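/- Let $K$ be a $p$-adic field, i.e. $[K:\mathbb{Q}_p]<\infty$, with valuation ring $R_K$, maximal ideal $P_K$, residue field of cardinality $q$, uniformizer $\pi$, normalized absolute value $|z|_K=q^{-\mathrm{ord}(z)}$ and angular component $\mathrm{ac}\,z=z\pi^{-\mathrm{ord}(z)}$. Let $2\le l\le n$, and let $f_1,\dots,f_l$ be power series in $n$ variables over $K$ with $f_i(0)=0$, each of them convenient (for every $t$, some power $x_t^{m}$ occurs in $f_i$ with non-zero coefficient). Then the following holds for every sufficiently small open neighbourhood $U\subseteq K^n$ of the origin on which all $f_i$ converge. For $j=l-1,l$ put $V^{(j)}=\{x\in U: f_1(x)=\dots=f_j(x)=0\}$. Assume: (a) for $j=l-1$ and $j=l$ the mapping $(f_1,\dots,f_j)$ is non-degenerate at the origin: for every $a\in\mathbb{R}^n$ with strictly positive coordinates and every $z\in (K^\times)^n\cap U$ with $f_{1,a}(z)=\dots=f_{j,a}(z)=0$, the matrix $[\partial f_{i,a}/\partial x_t(z)]_{1\le i\le j,\,1\le t\le n}$ has rank $\min\{j,n\}$, where $f_{i,a}$ is the sum of those monomials of $f_i$ whose exponents lie on the face of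 the Newton polyhedron of $f_i$ on which $\langle a,\cdot\rangle$ is minimal; (b) $V^{(l-1)}$ is a closed submanifold of $U$, i.e. $[\partial f_i/\partial x_t(z)]_{1\le i\le l-1,\,1\le t\le n}$ has rank $l-1$ for every $z\in V^{(l-1)}$; (c) for every $\lambda\in K^\times$ the $l$-form $\bigwedge_{i=1}^l df_i$ does not vanish at any point of $V^{(l,\lambda)}=\{z\in V^{(l-1)}: f_l(z)=\lambda\}$. Let $\Phi:K^n\to\mathbb{C}$ be a locally constant function with compact support contained in $U$. For a character $\chi$ of $R_K^\times$ let $Z_\Phi(s,\chi,V^{(l-1)},f_l)$ be the meromorphic continuation to $s\in\mathbb{C}$ of $$\int_{V^{(l-1)}}\Phi(x)\,\chi(\mathrm{ac}\,f_l(x))\,|f_l(x)|_K^s\,|\gamma_{GL}(x)|,\qquad \mathrm{Re}(s)>0,$$ where $|\gamma_{GL}|$ is the measure induced on $V^{(l-1)}$ by a Gel'fand–Leray form, i.e. a form with $\gamma_{GL}\wedge\bigwedge_{i=1}^{l-1}df_i=\bigwedge_{i=1}^n dx_i$. Then there is a positive integer $e(\Phi)$ such that, for every $\chi$, $Z_\Phi(s,\chi,V^{(l-1)},f_l)=0$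 for all $s\in\mathbb{C}$, unless the conductor of $\chi$ (the least $c\ge 1$ such that $\chi$ is trivial on $1+P_K^c$) is at most $e(\Phi)$. -/

import Mathlib

open MeasureTheory Filter Topology Set

noncomputable section

namespace PadicZeta

section Field

variable (K : Type*) [NontriviallyNormedField K] [IsUltrametricDist K]

/-- The cardinality `q` of the residue field `R_K / P_K`, where `R_K = {x | ‖x‖ ≤ 1}`. -/
def residueCard : ℕ :=
  Nat.card (IsLocalRing.ResidueField (NormedField.valuation (K := K)).valuationSubring)

variable {K}

/-- `π` generates the maximal ideal `P_K = {x | ‖x‖ < 1}`, and the norm of `K` is the normalized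
absolute value `|z|_K = q ^ (-ord z)`. -/
structure IsNormalizedUniformizer (π : K) : Prop where
  norm_eq : ‖π‖ = (residueCard K : ℝ)⁻¹
  generates : ∀ x : K, ‖x‖ < 1 → ‖x‖ ≤ ‖π‖

/-- The order of `z ≠ 0`: the integer with `‖z‖ = q ^ (-ord z)` (for the normalized norm). -/
def ord (z : K) : ℤ := -Int.log (residueCard K) ‖z‖

/-- The angular component `ac z = z π ^ (-ord z)`, a unit of `R_K` for `z ≠ 0`; `ac 0 = 0`. -/
def ac (π z : K) : K := z * π ^ (-ord z)

variable (K) in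
/-- The unit group `R_K^×`, that is, the group of elements of absolute value one. -/
abbrev UnitGroup : Type _ := Metric.sphere (0 : K) 1

open Classical in
/-- A character of `R_K^×`, extended by zero to `K`. -/
def extendChar (χ : UnitGroup K →ₜ* ℂˣ) (x : K) : ℂ :=
  if h : x ∈ Metric.sphere (0 : K) 1 then (χ ⟨x, h⟩ : ℂ) else 0

/-- The quasicharacter `ω(z) = χ(ac z) |z|_K ^ s` of `K^×`, with the value zero at `z = 0`. -/
def quasichar (π : K) (χ : UnitGroup K →ₜ* ℂˣ) (s : ℂ) (z : K) : ℂ :=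
  extendChar χ (ac π z) * (‖z‖ : ℂ) ^ s

/-- The conductor of `χ`: the least `c ≥ 1` such that `χ` is trivial on `1 + P_K ^ c`. -/
def conductor (χ : UnitGroup K →ₜ* ℂˣ) : ℕ :=
  sInf {c : ℕ | 1 ≤ c ∧
    ∀ u : UnitGroup K, ‖(u : K) - 1‖ ≤ ((residueCard K : ℝ)⁻¹) ^ c → χ u = 1}

end Field

section Series

variable {K : Type*} [NontriviallyNormedField K] {n : ℕ}

/-- The power series converges at every point of `U`. -/
def ConvergesOn (F : MvPowerSeries (Fin n) K) (U : Set (Fin n → K)) : Prop :=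
  ∀ x ∈ U, Summable fun m : Fin n →₀ ℕ => MvPowerSeries.coeff m F * m.prod fun j e => x j ^ e

/-- The function `x ↦ ∑ c_m x^m` defined by a power series. -/
def evalSeries (F : MvPowerSeries (Fin n) K) (x : Fin n → K) : K :=
  ∑' m : Fin n →₀ ℕ, MvPowerSeries.coeff m F * m.prod fun j e => x j ^ e

/-- The Jacobian matrix `[∂f_i/∂x_t]` at `x` of the functions defined by power series. -/
def jacobian {j : ℕ} (F : Fin j → MvPowerSeries (Fin n) K) (x : Fin n → K) :
    Matrix (Fin j) (Fin n) K :=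
  Matrix.of fun i t => fderiv K (evalSeries (F i)) x (Pi.single t 1)

/-- The differential `df` at `x` of the function defined by a power series. -/
def differential (F : MvPowerSeries (Fin n) K) (x : Fin n → K) : Module.Dual K (Fin n → K) :=
  (fderiv K (evalSeries F) x).toLinearMap

variable (K) in
/-- The coordinate differential `dx_t`. -/
def dx (t : Fin n) : Module.Dual K (Fin n → K) := LinearMap.proj t

/-- The common zero set in `U` of the functions defined by power series. -/
def zeroSet {j : ℕ} (F : Fin j → MvPowerSeries (Fin n) K) (U : Set (Fin n → K)) :
    Set (Fin n → K) :=
  {x | x ∈ U ∧ ∀ i, evalSeries (F i) x = 0}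

/-- The Newton polyhedron: the convex hull of the union of the `m + ℝ₊ⁿ`, `c_m ≠ 0`. -/
def newtonPolyhedron (F : MvPowerSeries (Fin n) K) : Set (Fin n → ℝ) :=
  convexHull ℝ {v | ∃ m : Fin n →₀ ℕ, MvPowerSeries.coeff m F ≠ 0 ∧ ∀ t, (m t : ℝ) ≤ v t}

/-- The first meet locus of `a`: the points of `Γ` at which `⟨a, ·⟩` attains its minimum on `Γ`. -/
def firstMeetLocus (a : Fin n → ℝ) (Γ : Set (Fin n → ℝ)) : Set (Fin n → ℝ) :=
  {x | x ∈ Γ ∧ ∀ y ∈ Γ, a ⬝ᵥ x ≤ a ⬝ᵥ y}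

open Classical in
/-- The face function `f_a`: the part of the series supported on the first meet locus of `a`. -/
def faceSeries (F : MvPowerSeries (Fin n) K) (a : Fin n → ℝ) : MvPowerSeries (Fin n) K :=
  fun m => if (fun t => (m t : ℝ)) ∈ firstMeetLocus a (newtonPolyhedron F)
    then MvPowerSeries.coeff m F else 0

/-- Non-degeneracy at the origin, on `U`, with respect to the Newton polyhedra of the components. -/
def IsNondegenerate {j : ℕ} (F : Fin j → MvPowerSeries (Fin n) K) (U : Set (Fin n → K)) : Prop :=
  ∀ a : Fin n → ℝ, (∀ t, 0 < a t) → ∀ z ∈ U, (∀ t, z t ≠ 0) →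
    (∀ i, evalSeries (faceSeries (F i) a) z = 0) →
      (jacobian (fun i => faceSeries (F i) a) z).rank = min j n

/-- Every component contains, for each `t`, a power of `x_t` with non-zero coefficient. -/
def IsConvenient {j : ℕ} (F : Fin j → MvPowerSeries (Fin n) K) : Prop :=
  ∀ i, ∀ t : Fin n, ∃ e : ℕ, 0 < e ∧ MvPowerSeries.coeff (Finsupp.single t e) (F i) ≠ 0

/-- `W` is an open set on which the coordinates `x_{J 1}, …, x_{J (n-k)}` are injective on
`V = {F = 0}`, and `γ = g dx_{J 1} ∧ ⋯ ∧ dx_{J (n-k)}` is a Gel'fand-Leray form along `V ∩ W`: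
`γ ∧ df_1 ∧ ⋯ ∧ df_k = dx_1 ∧ ⋯ ∧ dx_n`. The latter forces these coordinates to be local
coordinates of the manifold `V` at every point of `V ∩ W`. -/
structure IsGelfandLerayChart {k : ℕ} (F : Fin k → MvPowerSeries (Fin n) K) (U : Set (Fin n → K))
    (J : Fin (n - k) → Fin n) (W : Set (Fin n → K)) (g : (Fin n → K) → K) : Prop where
  isOpen : IsOpen W
  injOn : InjOn (fun x => x ∘ J) (zeroSet F U ∩ W)
  form : ∀ x ∈ zeroSet F U ∩ W,
    g x • (ExteriorAlgebra.ιMulti K (n - k) (fun t => dx K (J t)) *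
        ExteriorAlgebra.ιMulti K k (fun i => differential (F i) x)) =
      ExteriorAlgebra.ιMulti K n (fun t => dx K t)

variable [MeasurableSpace K]

/-- The measure on `V ∩ W` given by `|g| dx_{J 1} ⋯ dx_{J (n-k)}` in the coordinates
`x_{J 1}, …, x_{J (n-k)}`, as a measure on `Kⁿ`. -/
def chartMeasure {d : ℕ} (vol : Measure K) (V : Set (Fin n → K)) (J : Fin d → Fin n)
    (W : Set (Fin n → K)) (g : (Fin n → K) → K) : Measure (Fin n → K) :=
  ((Measure.comap (fun x : ↥(V ∩ W) => (x : Fin n → K) ∘ J)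
    (Measure.pi fun _ : Fin d => vol)).map Subtype.val).withDensity fun x => ‖g x‖ₑ

/-- The measure `|γ_GL|` on `V = {F = 0}` induced by a Gel'fand-Leray form. The chart measures are
its restrictions to the open pieces `V ∩ W`, and these cover `V` (the restriction of `γ_GL` to
`V` does not depend on any choice), so it is their supremum in the lattice of measures. -/
def gelfandLerayMeasure {k : ℕ} (vol : Measure K) (F : Fin k → MvPowerSeries (Fin n) K)
    (U : Set (Fin n → K)) : Measure (Fin n → K) :=
  ⨆ (J : Fin (n - k) → Fin n) (W : Set (Fin n → K)) (g : (Fin n → K) → K)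
    (_ : IsGelfandLerayChart F U J W g), chartMeasure vol (zeroSet F U) J W g

variable [IsUltrametricDist K]

/-- `Z` is the local zeta function `s ↦ Z_Φ(s, χ, V^{(l-1)}, f_l)`, `l = k + 1`: on `Re s > 0` it is
the (convergent) integral of `Φ(x) χ(ac f_l(x)) |f_l(x)|^s` over `V^{(l-1)}` with respect to
`|γ_GL|`, and on `ℂ` it is the meromorphic continuation of this integral (in normal form, that is,
with its true value at each regular point, and zero at the poles). -/
structure IsLocalZeta {k : ℕ} (vol : Measure K) (π : K)
    (F : Fin (k + 1) → MvPowerSeries (Fin n) K) (U : Set (Fin n → K)) (Φ : (Fin n → K) → ℂ)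
    (χ : UnitGroup K →ₜ* ℂˣ) (Z : ℂ → ℂ) : Prop where
  integrable : ∀ s : ℂ, 0 < s.re →
    Integrable (fun x => Φ x * quasichar π χ s (evalSeries (F (Fin.last k)) x))
      (gelfandLerayMeasure vol (fun i : Fin k => F i.castSucc) U)
  eq_integral : ∀ s : ℂ, 0 < s.re →
    Z s = ∫ x, Φ x * quasichar π χ s (evalSeries (F (Fin.last k)) x)
      ∂(gelfandLerayMeasure vol (fun i : Fin k => F i.castSucc) U)
  meromorphic : MeromorphicNFOn Z univ

end Series

end PadicZeta

end

open MeasureTheory Filter Topology Set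

noncomputable section

set_option linter.unusedSectionVars false

namespace PadicZeta

/-! The integral is cut into small pieces, each of which has a symmetry that multiplies f_l by a
unit ω and leaves f_1, …, f_{l-1}, Φ and the measure unchanged. The integral I over a piece then
satisfies I = χ(ω) I, so it vanishes once χ(ω) ≠ 1. The point is that a single group 1 + P_K^{e'} of
units ω serves all the pieces, although these accumulate at the origin.

The pieces are the multiplicative boxes |y_t - x_t| ≤ |π|^e max(|x_t|, |x|^{M+1}); they partition
the support of Φ without the origin. Scaling the coordinates by powers π^{a_t} turns a box into a
ball of radius |π|^e and f_i into a normalized series h_i(u) = π^{-d_i} f_i(π^a u), whose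
coefficients are bounded independently of the box. The heart is `exists_bounded_rightInverse`: at
the common zeros of h_1, …, h_{l-1}, the differential of (h_1, …, h_l) has a right inverse bounded
uniformly in the box. If not, take a sequence of counterexamples. Along an ultrafilter the
normalized series converge to rescaled face functions (`exists_limit_face`). Convenience gives d_i ≤
M a_t for every t, so a variable truncated at |x|^{M+1} drops out of the limit and its coordinate
can be set to 1; the limit point may thus be taken in the torus, where non-degeneracy applies. If
the face function of f_l vanishes there, non-degeneracy of the l-tuple gives a surjective
differential; if not, non-degeneracy of the (l-1)-tuple and Euler's identity do, and surjectivity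
persists near the limit with bounded right inverses.

With this bound a contraction argument makes (h_1, …, h_l) affine on the ball up to an isometry
(`exists_isometryEquiv_straighten`), so that multiplication of the last component by ω lifts to an
isometry of the ball. Isometries of an ultrametric space preserve Haar measure; this yields
`exists_box_symmetry`.

It remains to pass from Haar measure to |γ_GL|. The Gel'fand-Leray measure of a compact open set is
its intersection with the tube |f_1|, …, |f_{l-1}| ≤ |π|^N, measured by Haar measure and divided by
|π|^{N(l-1)}, for all large N (`isTubeVolume_gelfandLeray`). Hence it inherits the symmetry
(`gelfandLerayMeasure_inter_preimage`). Summing over the boxes gives zero for Re s > 0, and the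
identity theorem gives the rest. -/

theorem norm_sub_le_max {E : Type*} [SeminormedAddCommGroup E] [IsUltrametricDist E] (x y : E) :
    ‖x - y‖ ≤ max ‖x‖ ‖y‖ := by
  rw [sub_eq_add_neg, ← norm_neg y]
  exact IsUltrametricDist.norm_add_le_max x (-y)

/-! ### The discrete valuation and the residue classes. -/

section Uniformizer

variable {K : Type*} [NontriviallyNormedField K] [IsUltrametricDist K] {π : K}

theorem IsNormalizedUniformizer.norm_pos (hπ : IsNormalizedUniformizer π) : 0 < ‖π‖ := by
  rw [norm_pos_iff]
  rintro rfl
  obtain ⟨x, hx0, hx⟩ := NormedField.exists_norm_lt_one K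
  have := hπ.generates x hx
  rw [norm_zero] at this
  linarith

theorem IsNormalizedUniformizer.ne_zero (hπ : IsNormalizedUniformizer π) : π ≠ 0 :=
  norm_pos_iff.1 hπ.norm_pos

/-- `Nat.card` of an infinite residue field is 0, which would give ‖π‖ = 0; so the normalization of
‖π‖ already contains the finiteness of the residue field. -/
theorem IsNormalizedUniformizer.residueCard_pos (hπ : IsNormalizedUniformizer π) :
    0 < residueCard K := by
  have h := hπ.norm_pos
  rw [hπ.norm_eq, inv_pos] at h
  exact_mod_cast h

theorem IsNormalizedUniformizer.one_lt_residueCard (hπ : IsNormalizedUniformizer π) :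
    1 < residueCard K := by
  have h := hπ.residueCard_pos
  have : Finite (IsLocalRing.ResidueField (NormedField.valuation (K := K)).valuationSubring) :=
    (Nat.card_pos_iff.1 h).2
  exact Finite.one_lt_card

theorem IsNormalizedUniformizer.norm_lt_one (hπ : IsNormalizedUniformizer π) : ‖π‖ < 1 := by
  rw [hπ.norm_eq]
  exact inv_lt_one_of_one_lt₀ (by exact_mod_cast hπ.one_lt_residueCard)

/-- A power of π moves the norm of z into (‖π‖, 1], and no element has norm strictly between ‖π‖ and
1. -/
theorem IsNormalizedUniformizer.exists_norm_eq_zpow (hπ : IsNormalizedUniformizer π) {z : K}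
    (hz : z ≠ 0) : ∃ m : ℤ, ‖z‖ = ‖π‖ ^ m := by
  have hp := hπ.norm_pos
  have h1 := hπ.norm_lt_one
  obtain ⟨m, hm1, hm2⟩ := exists_mem_Ioc_zpow (norm_pos_iff.2 hz)
    ((one_lt_inv₀ hp).2 h1)
  refine ⟨-(m + 1), ?_⟩
  rw [inv_zpow, ← zpow_neg] at hm1 hm2
  have key : ‖z * π ^ (m + 1)‖ = 1 := by
    rw [norm_mul, norm_zpow]
    refine le_antisymm ?_ ?_
    · calc ‖z‖ * ‖π‖ ^ (m + 1) ≤ ‖π‖ ^ (-(m + 1)) * ‖π‖ ^ (m + 1) := by gcongr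
        _ = 1 := by rw [← zpow_add₀ hp.ne']; simp
    · by_contra! hlt
      have := hπ.generates (z * π ^ (m + 1)) (by rwa [norm_mul, norm_zpow])
      rw [norm_mul, norm_zpow] at this
      have h2 : ‖π‖ < ‖z‖ * ‖π‖ ^ (m + 1) := by
        calc ‖π‖ = ‖π‖ ^ (-m) * ‖π‖ ^ (m + 1) := by rw [← zpow_add₀ hp.ne']; simp
          _ < _ := by gcongr
      linarith
  rw [norm_mul, norm_zpow] at key
  rw [zpow_neg]
  exact eq_inv_of_mul_eq_one_left key

/-- Nonzero elements of norm at most one have norm a natural power of `‖π‖`. -/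
theorem IsNormalizedUniformizer.exists_norm_eq_pow (hπ : IsNormalizedUniformizer π) {z : K}
    (hz : z ≠ 0) (hz1 : ‖z‖ ≤ 1) : ∃ m : ℕ, ‖z‖ = ‖π‖ ^ m := by
  obtain ⟨m, hm⟩ := hπ.exists_norm_eq_zpow hz
  have : 0 ≤ m := by
    by_contra! hneg
    have : 1 < ‖π‖ ^ m := one_lt_zpow_of_neg₀ hπ.norm_pos hπ.norm_lt_one hneg
    linarith
  lift m to ℕ using this
  exact ⟨m, by simpa using hm⟩

open scoped Pointwise in
-- Reduces the effect of scaling by π on Haar measure to translation invariance: the unit ball is q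
-- disjoint translates of its image under π.
theorem exists_residue_transversal (hπ : IsNormalizedUniformizer π) :
    ∃ (σ : Fin (residueCard K) → K),
      (⋃ r, σ r +ᵥ Metric.closedBall (0 : K) ‖π‖) = Metric.closedBall (0 : K) 1 ∧
      Pairwise fun r s => Disjoint (σ r +ᵥ Metric.closedBall (0 : K) ‖π‖)
        (σ s +ᵥ Metric.closedBall (0 : K) ‖π‖) := by
  set R := (NormedField.valuation (K := K)).valuationSubring with hR
  have hmem : ∀ x : K, x ∈ R ↔ ‖x‖ ≤ 1 := fun x => by
    rw [hR, Valuation.mem_valuationSubring_iff, NormedField.valuation_apply]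
    exact Iff.rfl
  have hfin : Finite (IsLocalRing.ResidueField R) := (Nat.card_pos_iff.1 hπ.residueCard_pos).2
  have hsurj := IsLocalRing.residue_surjective (R := R)
  let τ := Function.surjInv hsurj
  have hτ : ∀ r, IsLocalRing.residue R (τ r) = r := Function.surjInv_eq hsurj
  have hunit : ∀ x : R, IsLocalRing.residue R x = 0 ↔ ‖(x : K)‖ ≤ ‖π‖ := fun x => by
    have h1 : IsLocalRing.residue R x = 0 ↔ ‖(x : K)‖ < 1 := by
      rw [IsLocalRing.residue_eq_zero_iff, Valuation.mem_maximalIdeal_iff,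
        NormedField.valuation_apply]
      exact Iff.rfl
    rw [h1]
    exact ⟨hπ.generates _, fun h => h.trans_lt hπ.norm_lt_one⟩
  let e : Fin (residueCard K) ≃ IsLocalRing.ResidueField R := (Finite.equivFin _).symm
  refine ⟨fun r => (τ (e r) : K), ?_, ?_⟩
  · ext x
    simp only [mem_iUnion, Set.mem_vadd_set_iff_neg_vadd_mem, Metric.mem_closedBall,
      dist_zero_right, vadd_eq_add]
    constructor
    · rintro ⟨r, hr⟩
      have h2 := (hmem _).1 (τ (e r)).2
      calc ‖x‖ = ‖-(τ (e r) : K) + x + (τ (e r) : K)‖ := by congr 1; ring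
        _ ≤ max _ _ := IsUltrametricDist.norm_add_le_max _ _
        _ ≤ 1 := max_le (hr.trans hπ.norm_lt_one.le) h2
    · intro hx
      refine ⟨e.symm (IsLocalRing.residue R ⟨x, (hmem x).2 hx⟩), ?_⟩
      rw [Equiv.apply_symm_apply]
      refine (hunit (-(τ (IsLocalRing.residue R ⟨x, (hmem x).2 hx⟩)) + ⟨x, (hmem x).2 hx⟩)).1 ?_
      rw [map_add, map_neg, hτ, neg_add_cancel]
  · intro r s hrs
    rw [Set.disjoint_left]
    intro x hr hs
    simp only [Set.mem_vadd_set_iff_neg_vadd_mem, Metric.mem_closedBall,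
      dist_zero_right, vadd_eq_add] at hr hs
    apply hrs
    apply e.injective
    have : IsLocalRing.residue R (τ (e r) - τ (e s)) = 0 := by
      rw [hunit]
      calc ‖((τ (e r) - τ (e s) : R) : K)‖ = ‖(-(τ (e s) : K) + x) - (-(τ (e r) : K) + x)‖ := by
            congr 1; push_cast; ring
        _ ≤ max ‖-(τ (e s) : K) + x‖ ‖-(τ (e r) : K) + x‖ := norm_sub_le_max _ _
        _ ≤ _ := max_le hs hr
    rw [map_sub, hτ, hτ, sub_eq_zero] at this
    exact this

end Uniformizer

/-! ### Linear change of variables for Haar measure on K^n. -/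

section Scaling

variable {K : Type*} [NontriviallyNormedField K] [IsUltrametricDist K] [ProperSpace K]
  [MeasurableSpace K] [BorelSpace K] {π : K}

open scoped Pointwise

theorem addHaar_closedBall_norm (hπ : IsNormalizedUniformizer π) (vol : Measure K)
    [vol.IsAddHaarMeasure] :
    residueCard K * vol (Metric.closedBall (0 : K) ‖π‖) = vol (Metric.closedBall (0 : K) 1) := by
  obtain ⟨σ, h1, h2⟩ := exists_residue_transversal hπ
  rw [← h1, measure_iUnion h2 fun r =>
    (Metric.isClosed_closedBall.measurableSet).const_vadd _]
  simp_rw [measure_vadd]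
  simp

/-- Both sides are multiplicative. Elements of norm one map the unit ball onto itself, and π maps it
onto one of the q cosets of equal measure that fill it. -/
theorem distribHaarChar_eq_nnnorm (hπ : IsNormalizedUniformizer π) (g : Kˣ) :
    distribHaarChar K g = ‖(g : K)‖₊ := by
  let vol : Measure K := Measure.addHaar
  have hB0 : vol (Metric.closedBall (0 : K) 1) ≠ 0 := (Metric.measure_closedBall_pos _ _ one_pos).ne'
  have hBt : vol (Metric.closedBall (0 : K) 1) ≠ ⊤ := measure_closedBall_lt_top.ne
  have hball : ∀ u : Kˣ, u • Metric.closedBall (0 : K) 1 = Metric.closedBall (0 : K) ‖(u : K)‖ := by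
    intro u
    have h := smul_closedBall (u : K) (0 : K) zero_le_one
    rw [smul_zero, mul_one] at h
    rw [← h]
    rfl
  have hunit : ∀ u : Kˣ, ‖(u : K)‖ = 1 → distribHaarChar K u = 1 := by
    intro u hu
    have := distribHaarChar_mul (μ := vol) u (Metric.closedBall (0 : K) 1)
    rw [hball, hu] at this
    have h2 := (ENNReal.mul_eq_right hB0 hBt).1 this
    exact_mod_cast h2
  set ϖ : Kˣ := Units.mk0 π hπ.ne_zero
  have hϖ : distribHaarChar K ϖ = ‖π‖₊ := by
    have h1 := distribHaarChar_mul (μ := vol) ϖ (Metric.closedBall (0 : K) 1)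
    rw [hball, ← addHaar_closedBall_norm hπ vol, ← mul_assoc] at h1
    have hv0 : vol (Metric.closedBall (0 : K) ‖π‖) ≠ 0 :=
      (Metric.measure_closedBall_pos _ _ hπ.norm_pos).ne'
    have hvt : vol (Metric.closedBall (0 : K) ‖π‖) ≠ ⊤ := measure_closedBall_lt_top.ne
    have h2 := (ENNReal.mul_eq_right hv0 hvt).1 h1
    have h3 : distribHaarChar K ϖ * (residueCard K : NNReal) = 1 := by exact_mod_cast h2
    have h4 : ‖π‖₊ = (residueCard K : NNReal)⁻¹ := by
      ext; simpa using hπ.norm_eq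
    rw [h4]
    exact eq_inv_of_mul_eq_one_left h3
  obtain ⟨m, hm⟩ := hπ.exists_norm_eq_zpow g.ne_zero
  have h5 := hunit (g * (ϖ ^ m)⁻¹) (by
    simp only [Units.val_mul, Units.val_inv_eq_inv_val, Units.val_zpow_eq_zpow_val, norm_mul,
      norm_inv, norm_zpow, hm, ϖ, Units.val_mk0]
    exact mul_inv_cancel₀ (zpow_ne_zero _ hπ.norm_pos.ne'))
  rw [map_mul, map_inv, map_zpow, hϖ] at h5
  have h6 := eq_of_mul_inv_eq_one h5
  rw [h6]
  ext
  simp [hm]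

theorem addHaar_preimage_mul_left (hπ : IsNormalizedUniformizer π) (vol : Measure K)
    [vol.IsAddHaarMeasure] {a : K} (ha : a ≠ 0) (s : Set K) :
    ‖a‖ₑ * vol ((a * ·) ⁻¹' s) = vol s := by
  have h1 := distribHaarChar_mul (μ := vol) (Units.mk0 a ha) ((a * ·) ⁻¹' s)
  rw [distribHaarChar_eq_nnnorm hπ] at h1
  have h2 : (Units.mk0 a ha) • ((a * ·) ⁻¹' s) = s := by
    ext x
    rw [Set.mem_smul_set_iff_inv_smul_mem]
    simp [Units.smul_def, ha]
  rw [h2] at h1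
  exact h1

open Matrix in
theorem smul_map_diagonal_pi {ι : Type*} [Fintype ι] [DecidableEq ι]
    (hπ : IsNormalizedUniformizer π) (vol : Measure K)
    [vol.IsAddHaarMeasure] {D : ι → K} (h : det (diagonal D) ≠ 0) :
    ‖det (diagonal D)‖ₑ • Measure.map (toLin' (diagonal D)) (Measure.pi fun _ => vol) =
      Measure.pi fun _ => vol := by
  refine (Measure.pi_eq fun s hs => ?_).symm
  simp only [det_diagonal, Measure.coe_smul, smul_eq_mul, Pi.smul_apply]
  rw [Measure.map_apply _ (MeasurableSet.univ_pi hs)]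
  swap; · exact Continuous.measurable (LinearMap.continuous_on_pi _)
  have :
    (Matrix.toLin' (diagonal D) ⁻¹' Set.pi Set.univ fun i : ι => s i) =
      Set.pi Set.univ fun i : ι => (D i * ·) ⁻¹' s i := by
    ext f
    simp only [LinearMap.coe_proj, smul_eq_mul, LinearMap.smul_apply, mem_univ_pi,
      mem_preimage, LinearMap.pi_apply, diagonal_toLin']
  have B : ∀ i, ‖D i‖ₑ * vol ((D i * ·) ⁻¹' s i) = vol (s i) := by
    intro i
    have A : D i ≠ 0 := by
      simp only [det_diagonal, Ne] at h
      exact Finset.prod_ne_zero_iff.1 h i (Finset.mem_univ i)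
    exact addHaar_preimage_mul_left hπ vol A _
  have hprod : ‖∏ i, D i‖ₑ = ∏ i, ‖D i‖ₑ := by
    simp [enorm_eq_nnnorm, nnnorm_prod]
  rw [this, Measure.pi_pi, hprod, ← Finset.prod_mul_distrib]
  simp only [B]

open Matrix in
-- A transvection translates one coordinate by an amount depending on another one, so integrating
-- over that coordinate first reduces to translation invariance.
theorem measurePreserving_transvectionStruct {ι : Type*} [Fintype ι] [DecidableEq ι]
    (vol : Measure K) [vol.IsAddHaarMeasure] (t : TransvectionStruct ι K) :
    MeasurePreserving (toLin' t.toMatrix) (Measure.pi fun _ => vol) (Measure.pi fun _ => vol) := by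
  have ht : Measurable (toLin' t.toMatrix) :=
    (LinearMap.continuous_on_pi (toLin' t.toMatrix)).measurable
  refine ⟨ht, ?_⟩
  refine (Measure.pi_eq fun s hs ↦ ?_).symm
  have h2s : MeasurableSet (univ.pi s) := .pi countable_univ fun i _ ↦ hs i
  simp_rw [← Measure.pi_pi, ← lintegral_indicator_one h2s]
  rw [lintegral_map (measurable_one.indicator h2s) ht]
  refine lintegral_eq_of_lmarginal_eq {t.i} ((measurable_one.indicator h2s).comp ht)
    (measurable_one.indicator h2s) ?_
  simp_rw [lmarginal_singleton]
  ext x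
  cases t with | mk t_i t_j t_hij t_c =>
  simp [transvection, single_mulVec, t_hij.symm, ← Function.update_add,
    lintegral_add_right_eq_self fun xᵢ ↦ indicator (univ.pi s) 1 (Function.update x t_i xᵢ)]

open Matrix in
/-- An invertible matrix rescales the product Haar measure by the norm of its determinant. -/
theorem smul_map_matrix_pi {ι : Type*} [Fintype ι] [DecidableEq ι]
    (hπ : IsNormalizedUniformizer π) (vol : Measure K)
    [vol.IsAddHaarMeasure] {M : Matrix ι ι K} (hM : det M ≠ 0) :
    ‖det M‖ₑ • Measure.map (toLin' M) (Measure.pi fun _ => vol) =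
      Measure.pi fun _ => vol := by
  apply diagonal_transvection_induction_of_det_ne_zero _ M hM
  · intro D hD
    exact smul_map_diagonal_pi hπ vol hD
  · intro t
    rw [(measurePreserving_transvectionStruct vol t).map_eq]
    simp
  · intro A B _ _ IHA IHB
    have hc : ∀ M : Matrix ι ι K, Measurable (toLin' M) :=
      fun M => (LinearMap.continuous_on_pi (toLin' M)).measurable
    rw [det_mul, enorm_mul, toLin'_mul, LinearMap.coe_comp, ← Measure.map_map (hc A) (hc B),
      mul_smul, ← Measure.map_smul, IHB, IHA]

open Matrix in
theorem pi_image_mulVec {ι : Type*} [Fintype ι] [DecidableEq ι]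
    (hπ : IsNormalizedUniformizer π) (vol : Measure K)
    [vol.IsAddHaarMeasure] {M : Matrix ι ι K} (hM : det M ≠ 0) {s : Set (ι → K)}
    (hs : MeasurableSet s) :
    ‖det M‖ₑ * Measure.pi (fun _ : ι => vol) ((M *ᵥ ·) ⁻¹' s) = Measure.pi (fun _ => vol) s := by
  conv_rhs => rw [← smul_map_matrix_pi hπ vol hM]
  rw [Measure.smul_apply, Measure.map_apply
    (LinearMap.continuous_on_pi (toLin' M)).measurable hs]
  rfl

end Scaling

/-! ### Isometries of ultrametric groups and Haar measure. -/

section Isometries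

variable {E : Type*} [NormedAddCommGroup E] [IsUltrametricDist E]

theorem norm_eq_of_norm_sub_lt {x y : E} (h : ‖x - y‖ < ‖y‖) : ‖x‖ = ‖y‖ := by
  refine le_antisymm ?_ ?_
  · calc ‖x‖ = ‖(x - y) + y‖ := by simp
      _ ≤ max ‖x - y‖ ‖y‖ := IsUltrametricDist.norm_add_le_max _ _
      _ = ‖y‖ := max_eq_right h.le
  · by_contra! hlt
    have : ‖y‖ ≤ max ‖x‖ ‖x - y‖ := by simpa using norm_sub_le_max x (x - y)
    exact absurd this (not_le.2 (max_lt hlt h))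

/-- A map that is near the identity on a closed ball agrees there with an isometry of the whole
space which preserves this ball. -/
theorem exists_isometryEquiv_of_near_id [CompleteSpace E] {φ : E → E} {z : E} {r κ : ℝ}
    (hκ : κ < 1)
    (h : ∀ x ∈ Metric.closedBall z r, ∀ y ∈ Metric.closedBall z r,
      ‖φ x - φ y - (x - y)‖ ≤ κ * ‖x - y‖) (hz : ‖φ z - z‖ ≤ r) :
    ∃ Ψ : E ≃ᵢ E, (∀ x ∈ Metric.closedBall z r, Ψ x = φ x) ∧
      ∀ x, Ψ x ∈ Metric.closedBall z r ↔ x ∈ Metric.closedBall z r := by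
  classical
  have hr : 0 ≤ r := (norm_nonneg _).trans hz
  have hzB : z ∈ Metric.closedBall z r := Metric.mem_closedBall_self hr
  have hiso : ∀ x ∈ Metric.closedBall z r, ∀ y ∈ Metric.closedBall z r,
      ‖φ x - φ y‖ = ‖x - y‖ := by
    intro x hx y hy
    rcases eq_or_ne x y with rfl | hxy
    · simp
    · have hpos : 0 < ‖x - y‖ := norm_pos_iff.2 (sub_ne_zero.2 hxy)
      refine norm_eq_of_norm_sub_lt ((h x hx y hy).trans_lt ?_)
      exact mul_lt_of_lt_one_left hpos hκ
  have hmaps : ∀ x ∈ Metric.closedBall z r, φ x ∈ Metric.closedBall z r := by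
    intro x hx
    rw [mem_closedBall_iff_norm] at hx ⊢
    calc ‖φ x - z‖ = ‖(φ x - φ z) + (φ z - z)‖ := by congr 1; abel
      _ ≤ max _ _ := IsUltrametricDist.norm_add_le_max _ _
      _ ≤ r := max_le ((hiso x (mem_closedBall_iff_norm.2 hx) z hzB).trans_le hx) hz
  have hsurj : ∀ y ∈ Metric.closedBall z r, ∃ x ∈ Metric.closedBall z r, φ x = y := by
    intro y hy
    -- Solutions of φ x = y are the fixed points of g, which contracts by κ on the ball.
    let g : E → E := fun x => y - (φ x - x)
    have hg : MapsTo g (Metric.closedBall z r) (Metric.closedBall z r) := by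
      intro x hx
      have h1 := hmaps x hx
      rw [mem_closedBall_iff_norm] at hx h1 hy ⊢
      calc ‖g x - z‖ = ‖(y - z) - ((φ x - z) - (x - z))‖ := by congr 1; simp only [g]; abel
        _ ≤ max _ _ := norm_sub_le_max _ _
        _ ≤ r := max_le hy ((norm_sub_le_max _ _).trans (max_le h1 hx))
    have hc : ContractingWith (Real.toNNReal κ) (hg.restrict g _ _) := by
      refine ⟨by simpa using hκ, LipschitzWith.of_dist_le_mul fun x x' => ?_⟩
      have h2 := h x x.2 x' x'.2
      rw [Subtype.dist_eq, Subtype.dist_eq, dist_eq_norm, dist_eq_norm]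
      calc ‖g x - g x'‖ = ‖φ x - φ x' - (x - x' : E)‖ := by
            rw [← norm_neg]; congr 1; simp only [g]; abel
        _ ≤ κ * ‖(x - x' : E)‖ := h2
        _ ≤ Real.toNNReal κ * ‖(x - x' : E)‖ := by
            gcongr; exact Real.le_coe_toNNReal κ
    obtain ⟨x, hx, hfix, -⟩ := hc.exists_fixedPoint' (Metric.isClosed_closedBall.isComplete) hg
      hzB (edist_ne_top _ _)
    refine ⟨x, hx, ?_⟩
    have h3 : y - (φ x - x) = x := hfix
    have h4 : y - φ x = 0 := by
      calc y - φ x = (y - (φ x - x)) - x := by abel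
        _ = 0 := by rw [h3, sub_self]
    exact (sub_eq_zero.1 h4).symm
  -- Extension by the identity remains isometric: the distance from an outside point to a point of
  -- the ball does not change when the latter moves within the ball.
  let Φ : E → E := fun x => if x ∈ Metric.closedBall z r then φ x else x
  have hin : ∀ x ∈ Metric.closedBall z r, Φ x = φ x := fun x hx => if_pos hx
  have hout : ∀ x ∉ Metric.closedBall z r, Φ x = x := fun x hx => if_neg hx
  have hcross : ∀ x ∈ Metric.closedBall z r, ∀ y ∉ Metric.closedBall z r,
      ‖φ x - y‖ = ‖x - y‖ := by
    intro x hx y hy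
    have h1 := hmaps x hx
    rw [mem_closedBall_iff_norm] at hx hy h1
    have h5 : r < ‖x - y‖ := by
      by_contra! hle
      apply hy
      calc ‖y - z‖ = ‖(x - z) - (x - y)‖ := by congr 1; abel
        _ ≤ max _ _ := norm_sub_le_max _ _
        _ ≤ r := max_le hx hle
    refine norm_eq_of_norm_sub_lt (lt_of_le_of_lt ?_ h5)
    calc ‖φ x - y - (x - y)‖ = ‖(φ x - z) - (x - z)‖ := by congr 1; abel
      _ ≤ max _ _ := norm_sub_le_max _ _
      _ ≤ r := max_le h1 hx
  have hΦ : Isometry Φ := by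
    refine Isometry.of_dist_eq fun x y => ?_
    rw [dist_eq_norm, dist_eq_norm]
    by_cases hx : x ∈ Metric.closedBall z r <;> by_cases hy : y ∈ Metric.closedBall z r
    · rw [hin x hx, hin y hy, hiso x hx y hy]
    · rw [hin x hx, hout y hy, hcross x hx y hy]
    · rw [hout x hx, hin y hy, norm_sub_rev, hcross y hy x hx, norm_sub_rev]
    · rw [hout x hx, hout y hy]
  have hΦs : Function.Surjective Φ := by
    intro y
    by_cases hy : y ∈ Metric.closedBall z r
    · obtain ⟨x, hx, hxy⟩ := hsurj y hy
      exact ⟨x, (hin x hx).trans hxy⟩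
    · exact ⟨y, hout y hy⟩
  refine ⟨⟨Equiv.ofBijective Φ ⟨hΦ.injective, hΦs⟩, hΦ⟩, hin, fun x => ?_⟩
  change Φ x ∈ _ ↔ _
  by_cases hx : x ∈ Metric.closedBall z r
  · rw [hin x hx]
    exact iff_of_true (hmaps x hx) hx
  · rw [hout x hx]

theorem borel_eq_generateFrom_closedBall [SecondCountableTopology E] [mE : MeasurableSpace E]
    [BorelSpace E] : mE = MeasurableSpace.generateFrom
      {s | ∃ (x : E) (r : ℝ), 0 < r ∧ s = Metric.closedBall x r} := by
  have hb : TopologicalSpace.IsTopologicalBasis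
      {s | ∃ (x : E) (r : ℝ), 0 < r ∧ s = Metric.closedBall x r} := by
    refine TopologicalSpace.isTopologicalBasis_of_isOpen_of_nhds ?_ ?_
    · rintro _ ⟨x, r, hr, rfl⟩
      exact IsUltrametricDist.isOpen_closedBall x hr.ne'
    · intro x u hx hu
      obtain ⟨r, hr, hru⟩ := Metric.nhds_basis_closedBall.mem_iff.1 (hu.mem_nhds hx)
      exact ⟨_, ⟨x, r, hr, rfl⟩, Metric.mem_closedBall_self hr.le, hru⟩
  rw [BorelSpace.measurable_eq (α := E)]
  exact hb.borel_eq_generateFrom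

theorem isPiSystem_closedBall :
    IsPiSystem {s | ∃ (x : E) (r : ℝ), 0 < r ∧ s = Metric.closedBall x r} := by
  rintro _ ⟨x, r, hr, rfl⟩ _ ⟨y, s, hs, rfl⟩ hne
  rcases IsUltrametricDist.closedBall_subset_trichotomy (x := x) (y := y) (r := r) (s := s)
    with h | h | h
  · exact ⟨x, r, hr, inter_eq_left.2 h⟩
  · exact ⟨y, s, hs, inter_eq_right.2 h⟩
  · exact absurd (disjoint_iff_inter_eq_empty.1 h) hne.ne_empty

/-- Isometries of an ultrametric group preserve Haar measure. -/
theorem measurePreserving_isometryEquiv [ProperSpace E] [MeasurableSpace E]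
    [BorelSpace E] (μ : Measure E) [μ.IsAddHaarMeasure] (Ψ : E ≃ᵢ E) :
    MeasurePreserving Ψ μ μ := by
  have : SecondCountableTopology E := secondCountable_of_proper
  refine ⟨Ψ.continuous.measurable, ?_⟩
  have hball : ∀ (x : E) (r : ℝ),
      μ.map Ψ (Metric.closedBall x r) = μ (Metric.closedBall x r) := by
    intro x r
    rw [Measure.map_apply Ψ.continuous.measurable Metric.isClosed_closedBall.measurableSet,
      IsometryEquiv.preimage_closedBall, Measure.addHaar_closedBall_center,
      Measure.addHaar_closedBall_center μ x]
  -- Balls form a generating π-system, and the Haar measure of a ball depends only on its radius.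
  refine Measure.ext_of_generateFrom_of_iUnion _ (fun n : ℕ => Metric.closedBall 0 (n + 1))
    borel_eq_generateFrom_closedBall isPiSystem_closedBall ?_ (fun n => ⟨0, n + 1, by positivity, rfl⟩)
    ?_ ?_
  · refine iUnion_eq_univ_iff.2 fun x => ?_
    obtain ⟨n, hn⟩ := exists_nat_ge ‖x‖
    exact ⟨n, by rw [mem_closedBall_zero_iff]; linarith⟩
  · intro n
    rw [hball]
    exact measure_closedBall_lt_top.ne
  · rintro _ ⟨x, r, -, rfl⟩
    exact hball x r

/-- Two measures agree on a compact open set if they agree on its compact open subsets. -/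
theorem restrict_eq_of_forall_isCompact_isOpen [ProperSpace E] [MeasurableSpace E]
    [BorelSpace E] {μ ν : Measure E} {B : Set E} (hB : IsCompact B) (hBo : IsOpen B)
    (hfin : μ B ≠ ⊤) (h : ∀ S ⊆ B, IsCompact S → IsOpen S → μ S = ν S) :
    μ.restrict B = ν.restrict B := by
  have : SecondCountableTopology E := secondCountable_of_proper
  have : IsFiniteMeasure (μ.restrict B) := ⟨by rw [Measure.restrict_apply_univ]; exact hfin.lt_top⟩
  refine ext_of_generate_finite _ borel_eq_generateFrom_closedBall isPiSystem_closedBall ?_ ?_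
  · rintro _ ⟨x, r, hr, rfl⟩
    rw [Measure.restrict_apply Metric.isClosed_closedBall.measurableSet,
      Measure.restrict_apply Metric.isClosed_closedBall.measurableSet]
    exact h _ inter_subset_right (hB.inter_left Metric.isClosed_closedBall)
      ((IsUltrametricDist.isOpen_closedBall x hr.ne').inter hBo)
  · rw [Measure.restrict_apply_univ, Measure.restrict_apply_univ]
    exact h B subset_rfl hB hBo

end Isometries

/-! ### Taylor estimates for power series on the unit polydisc. -/

section RestrictedSeries

variable {K : Type*} [NontriviallyNormedField K] [IsUltrametricDist K] {n : ℕ}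

open MvPolynomial in
-- The bounds are proved together because together they are stable under products, which reduces
-- them to powers of one variable. There the remainder is handled by induction on the exponent, with
-- integers of norm at most one.
theorem norm_eval_monomial_bounds (m : Fin n →₀ ℕ) {u v : Fin n → K} (hu : ‖u‖ ≤ 1)
    (hv : ‖v‖ ≤ 1) :
    ‖eval u (monomial m (1 : K))‖ ≤ 1 ∧ (∀ t, ‖eval v (pderiv t (monomial m (1 : K)))‖ ≤ 1) ∧
      ‖eval u (monomial m (1 : K)) - eval v (monomial m (1 : K)) -
        ∑ t, eval v (pderiv t (monomial m (1 : K))) * (u t - v t)‖ ≤ ‖u - v‖ ^ 2 := by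
  have hut : ∀ t, ‖u t‖ ≤ 1 := fun t => (norm_le_pi_norm u t).trans hu
  have hvt : ∀ t, ‖v t‖ ≤ 1 := fun t => (norm_le_pi_norm v t).trans hv
  have huv : ∀ t, ‖u t - v t‖ ≤ ‖u - v‖ := fun t => norm_le_pi_norm (u - v) t
  suffices H : ∀ p : MvPolynomial (Fin n) K, (∃ m, p = monomial m 1) →
      ‖eval u p‖ ≤ 1 ∧ ‖eval v p‖ ≤ 1 ∧ (∀ t, ‖eval v (pderiv t p)‖ ≤ 1) ∧
      ‖eval u p - eval v p - ∑ t, eval v (pderiv t p) * (u t - v t)‖ ≤ ‖u - v‖ ^ 2 by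
    obtain ⟨h1, -, h3⟩ := H (monomial m 1) ⟨m, rfl⟩
    exact ⟨h1, h3⟩
  rintro p ⟨m, rfl⟩
  induction m using Finsupp.induction_linear with
  | zero =>
    have : (monomial (0 : Fin n →₀ ℕ) (1 : K)) = 1 := rfl
    simp only [this, map_one, norm_one, sub_self, Derivation.map_one_eq_zero, map_zero, norm_zero,
      zero_mul, Finset.sum_const_zero, le_refl, zero_le_one, implies_true, true_and]
    positivity
  | add a b ha hb =>
    have hab : (monomial (a + b) (1 : K)) = monomial a 1 * monomial b 1 := by
      simp [monomial_mul]
    rw [hab]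
    set p := monomial a (1 : K)
    set q := monomial b (1 : K)
    obtain ⟨ha1, ha2, ha3, ha4⟩ := ha
    obtain ⟨hb1, hb2, hb3, hb4⟩ := hb
    refine ⟨?_, ?_, ?_, ?_⟩
    · rw [map_mul, norm_mul]; exact mul_le_one₀ ha1 (norm_nonneg _) hb1
    · rw [map_mul, norm_mul]; exact mul_le_one₀ ha2 (norm_nonneg _) hb2
    · intro t
      rw [Derivation.leibniz, map_add, smul_eq_mul, smul_eq_mul, map_mul, map_mul]
      refine (IsUltrametricDist.norm_add_le_max _ _).trans (max_le ?_ ?_)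
      · rw [norm_mul]; exact mul_le_one₀ ha2 (norm_nonneg _) (hb3 t)
      · rw [norm_mul]; exact mul_le_one₀ hb2 (norm_nonneg _) (ha3 t)
    · set dp := ∑ t, eval v (pderiv t p) * (u t - v t)
      set dq := ∑ t, eval v (pderiv t q) * (u t - v t)
      have hd : ∑ t, eval v (pderiv t (p * q)) * (u t - v t) = eval v p * dq + eval v q * dp := by
        rw [Finset.mul_sum, Finset.mul_sum, ← Finset.sum_add_distrib]
        refine Finset.sum_congr rfl fun t _ => ?_
        rw [Derivation.leibniz, map_add, smul_eq_mul, smul_eq_mul, map_mul, map_mul]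
        ring
      have hdp : ‖dp‖ ≤ ‖u - v‖ := by
        refine IsUltrametricDist.norm_sum_le_of_forall_le_of_nonneg (norm_nonneg _) fun t _ => ?_
        rw [norm_mul]
        calc _ ≤ 1 * ‖u - v‖ := by gcongr; exacts [ha3 t, huv t]
          _ = _ := one_mul _
      have hdq : ‖dq‖ ≤ ‖u - v‖ := by
        refine IsUltrametricDist.norm_sum_le_of_forall_le_of_nonneg (norm_nonneg _) fun t _ => ?_
        rw [norm_mul]
        calc _ ≤ 1 * ‖u - v‖ := by gcongr; exacts [hb3 t, huv t]
          _ = _ := one_mul _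
      have huv1 : ‖u - v‖ ≤ 1 := (norm_sub_le_max u v).trans (max_le hu hv)
      have hsq : ‖u - v‖ ^ 2 ≤ ‖u - v‖ := by
        rw [sq]; exact mul_le_of_le_one_left (norm_nonneg _) huv1
      have hq : ‖eval u q - eval v q‖ ≤ ‖u - v‖ := by
        calc ‖eval u q - eval v q‖ = ‖(eval u q - eval v q - dq) + dq‖ := by congr 1; ring
          _ ≤ max _ _ := IsUltrametricDist.norm_add_le_max _ _
          _ ≤ _ := max_le (hb4.trans hsq) hdq
      rw [hd, map_mul, map_mul]
      -- The remainder of a product, in terms of the remainders of the factors and one product of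
      -- two first-order terms.
      have e : eval u p * eval u q - eval v p * eval v q - (eval v p * dq + eval v q * dp) =
          (eval u p - eval v p - dp) * eval u q +
            (dp * (eval u q - eval v q) + eval v p * (eval u q - eval v q - dq)) := by ring
      rw [e]
      refine (IsUltrametricDist.norm_add_le_max _ _).trans (max_le ?_
        ((IsUltrametricDist.norm_add_le_max _ _).trans (max_le ?_ ?_)))
      · rw [norm_mul]
        calc _ ≤ ‖u - v‖ ^ 2 * 1 := by gcongr
          _ = _ := mul_one _
      · rw [norm_mul, sq]; gcongr
      · rw [norm_mul]
        calc _ ≤ 1 * ‖u - v‖ ^ 2 := by gcongr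
          _ = _ := one_mul _
  | single i e =>
    have hX : ∀ e : ℕ, monomial (Finsupp.single i e) (1 : K) = X i ^ e := fun e => by
      rw [X_pow_eq_monomial]
    rw [hX]
    have hd : ∀ t (w : Fin n → K), eval w (pderiv t (X i ^ e)) =
        if t = i then (e : K) * w i ^ (e - 1) else 0 := by
      intro t w
      rw [Derivation.leibniz_pow, pderiv_X]
      by_cases h : t = i
      · subst h; simp
      · simp [h]
    have hsum : ∑ t, eval v (pderiv t (X i ^ e)) * (u t - v t) =
        (e : K) * v i ^ (e - 1) * (u i - v i) := by
      simp_rw [hd, ite_mul, zero_mul]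
      rw [Finset.sum_ite_eq' Finset.univ i, if_pos (Finset.mem_univ i)]
    have hpow : ∀ {x : K} (j : ℕ), ‖x‖ ≤ 1 → ‖x ^ j‖ ≤ 1 := fun j hx => by
      rw [norm_pow]; exact pow_le_one₀ (norm_nonneg _) hx
    refine ⟨?_, ?_, ?_, ?_⟩
    · simpa using hpow e (hut i)
    · simpa using hpow e (hvt i)
    · intro t
      rw [hd]
      split_ifs
      · rw [norm_mul]
        exact mul_le_one₀ (IsUltrametricDist.norm_natCast_le_one K e) (norm_nonneg _)
          (hpow _ (hvt i))
      · simp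
    · rw [hsum]
      simp only [map_pow, eval_X]
      have key : ∀ e : ℕ, ‖u i ^ e - v i ^ e - (e : K) * v i ^ (e - 1) * (u i - v i)‖ ≤
          ‖u i - v i‖ ^ 2 := by
        intro e
        induction e with
        | zero => simp
        | succ e ih =>
          have hs : (e : K) * v i ^ (e - 1) * v i = e * v i ^ e := by
            rcases e with _ | e
            · simp
            · simp [pow_succ, mul_assoc]
          have e1 : u i ^ (e + 1) - v i ^ (e + 1) -
              ((e + 1 : ℕ) : K) * v i ^ (e + 1 - 1) * (u i - v i) =
              u i * (u i ^ e - v i ^ e - (e : K) * v i ^ (e - 1) * (u i - v i)) +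
                (e : K) * v i ^ (e - 1) * (u i - v i) ^ 2 := by
            simp only [Nat.add_sub_cancel]
            push_cast
            linear_combination (u i - v i) * hs
          rw [e1]
          refine (IsUltrametricDist.norm_add_le_max _ _).trans (max_le ?_ ?_)
          · rw [norm_mul]
            calc _ ≤ 1 * ‖u i - v i‖ ^ 2 := by gcongr; exact hut i
              _ = _ := one_mul _
          · rw [norm_mul, norm_pow]
            refine mul_le_of_le_one_left (by positivity) ?_
            rw [norm_mul]
            exact mul_le_one₀ (IsUltrametricDist.norm_natCast_le_one K e) (norm_nonneg _)
              (hpow _ (hvt i))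
      refine (key e).trans ?_
      gcongr
      exact huv i

/-- The power series converges on the closed unit polydisc. -/
def IsRestricted (F : MvPowerSeries (Fin n) K) : Prop :=
  Tendsto (fun m => MvPowerSeries.coeff m F) cofinite (𝓝 0)

/-- The value at `v` of the partial derivative of a power series. -/
def partialDeriv (F : MvPowerSeries (Fin n) K) (t : Fin n) (v : Fin n → K) : K :=
  ∑' m : Fin n →₀ ℕ, MvPowerSeries.coeff m F *
    MvPolynomial.eval v (MvPolynomial.pderiv t (MvPolynomial.monomial m (1 : K)))

/-- The total derivative at `v` of a power series, as a continuous linear form. -/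
def totalDeriv (F : MvPowerSeries (Fin n) K) (v : Fin n → K) : (Fin n → K) →L[K] K :=
  ∑ t, partialDeriv F t v • ContinuousLinearMap.proj t

theorem totalDeriv_apply (F : MvPowerSeries (Fin n) K) (v w : Fin n → K) :
    totalDeriv F v w = ∑ t, partialDeriv F t v * w t := by
  simp [totalDeriv]

theorem evalSeries_eq (F : MvPowerSeries (Fin n) K) (x : Fin n → K) :
    evalSeries F x = ∑' m : Fin n →₀ ℕ, MvPowerSeries.coeff m F *
      MvPolynomial.eval x (MvPolynomial.monomial m (1 : K)) := by
  simp [evalSeries, MvPolynomial.eval_monomial]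

variable [CompleteSpace K]

theorem IsRestricted.summable_mul {F : MvPowerSeries (Fin n) K} (hF : IsRestricted F)
    {b : (Fin n →₀ ℕ) → K} (hb : ∀ m, ‖b m‖ ≤ 1) :
    Summable fun m => MvPowerSeries.coeff m F * b m := by
  refine NonarchimedeanAddGroup.summable_of_tendsto_cofinite_zero ?_
  rw [tendsto_zero_iff_norm_tendsto_zero]
  refine squeeze_zero (fun _ => norm_nonneg _) (fun m => ?_) (tendsto_zero_iff_norm_tendsto_zero.1 hF)
  rw [norm_mul]
  exact mul_le_of_le_one_right (norm_nonneg _) (hb m)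

theorem norm_tsum_coeff_mul_le {F : MvPowerSeries (Fin n) K} {C : ℝ} (hC : 0 ≤ C)
    (hFC : ∀ m, ‖MvPowerSeries.coeff m F‖ ≤ C) {b : (Fin n →₀ ℕ) → K} {δ : ℝ}
    (hb : ∀ m, ‖b m‖ ≤ δ) : ‖∑' m, MvPowerSeries.coeff m F * b m‖ ≤ C * δ := by
  have hδ : 0 ≤ δ := (norm_nonneg _).trans (hb 0)
  refine IsUltrametricDist.norm_tsum_le_of_forall_le_of_nonneg (by positivity) fun m => ?_
  rw [norm_mul]
  gcongr
  exacts [hFC m, hb m]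

theorem norm_evalSeries_le {F : MvPowerSeries (Fin n) K} {C : ℝ} (hC : 0 ≤ C)
    (hFC : ∀ m, ‖MvPowerSeries.coeff m F‖ ≤ C) {u : Fin n → K} (hu : ‖u‖ ≤ 1) :
    ‖evalSeries F u‖ ≤ C := by
  rw [evalSeries_eq]
  simpa using norm_tsum_coeff_mul_le hC hFC fun m => (norm_eval_monomial_bounds m hu hu).1

theorem norm_partialDeriv_le {F : MvPowerSeries (Fin n) K} {C : ℝ} (hC : 0 ≤ C)
    (hFC : ∀ m, ‖MvPowerSeries.coeff m F‖ ≤ C) {u : Fin n → K} (hu : ‖u‖ ≤ 1) (t : Fin n) :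
    ‖partialDeriv F t u‖ ≤ C := by
  have h := norm_tsum_coeff_mul_le hC hFC fun m => (norm_eval_monomial_bounds m hu hu).2.1 t
  rwa [mul_one] at h

theorem norm_totalDeriv_apply_le {F : MvPowerSeries (Fin n) K} {C : ℝ} (hC : 0 ≤ C)
    (hFC : ∀ m, ‖MvPowerSeries.coeff m F‖ ≤ C) {u : Fin n → K} (hu : ‖u‖ ≤ 1) (w : Fin n → K) :
    ‖totalDeriv F u w‖ ≤ C * ‖w‖ := by
  rw [totalDeriv_apply]
  refine IsUltrametricDist.norm_sum_le_of_forall_le_of_nonneg (by positivity) fun t _ => ?_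
  rw [norm_mul]
  gcongr
  exacts [norm_partialDeriv_le hC hFC hu t, norm_le_pi_norm w t]

theorem evalSeries_taylor {F : MvPowerSeries (Fin n) K} (hF : IsRestricted F) {C : ℝ}
    (hC : 0 ≤ C) (hFC : ∀ m, ‖MvPowerSeries.coeff m F‖ ≤ C) {u v : Fin n → K} (hu : ‖u‖ ≤ 1)
    (hv : ‖v‖ ≤ 1) :
    ‖evalSeries F u - evalSeries F v - totalDeriv F v (u - v)‖ ≤ C * ‖u - v‖ ^ 2 := by
  have s1 := hF.summable_mul fun m => (norm_eval_monomial_bounds m hu hu).1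
  have s2 := hF.summable_mul fun m => (norm_eval_monomial_bounds m hv hv).1
  have s3 : ∀ t, Summable fun m => MvPowerSeries.coeff m F *
      MvPolynomial.eval v (MvPolynomial.pderiv t (MvPolynomial.monomial m (1 : K))) * (u - v) t :=
    fun t => (hF.summable_mul fun m => (norm_eval_monomial_bounds m hv hv).2.1 t).mul_right _
  have e : evalSeries F u - evalSeries F v - totalDeriv F v (u - v) =
      ∑' m, MvPowerSeries.coeff m F * (MvPolynomial.eval u (MvPolynomial.monomial m (1 : K)) -
        MvPolynomial.eval v (MvPolynomial.monomial m (1 : K)) -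
        ∑ t, MvPolynomial.eval v (MvPolynomial.pderiv t (MvPolynomial.monomial m (1 : K))) *
          (u t - v t)) := by
    rw [evalSeries_eq, evalSeries_eq, totalDeriv_apply]
    simp only [partialDeriv]
    simp_rw [← tsum_mul_right]
    rw [← s1.tsum_sub s2, ← Summable.tsum_finsetSum (fun t _ => s3 t),
      ← (s1.sub s2).tsum_sub (summable_sum fun t _ => s3 t)]
    refine tsum_congr fun m => ?_
    rw [mul_sub, mul_sub, Finset.mul_sum]
    simp [mul_assoc]
  rw [e]
  exact norm_tsum_coeff_mul_le hC hFC fun m => (norm_eval_monomial_bounds m hu hv).2.2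

theorem norm_partialDeriv_sub_le {F : MvPowerSeries (Fin n) K} (hF : IsRestricted F) {C : ℝ}
    (hC : 0 ≤ C) (hFC : ∀ m, ‖MvPowerSeries.coeff m F‖ ≤ C) {u v : Fin n → K} (hu : ‖u‖ ≤ 1)
    (hv : ‖v‖ ≤ 1) (t : Fin n) :
    ‖partialDeriv F t u - partialDeriv F t v‖ ≤ C * ‖u - v‖ := by
  have s : ∀ {w : Fin n → K}, ‖w‖ ≤ 1 → _ :=
    fun {w} hw => hF.summable_mul fun m => (norm_eval_monomial_bounds m hw hw).2.1 t
  rw [partialDeriv, partialDeriv, ← (s hu).tsum_sub (s hv)]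
  simp_rw [← mul_sub]
  refine norm_tsum_coeff_mul_le hC hFC fun m => ?_
  have huv1 : ‖u - v‖ ≤ 1 := (norm_sub_le_max u v).trans (max_le hu hv)
  have hm : ∀ m : Fin n →₀ ℕ, ‖MvPolynomial.eval u (MvPolynomial.monomial m (1 : K)) -
      MvPolynomial.eval v (MvPolynomial.monomial m (1 : K))‖ ≤ ‖u - v‖ := by
    intro m
    obtain ⟨-, -, h3⟩ := norm_eval_monomial_bounds m hu hv
    obtain ⟨-, h2, -⟩ := norm_eval_monomial_bounds m hv hv
    set d := ∑ t, MvPolynomial.eval v (MvPolynomial.pderiv t (MvPolynomial.monomial m (1 : K))) *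
      (u t - v t)
    have hd : ‖d‖ ≤ ‖u - v‖ := by
      refine IsUltrametricDist.norm_sum_le_of_forall_le_of_nonneg (norm_nonneg _) fun t _ => ?_
      rw [norm_mul]
      calc _ ≤ 1 * ‖u - v‖ := by gcongr; exacts [h2 t, norm_le_pi_norm (u - v) t]
        _ = _ := one_mul _
    calc _ = ‖(MvPolynomial.eval u (MvPolynomial.monomial m (1 : K)) -
          MvPolynomial.eval v (MvPolynomial.monomial m (1 : K)) - d) + d‖ := by congr 1; ring
      _ ≤ max _ _ := IsUltrametricDist.norm_add_le_max _ _
      _ ≤ ‖u - v‖ := max_le (h3.trans (by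
        rw [sq]; exact mul_le_of_le_one_left (norm_nonneg _) huv1)) hd
  -- The derivative of a monomial is an integer times a monomial, so the Lipschitz bound for
  -- monomials suffices.
  have hpd : MvPolynomial.pderiv t (MvPolynomial.monomial m (1 : K)) =
      MvPolynomial.C (m t : K) * MvPolynomial.monomial (m - Finsupp.single t 1) (1 : K) := by
    rw [MvPolynomial.pderiv_monomial, MvPolynomial.C_mul_monomial]
    simp
  rw [hpd, map_mul, map_mul, MvPolynomial.eval_C, MvPolynomial.eval_C, ← mul_sub, norm_mul]
  calc _ ≤ 1 * ‖u - v‖ := by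
        gcongr
        exacts [IsUltrametricDist.norm_natCast_le_one K _, hm _]
    _ = _ := one_mul _

theorem norm_totalDeriv_sub_apply_le {F : MvPowerSeries (Fin n) K} (hF : IsRestricted F) {C : ℝ}
    (hC : 0 ≤ C) (hFC : ∀ m, ‖MvPowerSeries.coeff m F‖ ≤ C) {u v : Fin n → K} (hu : ‖u‖ ≤ 1)
    (hv : ‖v‖ ≤ 1) (w : Fin n → K) :
    ‖totalDeriv F u w - totalDeriv F v w‖ ≤ C * ‖u - v‖ * ‖w‖ := by
  rw [totalDeriv_apply, totalDeriv_apply, ← Finset.sum_sub_distrib]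
  refine IsUltrametricDist.norm_sum_le_of_forall_le_of_nonneg (by positivity) fun t _ => ?_
  rw [← sub_mul, norm_mul]
  gcongr
  exacts [norm_partialDeriv_sub_le hF hC hFC hu hv t, norm_le_pi_norm w t]

theorem IsRestricted.exists_norm_coeff_le {F : MvPowerSeries (Fin n) K} (hF : IsRestricted F) :
    ∃ C : ℝ, 0 < C ∧ ∀ m, ‖MvPowerSeries.coeff m F‖ ≤ C := by
  have h1 : ∀ᶠ m in cofinite, ‖MvPowerSeries.coeff m F‖ ≤ 1 :=
    ((tendsto_zero_iff_norm_tendsto_zero.1 hF).eventually_lt_const one_pos).mono fun _ h => h.le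
  have hfin : {m | ¬ ‖MvPowerSeries.coeff m F‖ ≤ 1}.Finite := h1
  obtain ⟨C, hC⟩ := (hfin.image fun m => ‖MvPowerSeries.coeff m F‖).bddAbove
  refine ⟨max C 1, by positivity, fun m => ?_⟩
  by_cases h : ‖MvPowerSeries.coeff m F‖ ≤ 1
  · exact h.trans (le_max_right _ _)
  · exact (hC ⟨m, h, rfl⟩).trans (le_max_left _ _)

theorem IsRestricted.hasFDerivAt {F : MvPowerSeries (Fin n) K} (hF : IsRestricted F)
    {v : Fin n → K} (hv : ‖v‖ ≤ 1) : HasFDerivAt (evalSeries F) (totalDeriv F v) v := by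
  obtain ⟨C, hC, hFC⟩ := hF.exists_norm_coeff_le
  rw [hasFDerivAt_iff_isLittleO, Asymptotics.isLittleO_iff]
  intro c hc
  have h1 : ∀ᶠ x in 𝓝 v, ‖x‖ ≤ 1 := by
    have := (IsUltrametricDist.isOpen_closedBall (0 : Fin n → K) one_ne_zero).mem_nhds
      (mem_closedBall_zero_iff.2 hv)
    filter_upwards [this] with x hx
    exact mem_closedBall_zero_iff.1 hx
  filter_upwards [h1, Metric.closedBall_mem_nhds v (show 0 < c / C by positivity)] with x hx hxc
  refine (evalSeries_taylor hF hC.le hFC hx hv).trans ?_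
  rw [mem_closedBall_iff_norm, le_div_iff₀ hC] at hxc
  calc C * ‖x - v‖ ^ 2 = ‖x - v‖ * C * ‖x - v‖ := by ring
    _ ≤ c * ‖x - v‖ := by gcongr

end RestrictedSeries

/-! ### Diagonal rescaling, ranks of Jacobians and Euler's identity. -/

section Rescaling

variable {K : Type*} [NontriviallyNormedField K] {n : ℕ}

theorem evalSeries_smul_rescale (c : K) (b : Fin n → K) (F : MvPowerSeries (Fin n) K)
    (u : Fin n → K) :
    evalSeries (c • MvPowerSeries.rescale b F) u = c * evalSeries F (b * u) := by
  rw [evalSeries, evalSeries, ← tsum_mul_left]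
  refine tsum_congr fun m => ?_
  rw [map_smul, MvPowerSeries.coeff_rescale, smul_eq_mul]
  simp only [Pi.mul_apply, mul_pow, Finsupp.prod_mul]
  ring

/-- The total derivative at `v` of a tuple of power series. -/
def totalDerivs {j : ℕ} (F : Fin j → MvPowerSeries (Fin n) K) (v : Fin n → K) :
    (Fin n → K) →L[K] (Fin j → K) :=
  ContinuousLinearMap.pi fun i => totalDeriv (F i) v

theorem totalDerivs_apply {j : ℕ} (F : Fin j → MvPowerSeries (Fin n) K) (v w : Fin n → K)
    (i : Fin j) : totalDerivs F v w i = totalDeriv (F i) v w := rfl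

theorem jacobian_mulVec {j : ℕ} (F : Fin j → MvPowerSeries (Fin n) K) (x w : Fin n → K)
    (i : Fin j) : (jacobian F x).mulVec w i = fderiv K (evalSeries (F i)) x w := by
  rw [Matrix.mulVec, dotProduct]
  conv_rhs => rw [← Finset.univ_sum_single w, map_sum]
  refine Finset.sum_congr rfl fun t _ => ?_
  have : (Pi.single t (w t) : Fin n → K) = w t • Pi.single t 1 := by
    rw [← Pi.single_smul, smul_eq_mul, mul_one]
  rw [this, map_smul, smul_eq_mul, mul_comm]
  rfl

theorem rank_eq_iff_mulVec_surjective {j : ℕ} (A : Matrix (Fin j) (Fin n) K) :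
    A.rank = j ↔ Function.Surjective A.mulVec := by
  have h : Function.Surjective A.mulVec ↔ LinearMap.range A.mulVecLin = ⊤ := by
    rw [LinearMap.range_eq_top]; rfl
  rw [h, Matrix.rank]
  constructor
  · intro h1
    apply Submodule.eq_top_of_finrank_eq
    rw [h1]; simp
  · intro h1
    rw [h1]; simp

variable [IsUltrametricDist K] [CompleteSpace K]

theorem hasFDerivAt_of_isRestricted_smul_rescale {c : K} (hc : c ≠ 0) {b : Fin n → K}
    (hb : ∀ t, b t ≠ 0) {F : MvPowerSeries (Fin n) K}
    (hF : IsRestricted (c • MvPowerSeries.rescale b F)) {u : Fin n → K} (hu : ‖u‖ ≤ 1) :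
    HasFDerivAt (evalSeries F)
      (c⁻¹ • (totalDeriv (c • MvPowerSeries.rescale b F) u ∘L
        (ContinuousLinearMap.pi fun t => (b t)⁻¹ • ContinuousLinearMap.proj t))) (b * u) := by
  set L : (Fin n → K) →L[K] (Fin n → K) :=
    ContinuousLinearMap.pi fun t => (b t)⁻¹ • ContinuousLinearMap.proj t
  have hL : ∀ x, b * L x = x := fun x => by
    ext t
    simp [L, hb t]
  have hLu : L (b * u) = u := by
    ext t
    simp [L, hb t]
  have h1 : evalSeries F = fun x => c⁻¹ * evalSeries (c • MvPowerSeries.rescale b F) (L x) := by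
    ext x
    rw [evalSeries_smul_rescale, hL, inv_mul_cancel_left₀ hc]
  have h2 : HasFDerivAt (evalSeries (c • MvPowerSeries.rescale b F))
      (totalDeriv (c • MvPowerSeries.rescale b F) u) (L (b * u)) := by
    rw [hLu]; exact hF.hasFDerivAt hu
  rw [h1]
  exact (h2.comp (b * u) L.hasFDerivAt).const_mul c⁻¹

/-- Rescaling multiplies the rows of the Jacobian by the c_i and its columns by the b_t, all
nonzero. This transfers the rank condition from the point b * u to the formal derivative of the
rescaled series at u. -/
theorem jacobian_rank_eq_iff {j : ℕ} {c : Fin j → K} (hc : ∀ i, c i ≠ 0) {b : Fin n → K}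
    (hb : ∀ t, b t ≠ 0) {F : Fin j → MvPowerSeries (Fin n) K}
    (hF : ∀ i, IsRestricted (c i • MvPowerSeries.rescale b (F i))) {u : Fin n → K}
    (hu : ‖u‖ ≤ 1) :
    (jacobian F (b * u)).rank = j ↔
      Function.Surjective (totalDerivs (fun i => c i • MvPowerSeries.rescale b (F i)) u) := by
  rw [rank_eq_iff_mulVec_surjective]
  have key : ∀ w i, (jacobian F (b * u)).mulVec w i = (c i)⁻¹ *
      totalDerivs (fun i => c i • MvPowerSeries.rescale b (F i)) u (fun t => (b t)⁻¹ * w t) i := by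
    intro w i
    rw [jacobian_mulVec, (hasFDerivAt_of_isRestricted_smul_rescale (hc i) hb (hF i) hu).fderiv]
    rfl
  constructor
  · intro h y
    obtain ⟨w, hw⟩ := h (fun i => (c i)⁻¹ * y i)
    refine ⟨fun t => (b t)⁻¹ * w t, funext fun i => ?_⟩
    have := congrFun hw i
    rw [key] at this
    exact mul_left_cancel₀ (inv_ne_zero (hc i)) this
  · intro h y
    obtain ⟨w, hw⟩ := h (fun i => c i * y i)
    refine ⟨b * w, funext fun i => ?_⟩
    have : (fun t => (b t)⁻¹ * (b * w) t) = w := by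
      ext t; simp [hb t]
    rw [key, this, hw, inv_mul_cancel_left₀ (hc i)]

theorem IsRestricted.of_norm_le {F G : MvPowerSeries (Fin n) K} (hF : IsRestricted F) (c : ℝ)
    (h : ∀ m, ‖MvPowerSeries.coeff m G‖ ≤ c * ‖MvPowerSeries.coeff m F‖) : IsRestricted G := by
  rw [IsRestricted, tendsto_zero_iff_norm_tendsto_zero] at *
  refine squeeze_zero (fun _ => norm_nonneg _) h ?_
  simpa using hF.const_mul c

/-- Serves to change the coordinates on which a series does not depend without changing its
derivative. -/
theorem totalDeriv_add_of_evalSeries_eq {G : MvPowerSeries (Fin n) K} (hG : IsRestricted G)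
    {u v : Fin n → K} (hu : ‖u‖ ≤ 1) (hv : ‖v‖ ≤ 1)
    (h : ∀ w, evalSeries G (w + (v - u)) = evalSeries G w) : totalDeriv G u = totalDeriv G v := by
  have h1 := hG.hasFDerivAt hv
  have h2 : HasFDerivAt (fun w => evalSeries G (w + (v - u))) (totalDeriv G v) u := by
    rwa [hasFDerivAt_comp_add_right, add_sub_cancel]
  simp_rw [h] at h2
  exact (hG.hasFDerivAt hu).unique h2

/-- Pairing of weights with exponents. -/
def wt (a : Fin n → ℕ) (m : Fin n →₀ ℕ) : ℕ := ∑ t, a t * m t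

/-- Euler's identity for a quasi-homogeneous power series. -/
theorem totalDeriv_euler {G : MvPowerSeries (Fin n) K} (hG : IsRestricted G) {a : Fin n → ℕ}
    {δ : ℕ} (h : ∀ m, MvPowerSeries.coeff m G ≠ 0 → wt a m = δ) {v : Fin n → K} (hv : ‖v‖ ≤ 1) :
    totalDeriv G v (fun t => (a t : K) * v t) = δ * evalSeries G v := by
  rw [totalDeriv_apply, evalSeries_eq, ← tsum_mul_left]
  simp only [partialDeriv]
  simp_rw [← tsum_mul_right]
  have s : ∀ t, Summable fun m => MvPowerSeries.coeff m G *
      MvPolynomial.eval v (MvPolynomial.pderiv t (MvPolynomial.monomial m (1 : K))) *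
        ((a t : K) * v t) :=
    fun t => (hG.summable_mul fun m => (norm_eval_monomial_bounds m hv hv).2.1 t).mul_right _
  rw [← Summable.tsum_finsetSum fun t _ => s t]
  refine tsum_congr fun m => ?_
  by_cases hm : MvPowerSeries.coeff m G = 0
  · simp [hm]
  rw [← h m hm, wt]
  push_cast
  rw [Finset.sum_mul]
  refine Finset.sum_congr rfl fun t _ => ?_
  have e : v t * MvPolynomial.eval v (MvPolynomial.pderiv t (MvPolynomial.monomial m (1 : K))) =
      m t * MvPolynomial.eval v (MvPolynomial.monomial m (1 : K)) := by
    have := congrArg (MvPolynomial.eval v)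
      (MvPolynomial.X_mul_pderiv_monomial (R := K) (i := t) (m := m) (r := 1))
    simpa [-MvPolynomial.pderiv_monomial] using this
  linear_combination (MvPowerSeries.coeff m G * a t) * e

end Rescaling

/-! ### Face functions and series normalized by a weight. -/

section Newton

variable {K : Type*} [NontriviallyNormedField K] {n : ℕ}

theorem cast_wt (a : Fin n → ℕ) (m : Fin n →₀ ℕ) :
    (wt a m : ℝ) = (fun t => (a t : ℝ)) ⬝ᵥ fun t => (m t : ℝ) := by
  simp [wt, dotProduct]

open Classical in
-- A linear form with non-negative coefficients is bounded below on the Newton polyhedron by its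
-- minimum over the exponents, so the face is detected by comparing exponents alone.
theorem coeff_faceSeries (F : MvPowerSeries (Fin n) K) (a : Fin n → ℕ) (m : Fin n →₀ ℕ) :
    MvPowerSeries.coeff m (faceSeries F fun t => (a t : ℝ)) =
      if ∀ m', MvPowerSeries.coeff m' F ≠ 0 → wt a m ≤ wt a m' then MvPowerSeries.coeff m F
      else 0 := by
  by_cases hm : MvPowerSeries.coeff m F = 0
  · change (if _ then _ else _) = _
    simp [hm]
  change (if _ then _ else _) = _
  congr 1
  rw [eq_iff_iff]
  have hsub : ∀ m', MvPowerSeries.coeff m' F ≠ 0 →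
      (fun t => (m' t : ℝ)) ∈ newtonPolyhedron F := fun m' hm' =>
    subset_convexHull ℝ _ ⟨m', hm', fun t => le_rfl⟩
  constructor
  · rintro ⟨-, h⟩ m' hm'
    have := h _ (hsub m' hm')
    rw [← cast_wt, ← cast_wt] at this
    exact_mod_cast this
  · intro h
    refine ⟨hsub m hm, fun y hy => ?_⟩
    have hconv : Convex ℝ {y : Fin n → ℝ | (wt a m : ℝ) ≤ (fun t => (a t : ℝ)) ⬝ᵥ y} := by
      refine convex_halfSpace_ge (f := fun y : Fin n → ℝ => (fun t => (a t : ℝ)) ⬝ᵥ y)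
        ⟨fun x y => dotProduct_add _ _ _, fun c x => dotProduct_smul _ _ _⟩ _
    rw [← cast_wt]
    refine convexHull_min ?_ hconv hy
    rintro v ⟨m', hm', hv⟩
    change (wt a m : ℝ) ≤ _
    calc (wt a m : ℝ) ≤ wt a m' := by exact_mod_cast h m' hm'
      _ = _ := cast_wt a m'
      _ ≤ _ := Finset.sum_le_sum fun t _ => by gcongr; exact hv t

/-- The least weight of an exponent of `F`. -/
def minWeight (F : MvPowerSeries (Fin n) K) (a : Fin n → ℕ) : ℕ :=
  sInf (wt a '' {m | MvPowerSeries.coeff m F ≠ 0})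

theorem minWeight_le {F : MvPowerSeries (Fin n) K} (a : Fin n → ℕ) {m : Fin n →₀ ℕ}
    (hm : MvPowerSeries.coeff m F ≠ 0) : minWeight F a ≤ wt a m :=
  Nat.sInf_le ⟨m, hm, rfl⟩

theorem exists_wt_eq_minWeight {F : MvPowerSeries (Fin n) K} (a : Fin n → ℕ) {m : Fin n →₀ ℕ}
    (hm : MvPowerSeries.coeff m F ≠ 0) :
    ∃ m', MvPowerSeries.coeff m' F ≠ 0 ∧ wt a m' = minWeight F a :=
  Nat.sInf_mem (s := wt a '' {m | MvPowerSeries.coeff m F ≠ 0}) ⟨_, m, hm, rfl⟩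

theorem wt_single (a : Fin n → ℕ) (t : Fin n) (e : ℕ) : wt a (Finsupp.single t e) = a t * e := by
  rw [wt, Finset.sum_eq_single t] <;> simp +contextual [eq_comm]

theorem mul_le_wt (a : Fin n → ℕ) (m : Fin n →₀ ℕ) (t : Fin n) : a t * m t ≤ wt a m :=
  Finset.single_le_sum (f := fun t => a t * m t) (fun _ _ => Nat.zero_le _) (Finset.mem_univ t)

/-- The series `π ^ (-d) F(π ^ a_1 u_1, …, π ^ a_n u_n)`, `d` the least weight of an exponent. -/
def normalizedSeries (π : K) (F : MvPowerSeries (Fin n) K) (a : Fin n → ℕ) :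
    MvPowerSeries (Fin n) K :=
  (π ^ minWeight F a)⁻¹ • MvPowerSeries.rescale (fun t => π ^ a t) F

theorem prod_pow_pow (π : K) (a : Fin n → ℕ) (m : Fin n →₀ ℕ) :
    (m.prod fun t e => (π ^ a t) ^ e) = π ^ wt a m := by
  rw [Finsupp.prod_fintype _ _ (by simp), wt, ← Finset.prod_pow_eq_pow_sum]
  simp [pow_mul]

theorem coeff_normalizedSeries {π : K} (hπ : π ≠ 0) (F : MvPowerSeries (Fin n) K) (a : Fin n → ℕ)
    (m : Fin n →₀ ℕ) :
    MvPowerSeries.coeff m (normalizedSeries π F a) =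
      π ^ (wt a m - minWeight F a) * MvPowerSeries.coeff m F := by
  by_cases hm : MvPowerSeries.coeff m F = 0
  · simp [normalizedSeries, MvPowerSeries.coeff_rescale, hm]
  · rw [normalizedSeries, map_smul, MvPowerSeries.coeff_rescale, prod_pow_pow,
      pow_sub₀ _ hπ (minWeight_le a hm), smul_eq_mul]
    ring

end Newton

/-! ### Limits along ultrafilters and persistence of surjectivity. -/

section Limits

/-- If α does not tend to infinity, it stays below some B on a set of the ultrafilter, and finitely
many values are left. -/
theorem ultrafilter_eventually_eq_or_tendsto {ι : Type*} (𝒰 : Ultrafilter ι) (α : ι → ℕ) :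
    (∃ b, ∀ᶠ ν in (𝒰 : Filter ι), α ν = b) ∨ Tendsto α 𝒰 atTop := by
  by_contra! h
  obtain ⟨h1, h2⟩ := h
  rw [tendsto_atTop] at h2
  push Not at h2
  obtain ⟨B, hB⟩ := h2
  have h3 : ∀ᶠ ν in (𝒰 : Filter ι), ∀ b ∈ Finset.range B, α ν ≠ b := by
    rw [Filter.eventually_all_finset]
    intro b _
    exact h1 b
  obtain ⟨ν, hν, hlt⟩ := (h3.and hB).exists
  exact hν (α ν) (Finset.mem_range.2 hlt) rfl

/-- Let B₀ be a right inverse of the limit. The operators L_ν B₀ tend to 1, so they are eventually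
invertible, and B₀ (L_ν B₀)⁻¹ are right inverses of L_ν which tend to B₀. -/
theorem exists_bounded_rightInverse_of_tendsto {K : Type*} [NontriviallyNormedField K]
    [CompleteSpace K] {n j : ℕ} {ι : Type*} {l : Filter ι}
    {L : ι → (Fin n → K) →L[K] (Fin j → K)} {L₀ : (Fin n → K) →L[K] (Fin j → K)}
    (hL : Tendsto L l (𝓝 L₀)) (hs : Function.Surjective L₀) :
    ∃ C : ℝ, 0 < C ∧ ∀ᶠ ν in l, ∃ B : (Fin j → K) →L[K] (Fin n → K),
      (∀ y, ‖B y‖ ≤ C * ‖y‖) ∧ ∀ y, L ν (B y) = y := by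
  obtain ⟨B₁, hB₁⟩ := (L₀ : (Fin n → K) →ₗ[K] (Fin j → K)).exists_rightInverse_of_surjective
    (LinearMap.range_eq_top.2 hs)
  let B₀ : (Fin j → K) →L[K] (Fin n → K) := LinearMap.toContinuousLinearMap B₁
  have hB₀ : L₀ ∘L B₀ = 1 := by
    ext1 y
    exact LinearMap.congr_fun hB₁ y
  have h1 : Tendsto (fun ν => L ν ∘L B₀) l (𝓝 1) := by
    rw [← hB₀]
    exact ((ContinuousLinearMap.compL K _ _ _).flip B₀).continuous.continuousAt.tendsto.comp hL
  have h2 : Tendsto (fun ν => Ring.inverse (L ν ∘L B₀)) l (𝓝 1) := by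
    have := (NormedRing.inverse_continuousAt (1 : ((Fin j → K) →L[K] (Fin j → K))ˣ)).tendsto
    rw [Units.val_one, Ring.inverse_one] at this
    exact this.comp h1
  have h3 : ∀ᶠ ν in l, IsUnit (L ν ∘L B₀) :=
    h1.eventually (Units.isOpen.mem_nhds isUnit_one)
  have h4 : Tendsto (fun ν => B₀ ∘L Ring.inverse (L ν ∘L B₀)) l (𝓝 B₀) := by
    exact ((ContinuousLinearMap.compL K (Fin j → K) _ _) B₀).continuous.continuousAt.tendsto.comp h2
  refine ⟨‖B₀‖ + 1, by positivity, ?_⟩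
  filter_upwards [h3, h4.norm.eventually_lt_const (lt_add_one _)] with ν hν1 hν2
  refine ⟨B₀ ∘L Ring.inverse (L ν ∘L B₀), fun y => ?_, fun y => ?_⟩
  · exact (ContinuousLinearMap.le_opNorm _ y).trans (by gcongr)
  · have := Ring.mul_inverse_cancel _ hν1
    exact DFunLike.congr_fun this y

end Limits

/-! ### Coefficient bounds uniform in the weight. -/

section UniformBounds

variable {K : Type*} [NontriviallyNormedField K] {n : ℕ} {π : K}

/-- The exponents all of whose entries are at most `D`. -/
def expBox (n D : ℕ) : Finset (Fin n →₀ ℕ) :=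
  Finset.Iic (Finsupp.equivFunOnFinite.symm fun _ => D)

theorem mem_expBox {D : ℕ} {m : Fin n →₀ ℕ} : m ∈ expBox n D ↔ ∀ t, m t ≤ D := by
  rw [expBox, Finset.mem_Iic, Finsupp.le_def]
  rfl

theorem minWeight_le_mul {F : MvPowerSeries (Fin n) K} {M : ℕ} {t : Fin n}
    (hM : ∃ e, e ≤ M ∧ MvPowerSeries.coeff (Finsupp.single t e) F ≠ 0) (a : Fin n → ℕ) :
    minWeight F a ≤ M * a t := by
  obtain ⟨e, he, hc⟩ := hM
  calc minWeight F a ≤ wt a (Finsupp.single t e) := minWeight_le a hc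
    _ = a t * e := wt_single a t e
    _ ≤ M * a t := by rw [mul_comm]; gcongr

/-- With a_min the least of the a_t, the minimal weight is at most M a_min by convenience, while m
has weight at least a_min |m| and |m| ≥ 2M + 1. The excess is at least 2A (|m| - M), which is at
least A |m| + A. -/
theorem minWeight_add_le_wt {F : MvPowerSeries (Fin n) K} {M N A : ℕ}
    (hM : ∀ t, ∃ e, e ≤ M ∧ MvPowerSeries.coeff (Finsupp.single t e) F ≠ 0) {a : Fin n → ℕ}
    (ha : ∀ t, 2 * A ≤ a t) (hNA : N ≤ A) {m : Fin n →₀ ℕ} (hm : m ∉ expBox n (2 * M)) :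
    minWeight F a + N * (∑ t, m t) + A ≤ wt a m := by
  rw [mem_expBox] at hm
  push Not at hm
  obtain ⟨s, hs⟩ := hm
  obtain ⟨t₀, -, ht₀⟩ := Finset.exists_min_image Finset.univ a ⟨s, Finset.mem_univ s⟩
  have h1 := minWeight_le_mul (hM t₀) a
  have h2 : a t₀ * (∑ t, m t) ≤ wt a m := by
    rw [wt, Finset.mul_sum]
    exact Finset.sum_le_sum fun t _ => Nat.mul_le_mul_right _ (ht₀ t (Finset.mem_univ t))
  have h3 : 2 * M + 1 ≤ ∑ t, m t :=
    (Nat.succ_le_of_lt hs).trans (Finset.single_le_sum (f := fun t => m t)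
      (fun _ _ => Nat.zero_le _) (Finset.mem_univ s))
  obtain ⟨d, hd⟩ := Nat.exists_eq_add_of_le h3
  have h4 := ha t₀
  obtain ⟨c, hc⟩ := Nat.exists_eq_add_of_le h4
  rw [hd] at h2 ⊢
  rw [hc] at h1 h2
  nlinarith [Nat.zero_le (c * d), Nat.zero_le (M * c), Nat.zero_le (A * d), Nat.zero_le (A * M),
    Nat.mul_le_mul_right d hNA, Nat.mul_le_mul_right M hNA]

/-- Of the excess weight, N |m| compensates the growth of the coefficients of F, and A is left as
uniform decay. Hence only the finitely many exponents in the box matter in a limit. -/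
theorem norm_coeff_normalizedSeries_le_of_notMem (hπ0 : π ≠ 0) (hπ1 : ‖π‖ ≤ 1)
    {F : MvPowerSeries (Fin n) K} {M N A : ℕ} {C : ℝ}
    (hC : ∀ m, ‖MvPowerSeries.coeff m (MvPowerSeries.rescale (fun _ => π ^ N) F)‖ ≤ C)
    (hM : ∀ t, ∃ e, e ≤ M ∧ MvPowerSeries.coeff (Finsupp.single t e) F ≠ 0) {a : Fin n → ℕ}
    (ha : ∀ t, 2 * A ≤ a t) (hNA : N ≤ A) {m : Fin n →₀ ℕ} (hm : m ∉ expBox n (2 * M)) :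
    ‖MvPowerSeries.coeff m (normalizedSeries π F a)‖ ≤ C * ‖π‖ ^ A := by
  have h1 := minWeight_add_le_wt hM ha hNA hm
  have h2 := hC m
  rw [MvPowerSeries.coeff_rescale] at h2
  have h3 : (m.prod fun _ e => (π ^ N) ^ e) = π ^ (N * ∑ t, m t) := by
    rw [prod_pow_pow π (fun _ => N) m, wt, Finset.mul_sum]
  rw [h3, norm_mul, norm_pow] at h2
  rw [coeff_normalizedSeries hπ0, norm_mul, norm_pow]
  calc ‖π‖ ^ (wt a m - minWeight F a) * ‖MvPowerSeries.coeff m F‖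
      ≤ ‖π‖ ^ (N * (∑ t, m t) + A) * ‖MvPowerSeries.coeff m F‖ := by
        gcongr ?_ * _
        exact pow_le_pow_of_le_one (norm_nonneg _) hπ1 (by omega)
    _ = (‖π‖ ^ (N * ∑ t, m t) * ‖MvPowerSeries.coeff m F‖) * ‖π‖ ^ A := by ring
    _ ≤ C * ‖π‖ ^ A := by gcongr

theorem norm_coeff_normalizedSeries_le (hπ0 : π ≠ 0) (hπ1 : ‖π‖ ≤ 1)
    {F : MvPowerSeries (Fin n) K} {M N : ℕ} {C : ℝ}
    (hC : ∀ m, ‖MvPowerSeries.coeff m (MvPowerSeries.rescale (fun _ => π ^ N) F)‖ ≤ C)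
    (hM : ∀ t, ∃ e, e ≤ M ∧ MvPowerSeries.coeff (Finsupp.single t e) F ≠ 0) {a : Fin n → ℕ}
    (ha : ∀ t, 2 * N ≤ a t) (m : Fin n →₀ ℕ) :
    ‖MvPowerSeries.coeff m (normalizedSeries π F a)‖ ≤
      C + ∑ m ∈ expBox n (2 * M), ‖MvPowerSeries.coeff m F‖ := by
  have hC0 : 0 ≤ C := (norm_nonneg _).trans (hC 0)
  by_cases hm : m ∈ expBox n (2 * M)
  · have h1 : ‖MvPowerSeries.coeff m (normalizedSeries π F a)‖ ≤ ‖MvPowerSeries.coeff m F‖ := by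
      rw [coeff_normalizedSeries hπ0, norm_mul, norm_pow]
      exact mul_le_of_le_one_left (norm_nonneg _) (pow_le_one₀ (norm_nonneg _) hπ1)
    have h2 := Finset.single_le_sum (f := fun m => ‖MvPowerSeries.coeff m F‖)
      (fun _ _ => norm_nonneg _) hm
    linarith
  · have h1 := norm_coeff_normalizedSeries_le_of_notMem hπ0 hπ1 hC hM ha le_rfl hm
    have h2 : C * ‖π‖ ^ N ≤ C := mul_le_of_le_one_right hC0 (pow_le_one₀ (norm_nonneg _) hπ1)
    have h3 : 0 ≤ ∑ m ∈ expBox n (2 * M), ‖MvPowerSeries.coeff m F‖ :=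
      Finset.sum_nonneg fun _ _ => norm_nonneg _
    linarith

theorem isRestricted_rescale_pow [IsUltrametricDist K] [CompleteSpace K] (hπ1 : ‖π‖ ≤ 1)
    {F : MvPowerSeries (Fin n) K} {N : ℕ}
    (hF : IsRestricted (MvPowerSeries.rescale (fun _ => π ^ N) F)) (c : K) {a : Fin n → ℕ}
    (ha : ∀ t, N ≤ a t) : IsRestricted (c • MvPowerSeries.rescale (fun t => π ^ a t) F) := by
  refine hF.of_norm_le ‖c‖ fun m => ?_
  have h3 := prod_pow_pow π (fun _ => N) m
  rw [map_smul, norm_smul, MvPowerSeries.coeff_rescale, MvPowerSeries.coeff_rescale, prod_pow_pow,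
    h3, norm_mul, norm_mul, norm_pow, norm_pow]
  gcongr ?_ * (?_ * _)
  refine pow_le_pow_of_le_one (norm_nonneg _) hπ1 ?_
  exact Finset.sum_le_sum fun t _ => Nat.mul_le_mul_right _ (ha t)

end UniformBounds

/-! ### The face selected by a sequence of weights. -/

section LimitFace

variable {K : Type*} [NontriviallyNormedField K] {n : ℕ}

theorem wt_pos {a : Fin n → ℕ} (ha : ∀ t, 0 < a t) {m : Fin n →₀ ℕ} (hm : m ≠ 0) : 0 < wt a m := by
  obtain ⟨t, ht⟩ := Finsupp.ne_iff.1 hm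
  exact (Nat.mul_pos (ha t) (Nat.pos_of_ne_zero ht)).trans_le (mul_le_wt a m t)

/-- Along an ultrafilter, the exponents of bounded relative weight form a face: the first meet
locus of some weight vector with positive entries. -/
theorem exists_limit_face {j M : ℕ} (hn : 0 < n) {F : Fin j → MvPowerSeries (Fin n) K}
    (hF0 : ∀ i, MvPowerSeries.constantCoeff (F i) = 0)
    (hM : ∀ i t, ∃ e, e ≤ M ∧ MvPowerSeries.coeff (Finsupp.single t e) (F i) ≠ 0)
    {𝒰 : Ultrafilter ℕ} (h𝒰 : (𝒰 : Filter ℕ) ≤ atTop) {a : ℕ → Fin n → ℕ}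
    (ha : ∀ ν t, 2 * (ν + 1) ≤ a ν t) {P : ℕ → Prop} (hP : ∀ᶠ ν in (𝒰 : Filter ℕ), P ν) :
    ∃ ν₀, P ν₀ ∧ ∃ b : Fin n → ℕ, (∀ t, 0 < b t) ∧ ∃ δ : Fin j → ℕ, ∀ i, 0 < δ i ∧
      (∀ m, MvPowerSeries.coeff m (faceSeries (F i) fun t => (b t : ℝ)) ≠ 0 →
        MvPowerSeries.coeff m (faceSeries (F i) fun t => (b t : ℝ)) = MvPowerSeries.coeff m (F i) ∧
        m ∈ expBox n (2 * M) ∧ wt b m = δ i ∧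
        ∀ᶠ ν in (𝒰 : Filter ℕ), wt (a ν) m - minWeight (F i) (a ν) =
          wt (a ν₀) m - minWeight (F i) (a ν₀)) ∧
      ∀ m, MvPowerSeries.coeff m (F i) ≠ 0 →
        MvPowerSeries.coeff m (faceSeries (F i) fun t => (b t : ℝ)) = 0 →
        Tendsto (fun ν => wt (a ν) m - minWeight (F i) (a ν)) 𝒰 atTop := by
  classical
  set α : Fin j → (Fin n →₀ ℕ) → ℕ → ℕ := fun i m ν => wt (a ν) m - minWeight (F i) (a ν)
  -- The exponents that survive in the limit: those whose relative weight α is eventually constant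
  -- along 𝒰.
  let S : Fin j → (Fin n →₀ ℕ) → Prop := fun i m =>
    MvPowerSeries.coeff m (F i) ≠ 0 ∧ ∃ c, ∀ᶠ ν in (𝒰 : Filter ℕ), α i m ν = c
  have hout : ∀ i m, MvPowerSeries.coeff m (F i) ≠ 0 → m ∉ expBox n (2 * M) → ∀ ν, ν + 1 ≤ α i m ν := by
    intro i m _ hm ν
    have := minWeight_add_le_wt (N := 0) (hM i) (ha ν) (Nat.zero_le _) hm
    simp only [α]
    omega
  have hid : Tendsto (fun ν : ℕ => ν) 𝒰 atTop := tendsto_id.mono_left h𝒰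
  have houtT : ∀ i m, MvPowerSeries.coeff m (F i) ≠ 0 → m ∉ expBox n (2 * M) →
      Tendsto (α i m) 𝒰 atTop := fun i m h1 h2 =>
    tendsto_atTop_mono (fun ν => (Nat.le_succ ν).trans (hout i m h1 h2 ν)) hid
  have hnotS : ∀ i m, MvPowerSeries.coeff m (F i) ≠ 0 → ¬ S i m → Tendsto (α i m) 𝒰 atTop := by
    intro i m h1 h2
    refine (ultrafilter_eventually_eq_or_tendsto 𝒰 (α i m)).resolve_left fun h => h2 ⟨h1, h⟩
  have hSbox : ∀ i m, S i m → m ∈ expBox n (2 * M) := by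
    rintro i m ⟨h1, c, hc⟩
    by_contra hm
    obtain ⟨ν, hν1, hν2⟩ := (hc.and ((houtT i m h1 hm).eventually_gt_atTop c)).exists
    omega
  have hSne : ∀ i, ∃ m, S i m := by
    intro i
    -- Otherwise all relative weights are eventually positive, in the box because there are finitely
    -- many and outside it by `hout`; but an exponent of minimal weight has relative weight 0.
    by_contra! hne
    have h1 : ∀ᶠ ν in (𝒰 : Filter ℕ), ∀ m ∈ expBox n (2 * M),
        MvPowerSeries.coeff m (F i) ≠ 0 → 0 < α i m ν := by
      rw [Filter.eventually_all_finset]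
      intro m _
      by_cases h : MvPowerSeries.coeff m (F i) ≠ 0
      · exact ((hnotS i m h (hne m)).eventually_gt_atTop 0).mono fun _ h _ => h
      · exact Eventually.of_forall fun _ h' => absurd h' h
    obtain ⟨ν, hν⟩ := h1.exists
    obtain ⟨e, -, he⟩ := hM i ⟨0, hn⟩
    obtain ⟨m, hm1, hm2⟩ := exists_wt_eq_minWeight (a ν) he
    have h3 : α i m ν = 0 := by simp only [α]; omega
    by_cases hm : m ∈ expBox n (2 * M)
    · exact absurd h3 (hν m hm hm1).ne'
    · have := hout i m hm1 hm ν
      omega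
  choose! c hc using fun i m (h : S i m) => h.2
  have hconst : ∀ᶠ ν in (𝒰 : Filter ℕ), ∀ i, ∀ m ∈ expBox n (2 * M), S i m → α i m ν = c i m := by
    rw [Filter.eventually_all]
    intro i
    rw [Filter.eventually_all_finset]
    intro m _
    by_cases h : S i m
    · exact (hc i m h).mono fun _ h _ => h
    · exact Eventually.of_forall fun _ h' => absurd h' h
  obtain ⟨ν₀, hPν₀, hν₀⟩ := (hP.and hconst).exists
  have hgrow : ∀ᶠ ν in (𝒰 : Filter ℕ), ∀ i, ∀ m ∈ expBox n (2 * M),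
      MvPowerSeries.coeff m (F i) ≠ 0 → ¬ S i m → α i m ν₀ < α i m ν := by
    rw [Filter.eventually_all]
    intro i
    rw [Filter.eventually_all_finset]
    intro m _
    by_cases h : MvPowerSeries.coeff m (F i) ≠ 0 ∧ ¬ S i m
    · exact ((hnotS i m h.1 h.2).eventually_gt_atTop _).mono fun _ h _ _ => h
    · exact Eventually.of_forall fun _ h1 h2 => absurd ⟨h1, h2⟩ h
  have hagrow : ∀ᶠ ν in (𝒰 : Filter ℕ), ∀ t, a ν₀ t < a ν t := by
    rw [Filter.eventually_all]
    intro t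
    refine Tendsto.eventually_gt_atTop ?_ _
    exact tendsto_atTop_mono (fun ν => (by have := ha ν t; omega)) hid
  obtain ⟨ν₁, ⟨hν₁, hg⟩, hag⟩ := ((hconst.and hgrow).and hagrow).exists
  -- Between the indices ν₀ and ν₁ the relative weights of the exponents in S do not change, while
  -- those of the other exponents of F in the box grow. So b takes the constant value δ i on S and
  -- larger values on the others.
  let b : Fin n → ℕ := fun t => a ν₁ t - a ν₀ t
  have hb : ∀ t, 0 < b t := fun t => Nat.sub_pos_of_lt (hag t)
  have hwt : ∀ m, wt b m + wt (a ν₀) m = wt (a ν₁) m := by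
    intro m
    simp only [wt, ← Finset.sum_add_distrib]
    refine Finset.sum_congr rfl fun t _ => ?_
    rw [← add_mul, Nat.sub_add_cancel (hag t).le]
  let δ : Fin j → ℕ := fun i => minWeight (F i) (a ν₁) - minWeight (F i) (a ν₀)
  have hwα : ∀ i m, MvPowerSeries.coeff m (F i) ≠ 0 →
      wt b m + minWeight (F i) (a ν₀) + α i m ν₀ = minWeight (F i) (a ν₁) + α i m ν₁ := by
    intro i m hm
    have h1 := hwt m
    have h2 := minWeight_le (a ν₀) hm
    have h3 := minWeight_le (a ν₁) hm
    simp only [α]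
    omega
  have hle : ∀ i, minWeight (F i) (a ν₀) ≤ minWeight (F i) (a ν₁) := by
    intro i
    obtain ⟨m, hm⟩ := hSne i
    have h1 := hwα i m hm.1
    rw [hν₀ i m (hSbox i m hm) hm, hν₁ i m (hSbox i m hm) hm] at h1
    omega
  have hSδ : ∀ i m, S i m → wt b m = δ i := by
    intro i m hm
    have h1 := hwα i m hm.1
    rw [hν₀ i m (hSbox i m hm) hm, hν₁ i m (hSbox i m hm) hm] at h1
    have := hle i
    simp only [δ]
    omega
  have hboxle : ∀ i m, m ∈ expBox n (2 * M) → MvPowerSeries.coeff m (F i) ≠ 0 → ¬ S i m →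
      δ i < wt b m := by
    intro i m hm1 hm2 hm3
    have h1 := hwα i m hm2
    have h2 := hg i m hm1 hm2 hm3
    have := hle i
    simp only [δ]
    omega
  have hlt : ∀ i m, MvPowerSeries.coeff m (F i) ≠ 0 → ¬ S i m → δ i < wt b m := by
    intro i m hm2 hm3
    by_cases hm1 : m ∈ expBox n (2 * M)
    · exact hboxle i m hm1 hm2 hm3
    · rw [mem_expBox] at hm1
      push Not at hm1
      obtain ⟨t, ht⟩ := hm1
      -- Outside the box, m is compared with the pure power of x_t provided by convenience, for
      -- which e ≤ M < m t.
      obtain ⟨e, heM, he⟩ := hM i t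
      have hbox : Finsupp.single t e ∈ expBox n (2 * M) := by
        rw [mem_expBox]
        intro s
        rw [Finsupp.single_apply]
        split_ifs <;> omega
      have h1 : δ i ≤ wt b (Finsupp.single t e) := by
        by_cases hS : S i (Finsupp.single t e)
        · exact (hSδ i _ hS).ge
        · exact (hboxle i _ hbox he hS).le
      rw [wt_single] at h1
      calc δ i ≤ b t * e := h1
        _ < b t * m t := Nat.mul_lt_mul_of_pos_left (by omega) (hb t)
        _ ≤ wt b m := mul_le_wt b m t
  have hface : ∀ i m, MvPowerSeries.coeff m (faceSeries (F i) fun t => (b t : ℝ)) =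
      if S i m then MvPowerSeries.coeff m (F i) else 0 := by
    intro i m
    rw [coeff_faceSeries]
    by_cases hm : MvPowerSeries.coeff m (F i) = 0
    · simp [hm]
    congr 1
    rw [eq_iff_iff]
    constructor
    · intro h
      by_contra hS
      obtain ⟨m', hm'⟩ := hSne i
      have h1 := h m' hm'.1
      rw [hSδ i m' hm'] at h1
      exact absurd (hlt i m hm hS) (not_lt.2 h1)
    · intro hS m' hm'
      rw [hSδ i m hS]
      by_cases hS' : S i m'
      · exact (hSδ i m' hS').ge
      · exact (hlt i m' hm' hS').le
  refine ⟨ν₀, hPν₀, b, hb, δ, fun i => ⟨?_, ?_, ?_⟩⟩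
  · obtain ⟨m, hm⟩ := hSne i
    rw [← hSδ i m hm]
    refine wt_pos hb ?_
    rintro rfl
    exact hm.1 (by simpa using hF0 i)
  · intro m hm
    rw [hface] at hm
    have hS : S i m := by
      by_contra h
      exact hm (if_neg h)
    refine ⟨by rw [hface, if_pos hS], hSbox i m hS, hSδ i m hS, ?_⟩
    filter_upwards [hconst] with ν hν
    exact (hν i m (hSbox i m hS) hS).trans (hν₀ i m (hSbox i m hS) hS).symm
  · intro m hm1 hm2
    refine hnotS i m hm1 fun hS => ?_
    rw [hface, if_pos hS] at hm2
    exact hm1 hm2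

end LimitFace

/-! ### Dependence of values and derivatives on the coefficients. -/

section Subtraction

variable {K : Type*} [NontriviallyNormedField K] [IsUltrametricDist K] [CompleteSpace K] {n : ℕ}
  {F G : MvPowerSeries (Fin n) K}

theorem norm_evalSeries_sub_le (hF : IsRestricted F) (hG : IsRestricted G) {ε : ℝ} (hε : 0 ≤ ε)
    (h : ∀ m, ‖MvPowerSeries.coeff m F - MvPowerSeries.coeff m G‖ ≤ ε) {u : Fin n → K}
    (hu : ‖u‖ ≤ 1) : ‖evalSeries F u - evalSeries G u‖ ≤ ε := by
  have hb := fun m => (norm_eval_monomial_bounds (K := K) m hu hu).1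
  rw [evalSeries_eq, evalSeries_eq, ← (hF.summable_mul hb).tsum_sub (hG.summable_mul hb)]
  simp_rw [← sub_mul, ← map_sub]
  have := norm_tsum_coeff_mul_le (F := F - G) hε (fun m => by rw [map_sub]; exact h m) hb
  rwa [mul_one] at this

theorem norm_totalDeriv_sub_le (hF : IsRestricted F) (hG : IsRestricted G) {ε : ℝ} (hε : 0 ≤ ε)
    (h : ∀ m, ‖MvPowerSeries.coeff m F - MvPowerSeries.coeff m G‖ ≤ ε) {u : Fin n → K}
    (hu : ‖u‖ ≤ 1) (w : Fin n → K) : ‖totalDeriv F u w - totalDeriv G u w‖ ≤ ε * ‖w‖ := by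
  have hb := fun t m => (norm_eval_monomial_bounds (K := K) m hu hu).2.1 t
  have e : totalDeriv F u w - totalDeriv G u w = totalDeriv (F - G) u w := by
    rw [totalDeriv_apply, totalDeriv_apply, totalDeriv_apply, ← Finset.sum_sub_distrib]
    refine Finset.sum_congr rfl fun t _ => ?_
    rw [← sub_mul, partialDeriv, partialDeriv, partialDeriv,
      ← (hF.summable_mul (hb t)).tsum_sub (hG.summable_mul (hb t))]
    simp_rw [map_sub, sub_mul]
  rw [e]
  exact norm_totalDeriv_apply_le hε (fun m => by rw [map_sub]; exact h m) hu w

end Subtraction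

/-! ### Uniform submersivity from non-degeneracy. -/

section Compactness

variable {K : Type*} [NontriviallyNormedField K] [IsUltrametricDist K] [ProperSpace K]
  [CharZero K] {n k : ℕ} {π : K}

/-- The vector E is in the kernel of the first k derivatives but not of the last, so the last
component can be corrected along E. -/
theorem totalDerivs_surjective_of_euler {H : Fin (k + 1) → MvPowerSeries (Fin n) K}
    {u : Fin n → K} (hs : Function.Surjective (totalDerivs (fun i : Fin k => H i.castSucc) u))
    {E : Fin n → K} (hE : ∀ i : Fin k, totalDeriv (H i.castSucc) u E = 0)
    (hE' : totalDeriv (H (Fin.last k)) u E ≠ 0) : Function.Surjective (totalDerivs H u) := by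
  intro y
  obtain ⟨w, hw⟩ := hs fun i => y i.castSucc
  refine ⟨w + ((y (Fin.last k) - totalDeriv (H (Fin.last k)) u w) /
    totalDeriv (H (Fin.last k)) u E) • E, funext fun i => ?_⟩
  rw [totalDerivs_apply, map_add, map_smul, smul_eq_mul]
  induction i using Fin.lastCases with
  | last => rw [div_mul_cancel₀ _ hE']; ring
  | cast i =>
    rw [hE, mul_zero, add_zero]
    exact congrFun hw i

/-- Joint continuity in the series, for the supremum norm of the coefficients, and in the point:
vary the series with the point fixed, then the point. -/
theorem norm_tendsto_totalDerivs {j : ℕ} {ι : Type*} {l : Filter ι}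
    {H : ι → Fin j → MvPowerSeries (Fin n) K} {H₀ : Fin j → MvPowerSeries (Fin n) K}
    (hH : ∀ ν i, IsRestricted (H ν i)) (hH₀ : ∀ i, IsRestricted (H₀ i))
    (hlim : ∀ ε > 0, ∀ᶠ ν in l, ∀ i m,
      ‖MvPowerSeries.coeff m (H ν i) - MvPowerSeries.coeff m (H₀ i)‖ ≤ ε)
    {u : ι → Fin n → K} {u₀ : Fin n → K} (hu : ∀ ν, ‖u ν‖ ≤ 1) (hu₀ : ‖u₀‖ ≤ 1)
    (hlu : Tendsto u l (𝓝 u₀)) :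
    Tendsto (fun ν => totalDerivs (H ν) (u ν)) l (𝓝 (totalDerivs H₀ u₀)) ∧
      ∀ i, Tendsto (fun ν => evalSeries (H ν i) (u ν)) l (𝓝 (evalSeries (H₀ i) u₀)) := by
  choose C hC0 hC using fun i => (hH₀ i).exists_norm_coeff_le
  constructor
  · rw [tendsto_iff_norm_sub_tendsto_zero]
    have hsum : Tendsto (fun ν => ∑ i, C i * ‖u ν - u₀‖) l (𝓝 0) := by
      have h1 := tendsto_iff_norm_sub_tendsto_zero.1 hlu
      have h2 := tendsto_finsetSum (s := Finset.univ) (f := fun (i : Fin j) ν => C i * ‖u ν - u₀‖)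
        (fun i _ => h1.const_mul (C i))
      simpa using h2
    rw [Metric.tendsto_nhds]
    intro ε hε
    filter_upwards [hlim (ε / 2) (by positivity), hsum.eventually_lt_const (half_pos hε)]
      with ν h1 h2
    rw [dist_zero_right, norm_norm]
    refine lt_of_le_of_lt ?_ (half_lt_self hε)
    refine ContinuousLinearMap.opNorm_le_bound _ (by positivity) fun w => ?_
    refine (pi_norm_le_iff_of_nonneg (by positivity)).2 fun i => ?_
    calc ‖totalDeriv (H ν i) (u ν) w - totalDeriv (H₀ i) u₀ w‖
        = ‖(totalDeriv (H ν i) (u ν) w - totalDeriv (H₀ i) (u ν) w) +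
            (totalDeriv (H₀ i) (u ν) w - totalDeriv (H₀ i) u₀ w)‖ := by congr 1; ring
      _ ≤ max _ _ := IsUltrametricDist.norm_add_le_max _ _
      _ ≤ ε / 2 * ‖w‖ := max_le (norm_totalDeriv_sub_le (hH ν i) (hH₀ i) (by positivity)
            (h1 i) (hu ν) w) ?_
    refine (norm_totalDeriv_sub_apply_le (hH₀ i) (hC0 i).le (hC i) (hu ν) hu₀ w).trans ?_
    gcongr
    exact (Finset.single_le_sum (f := fun i => C i * ‖u ν - u₀‖)
      (fun i _ => mul_nonneg (hC0 i).le (norm_nonneg _)) (Finset.mem_univ i)).trans h2.le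
  · intro i
    have h0 := ((hH₀ i).hasFDerivAt hu₀).continuousAt.tendsto.comp hlu
    rw [Metric.tendsto_nhds]
    intro ε hε
    filter_upwards [hlim (ε / 2) (by positivity), (Metric.tendsto_nhds.1 h0) ε hε] with ν h1 h2
    rw [dist_eq_norm] at h2 ⊢
    calc ‖evalSeries (H ν i) (u ν) - evalSeries (H₀ i) u₀‖
        = ‖(evalSeries (H ν i) (u ν) - evalSeries (H₀ i) (u ν)) +
            (evalSeries (H₀ i) (u ν) - evalSeries (H₀ i) u₀)‖ := by congr 1; ring
      _ ≤ max _ _ := IsUltrametricDist.norm_add_le_max _ _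
      _ < ε := max_lt ((norm_evalSeries_sub_le (hH ν i) (hH₀ i) (by positivity)
            (h1 i) (hu ν)).trans_lt (half_lt_self hε)) h2

/-- Non-degeneracy at the origin gives, uniformly near the origin, right inverses of bounded norm
of the Jacobian matrices of the normalized series, at the zeros of the first `k` of them. -/
theorem exists_bounded_rightInverse (hπ : IsNormalizedUniformizer π) {M N : ℕ} (hkn : k + 1 ≤ n)
    {F : Fin (k + 1) → MvPowerSeries (Fin n) K}
    (hF0 : ∀ i, MvPowerSeries.constantCoeff (F i) = 0)
    (hM : ∀ i t, ∃ e, e ≤ M ∧ MvPowerSeries.coeff (Finsupp.single t e) (F i) ≠ 0)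
    (hN : ∀ i, IsRestricted (MvPowerSeries.rescale (fun _ => π ^ N) (F i)))
    {U : Set (Fin n → K)} (hU : U ∈ 𝓝 0) (hnd : IsNondegenerate F U)
    (hnd' : IsNondegenerate (fun i : Fin k => F i.castSucc) U) :
    ∃ C : ℝ, 0 < C ∧ ∃ A : ℕ, 2 * N ≤ A ∧ ∀ a : Fin n → ℕ, (∀ t, A ≤ a t) → ∀ (u : Fin n → K)
      (t₀ : Fin n), ‖u‖ ≤ 1 → (∀ t, ‖u t‖ = 1 ∨ (M + 1) * a t₀ ≤ a t) →
      (∀ i : Fin k, evalSeries (normalizedSeries π (F i.castSucc) a) u = 0) →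
      ∃ B : (Fin (k + 1) → K) →L[K] (Fin n → K), (∀ y, ‖B y‖ ≤ C * ‖y‖) ∧
        ∀ y, totalDerivs (fun i => normalizedSeries π (F i) a) u (B y) = y := by
  by_contra hcon
  push Not at hcon
  have hp0 := hπ.norm_pos
  have hp1 := hπ.norm_lt_one
  have hπ0 := hπ.ne_zero
  -- The ν-th counterexample has all weights at least 2 (ν + 1 + N) and no right inverse of norm at
  -- most ν + 1.
  choose a ha u t₀ hu hut hzero hbad using fun ν : ℕ =>
    hcon ((ν : ℝ) + 1) (by positivity) (2 * (ν + 1 + N)) (by omega)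
  let 𝒰 : Ultrafilter ℕ := hyperfilter ℕ
  have h𝒰 : (𝒰 : Filter ℕ) ≤ atTop := by
    rw [← Nat.cofinite_eq_atTop]; exact hyperfilter_le_cofinite
  have haN : ∀ ν t, N ≤ a ν t := fun ν t => by have := ha ν t; omega
  have hpow : Tendsto (fun ν : ℕ => ‖π‖ ^ ν) 𝒰 (𝓝 0) :=
    (tendsto_pow_atTop_nhds_zero_of_lt_one hp0.le hp1).mono_left h𝒰
  -- the small polydiscs lie in `U`
  let P : ℕ → Prop := fun ν => ∀ x : Fin n → K, ‖x‖ ≤ 1 → (fun t => π ^ a ν t) * x ∈ U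
  have hP : ∀ᶠ ν in (𝒰 : Filter ℕ), P ν := by
    obtain ⟨r, hr, hrU⟩ := Metric.nhds_basis_closedBall.mem_iff.1 hU
    filter_upwards [hpow.eventually_lt_const hr] with ν hν x hx
    refine hrU (mem_closedBall_zero_iff.2 ((pi_norm_le_iff_of_nonneg hr.le).2 fun t => ?_))
    rw [Pi.mul_apply, norm_mul, norm_pow]
    calc ‖π‖ ^ a ν t * ‖x t‖ ≤ ‖π‖ ^ ν * 1 := by
          gcongr ?_ * ?_
          · exact pow_le_pow_of_le_one hp0.le hp1.le (by have := ha ν t; omega)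
          · exact (norm_le_pi_norm x t).trans hx
      _ ≤ r := by linarith
  obtain ⟨ν₀, hPν₀, b, hb, δ, hδ⟩ := exists_limit_face (by omega) hF0 hM h𝒰
    (a := a) (fun ν t => by have := ha ν t; omega) hP
  have hδ0 := fun i => (hδ i).1
  have hδ1 := fun i => (hδ i).2.1
  have hδ2 := fun i => (hδ i).2.2
  set G : Fin (k + 1) → MvPowerSeries (Fin n) K := fun i => faceSeries (F i) fun t => (b t : ℝ)
  -- The limit of the normalized series is the face function, scaled as at the reference index ν₀:
  -- on the face the exponent of π in the coefficients is eventually the one at ν₀.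
  set c : Fin (k + 1) → K := fun i => (π ^ minWeight (F i) (a ν₀))⁻¹
  have hc : ∀ i, c i ≠ 0 := fun i => inv_ne_zero (pow_ne_zero _ hπ0)
  set z : Fin n → K := fun t => π ^ a ν₀ t
  have hz : ∀ t, z t ≠ 0 := fun t => pow_ne_zero _ hπ0
  set H : Fin (k + 1) → MvPowerSeries (Fin n) K := fun i => c i • MvPowerSeries.rescale z (G i)
  have hGF : ∀ i m, ‖MvPowerSeries.coeff m (G i)‖ ≤ ‖MvPowerSeries.coeff m (F i)‖ := by
    intro i m
    by_cases h : MvPowerSeries.coeff m (G i) = 0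
    · rw [h, norm_zero]; positivity
    · rw [(hδ1 i m h).1]
  have hH : ∀ i, IsRestricted (H i) := by
    intro i
    refine isRestricted_rescale_pow hp1.le ?_ _ (haN ν₀)
    refine (hN i).of_norm_le 1 fun m => ?_
    rw [MvPowerSeries.coeff_rescale, MvPowerSeries.coeff_rescale, norm_mul, norm_mul, one_mul]
    gcongr
    exact hGF i m
  have hHcoeff : ∀ i m, MvPowerSeries.coeff m (H i) ≠ 0 → MvPowerSeries.coeff m (G i) ≠ 0 := by
    intro i m h h'
    apply h
    simp only [H]
    rw [map_smul, MvPowerSeries.coeff_rescale, h', mul_zero, smul_zero]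
  have hHval : ∀ i m, MvPowerSeries.coeff m (G i) ≠ 0 → MvPowerSeries.coeff m (H i) =
      π ^ (wt (a ν₀) m - minWeight (F i) (a ν₀)) * MvPowerSeries.coeff m (F i) := by
    intro i m h
    rw [← coeff_normalizedSeries hπ0, normalizedSeries]
    simp only [H, map_smul, MvPowerSeries.coeff_rescale]
    rw [(hδ1 i m h).1]
  have hh : ∀ ν i, IsRestricted (normalizedSeries π (F i) (a ν)) := fun ν i =>
    isRestricted_rescale_pow hp1.le (hN i) _ (haN ν)
  -- convergence of the normalized series
  choose D hD0 hD using fun i => (hN i).exists_norm_coeff_le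
  have hlim : ∀ ε > 0, ∀ᶠ ν in (𝒰 : Filter ℕ), ∀ i m,
      ‖MvPowerSeries.coeff m (normalizedSeries π (F i) (a ν)) - MvPowerSeries.coeff m (H i)‖ ≤ ε := by
    intro ε hε
    rw [Filter.eventually_all]
    intro i
    have hbox : ∀ᶠ ν in (𝒰 : Filter ℕ), ∀ m ∈ expBox n (2 * M),
        ‖MvPowerSeries.coeff m (normalizedSeries π (F i) (a ν)) -
          MvPowerSeries.coeff m (H i)‖ ≤ ε := by
      rw [Filter.eventually_all_finset]
      intro m _
      by_cases hF : MvPowerSeries.coeff m (F i) = 0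
      · refine Eventually.of_forall fun ν => ?_
        have hG : MvPowerSeries.coeff m (H i) = 0 := by
          by_contra h
          have h2 := hHcoeff i m h
          exact h2 ((hδ1 i m h2).1.trans hF)
        rw [coeff_normalizedSeries hπ0, hF, hG]
        simpa using hε.le
      by_cases hG : MvPowerSeries.coeff m (G i) = 0
      · have h1 := hδ2 i m hF hG
        have h2 : MvPowerSeries.coeff m (H i) = 0 := by
          by_contra h
          exact hHcoeff i m h hG
        have h3 : Tendsto (fun ν => ‖π‖ ^ (wt (a ν) m - minWeight (F i) (a ν)) *
            ‖MvPowerSeries.coeff m (F i)‖) 𝒰 (𝓝 0) := by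
          have := ((tendsto_pow_atTop_nhds_zero_of_lt_one hp0.le hp1).comp h1).mul_const
            ‖MvPowerSeries.coeff m (F i)‖
          simpa using this
        filter_upwards [h3.eventually_lt_const hε] with ν hν
        rw [coeff_normalizedSeries hπ0, h2, sub_zero, norm_mul, norm_pow]
        exact hν.le
      · filter_upwards [(hδ1 i m hG).2.2.2] with ν hν
        rw [hHval i m hG, coeff_normalizedSeries hπ0, hν, sub_self, norm_zero]
        exact hε.le
    have hsmall : ∀ᶠ ν in (𝒰 : Filter ℕ), D i * ‖π‖ ^ ν < ε := by
      have := hpow.const_mul (D i)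
      rw [mul_zero] at this
      exact this.eventually_lt_const hε
    filter_upwards [hbox, hsmall] with ν h1 h2 m
    by_cases hm : m ∈ expBox n (2 * M)
    · exact h1 m hm
    · have h3 : MvPowerSeries.coeff m (H i) = 0 := by
        by_contra h
        exact hm (hδ1 i m (hHcoeff i m h)).2.1
      rw [h3, sub_zero]
      refine (norm_coeff_normalizedSeries_le_of_notMem hπ0 hp1.le (hD i) (hM i) (ha ν)
        (by omega) hm).trans (le_trans ?_ h2.le)
      gcongr ?_ * ?_
      · exact (hD0 i).le
      · exact pow_le_pow_of_le_one hp0.le hp1.le (by omega)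
  -- the limit point
  obtain ⟨v, hv, hlv⟩ := (isCompact_closedBall (0 : Fin n → K) 1).ultrafilter_le_nhds (𝒰.map u)
    (by
      rw [le_principal_iff]
      exact Filter.mem_map.2 (univ_mem' fun ν => mem_closedBall_zero_iff.2 (hu ν)))
  have hv1 : ‖v‖ ≤ 1 := mem_closedBall_zero_iff.1 hv
  have hlu : Tendsto u 𝒰 (𝓝 v) := hlv
  obtain ⟨hL, hE⟩ := norm_tendsto_totalDerivs hh hH hlim hu hv1 hlu
  have hvzero : ∀ i : Fin k, evalSeries (H i.castSucc) v = 0 := by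
    intro i
    refine tendsto_nhds_unique (hE i.castSucc) ?_
    simp only [hzero]
    exact tendsto_const_nhds
  -- the variables on which the limit does not depend
  have hindep : ∀ i m, MvPowerSeries.coeff m (H i) ≠ 0 → ∀ t, ‖v t‖ ≠ 1 → m t = 0 := by
    intro i m hm t ht
    by_contra hmt
    have hmt : 0 < m t := Nat.pos_of_ne_zero hmt
    have h1 : ∀ᶠ ν in (𝒰 : Filter ℕ), ‖u ν t‖ ≠ 1 := by
      have h2 : Tendsto (fun ν => ‖u ν t‖) 𝒰 (𝓝 ‖v t‖) :=
        ((continuous_apply t).tendsto v |>.comp hlu).norm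
      exact h2.eventually_ne ht
    have hG := hHcoeff i m hm
    have hFm : MvPowerSeries.coeff m (F i) ≠ 0 := by rw [← (hδ1 i m hG).1]; exact hG
    have h3 := (hδ1 i m hG).2.2.2
    have h4 : ∀ᶠ ν in (𝒰 : Filter ℕ), wt (a ν₀) m - minWeight (F i) (a ν₀) < ν :=
      (tendsto_id.mono_left h𝒰).eventually_gt_atTop _
    obtain ⟨ν, ⟨h5, h6⟩, h7⟩ := ((h1.and h3).and h4).exists
    -- If x_t occurred in m, then wt m ≥ a_t ≥ (M + 1) a_{t₀}, while the minimal weight is at most M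
    -- a_{t₀}. The relative weight would be at least a_{t₀}, hence unbounded.
    have h8 := (hut ν t).resolve_left h5
    have h9 := mul_le_wt (a ν) m t
    have h10 := minWeight_le_mul (hM i (t₀ ν)) (a ν)
    have h11 : a ν t ≤ a ν t * m t := Nat.le_mul_of_pos_right _ hmt
    have h12 := ha ν (t₀ ν)
    rw [add_mul, one_mul] at h8
    omega
  -- Non-degeneracy concerns only points with nonzero coordinates. The coordinates on which the
  -- limit does not depend are replaced by 1, which brings the point into the torus.
  let v' : Fin n → K := fun t => if ‖v t‖ = 1 then v t else 1
  have hv't : ∀ t, ‖v' t‖ = 1 := by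
    intro t
    simp only [v']
    split_ifs with h
    · exact h
    · exact norm_one
  have hv'1 : ‖v'‖ ≤ 1 := (pi_norm_le_iff_of_nonneg zero_le_one).2 fun t => (hv't t).le
  have hshift : ∀ i w, evalSeries (H i) (w + (v' - v)) = evalSeries (H i) w := by
    intro i w
    rw [evalSeries, evalSeries]
    refine tsum_congr fun m => ?_
    by_cases hm : MvPowerSeries.coeff m (H i) = 0
    · simp [hm]
    congr 1
    refine Finsupp.prod_congr fun t ht => ?_
    have h1 : ‖v t‖ = 1 := by
      by_contra h
      exact (Finsupp.mem_support_iff.1 ht) (hindep i m hm t h)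
    simp [v', h1]
  have hval : ∀ i, evalSeries (H i) v' = evalSeries (H i) v := by
    intro i
    have := hshift i v
    rwa [add_sub_cancel] at this
  have hderiv : totalDerivs H v = totalDerivs H v' := by
    rw [totalDerivs, totalDerivs]
    congr 1
    ext1 i
    exact totalDeriv_add_of_evalSeries_eq (hH i) hv1 hv'1 (hshift i)
  have hGval : ∀ i, evalSeries (H i) v' = c i * evalSeries (G i) (z * v') := fun i =>
    evalSeries_smul_rescale _ _ _ _
  have hzU : z * v' ∈ U := hPν₀ v' hv'1
  have hzt : ∀ t, (z * v') t ≠ 0 := fun t => mul_ne_zero (hz t)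
    (norm_pos_iff.1 (by rw [hv't]; exact one_pos))
  have hbR : ∀ t, (0 : ℝ) < b t := fun t => by exact_mod_cast hb t
  have hGzero : ∀ i : Fin k, evalSeries (G i.castSucc) (z * v') = 0 := by
    intro i
    have h1 := hGval i.castSucc
    rw [hval, hvzero] at h1
    exact (mul_eq_zero.1 h1.symm).resolve_left (hc _)
  have hsurj : Function.Surjective (totalDerivs H v') := by
    -- If the last face function vanishes as well, the l-tuple is non-degenerate there. Otherwise
    -- the first l - 1 functions are, and the Euler field supplies the missing direction.
    by_cases hlast : evalSeries (G (Fin.last k)) (z * v') = 0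
    · have h1 := hnd _ hbR (z * v') hzU hzt (fun i => by
        induction i using Fin.lastCases with
        | last => exact hlast
        | cast i => exact hGzero i)
      rw [min_eq_left hkn] at h1
      exact (jacobian_rank_eq_iff hc hz hH hv'1).1 h1
    · have h1 := hnd' _ hbR (z * v') hzU hzt hGzero
      rw [min_eq_left (by omega)] at h1
      have h2 := (jacobian_rank_eq_iff (fun i : Fin k => hc i.castSucc) hz
        (fun i => hH i.castSucc) hv'1).1 h1
      have heuler : ∀ i, totalDeriv (H i) v' (fun t => (b t : K) * v' t) =
          δ i * evalSeries (H i) v' := fun i =>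
        totalDeriv_euler (hH i) (fun m hm => (hδ1 i m (hHcoeff i m hm)).2.2.1) hv'1
      refine totalDerivs_surjective_of_euler h2 (E := fun t => (b t : K) * v' t) (fun i => ?_) ?_
      · rw [heuler, hval, hvzero, mul_zero]
      · rw [heuler, hGval]
        -- δ is positive because there is no constant term, and it stays nonzero in K since the
        -- characteristic is zero.
        exact mul_ne_zero (Nat.cast_ne_zero.2 (hδ0 _).ne') (mul_ne_zero (hc _) hlast)
  rw [← hderiv] at hsurj
  obtain ⟨C, hC, hev⟩ := exists_bounded_rightInverse_of_tendsto hL hsurj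
  -- The bound C of the right inverses near the limit is eventually less than ν + 1, contrary to the
  -- choice of the counterexamples.
  obtain ⟨ν₁, hν₁⟩ := exists_nat_gt C
  obtain ⟨ν, ⟨B, hB1, hB2⟩, hν⟩ := (hev.and ((tendsto_id.mono_left h𝒰).eventually_ge_atTop ν₁)).exists
  obtain ⟨y, hy⟩ := hbad ν B fun y => (hB1 y).trans (by
    gcongr
    have : (ν₁ : ℝ) ≤ ν := by exact_mod_cast hν
    linarith)
  exact hy (hB2 y)

end Compactness

/-! ### Gel'fand-Leray forms and determinants. -/

section WedgeProducts

variable {K : Type*} [Field K]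

/-- Both sides are alternating in n vectors of an n-dimensional space, so it is enough to compare
them on a basis. -/
theorem ιMulti_eq_det_smul {n : ℕ} (v : Fin n → Module.Dual K (Fin n → K)) :
    ExteriorAlgebra.ιMulti K n v =
      (Matrix.of fun i t => v i (Pi.single t 1)).det •
        ExteriorAlgebra.ιMulti K n (fun t => (LinearMap.proj t : Module.Dual K (Fin n → K))) := by
  set e := (Pi.basisFun K (Fin n)).dualBasis
  have he : ∀ t, e t = LinearMap.proj t := by
    intro t
    refine (Pi.basisFun K (Fin n)).ext fun s => ?_
    rw [Module.Basis.dualBasis_apply_self]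
    simp [Pi.single_apply, eq_comm]
  have hdet : ∀ v : Fin n → Module.Dual K (Fin n → K),
      e.det v = (Matrix.of fun i t => v i (Pi.single t 1)).det := by
    intro v
    rw [Module.Basis.det_apply, ← Matrix.det_transpose]
    congr 1
    ext i t
    rw [Matrix.transpose_apply, Module.Basis.toMatrix_apply, Module.Basis.dualBasis_repr]
    simp
  rw [← hdet]
  have key : ExteriorAlgebra.ιMulti K n = (LinearMap.toSpanSingleton K _
      (ExteriorAlgebra.ιMulti K n (fun t => (LinearMap.proj t : Module.Dual K (Fin n → K))))
        ).compAlternatingMap e.det := by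
    refine Module.Basis.ext_alternating e fun σ hσ => ?_
    let τ : Equiv.Perm (Fin n) := Equiv.ofBijective σ (Finite.injective_iff_bijective.1 hσ)
    have h1 : (fun i => e (σ i)) = (fun t => e t) ∘ τ := rfl
    rw [h1, AlternatingMap.map_perm, AlternatingMap.map_perm]
    congr 1
    have h2 : e.det (fun t => e t) = 1 := e.det_self
    rw [LinearMap.compAlternatingMap_apply, h2]
    simp [he]
  exact DFunLike.congr_fun key v

/-- The determinant extends to a linear map on the exterior algebra, with value 1 on this element.
-/
theorem ιMulti_proj_ne_zero (n : ℕ) :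
    ExteriorAlgebra.ιMulti K n (fun t => (LinearMap.proj t : Module.Dual K (Fin n → K))) ≠ 0 := by
  intro h
  set e := (Pi.basisFun K (Fin n)).dualBasis
  have he : ∀ t, e t = LinearMap.proj t := by
    intro t
    refine (Pi.basisFun K (Fin n)).ext fun s => ?_
    rw [Module.Basis.dualBasis_apply_self]
    simp [Pi.single_apply, eq_comm]
  have h1 := ExteriorAlgebra.liftAlternating_apply_ιMulti (R := K) (N := K)
    (f := Pi.single n e.det) (fun t => (LinearMap.proj t : Module.Dual K (Fin n → K)))
  rw [h, map_zero, Pi.single_eq_same] at h1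
  simp_rw [← he] at h1
  rw [e.det_self] at h1
  exact zero_ne_one h1

/-- The matrix of the forms `dx_{J 1}, …, dx_{J d}, ℓ_1, …, ℓ_k`. -/
def formMatrix {n d k : ℕ} (hd : d + k = n) (J : Fin d → Fin n)
    (ℓ : Fin k → Module.Dual K (Fin n → K)) : Matrix (Fin n) (Fin n) K :=
  Matrix.of fun i t => Fin.append (fun s => (LinearMap.proj (J s) : Module.Dual K (Fin n → K))) ℓ
    (Fin.cast hd.symm i) (Pi.single t 1)

/-- Turns the defining equation of a Gel'fand-Leray form into the statement that its coefficient g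
is the inverse of a determinant. -/
theorem smul_ιMulti_mul_eq_iff {n d k : ℕ} (hd : d + k = n) (J : Fin d → Fin n)
    (ℓ : Fin k → Module.Dual K (Fin n → K)) (g : K) :
    g • (ExteriorAlgebra.ιMulti K d (fun s => (LinearMap.proj (J s) : Module.Dual K (Fin n → K))) *
      ExteriorAlgebra.ιMulti K k ℓ) =
        ExteriorAlgebra.ιMulti K n (fun t => (LinearMap.proj t : Module.Dual K (Fin n → K))) ↔
      g * (formMatrix hd J ℓ).det = 1 := by
  subst hd
  rw [ExteriorAlgebra.ιMulti_mul_ιMulti, ιMulti_eq_det_smul, smul_smul]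
  change (g * (formMatrix rfl J ℓ).det) • _ = _ ↔ _
  constructor
  · intro h
    have h2 : (g * (formMatrix rfl J ℓ).det - 1) • ExteriorAlgebra.ιMulti K (d + k)
        (fun t => (LinearMap.proj t : Module.Dual K (Fin (d + k) → K))) = 0 := by
      rw [sub_smul, h, one_smul, sub_self]
    exact sub_eq_zero.1 ((smul_eq_zero.1 h2).resolve_right (ιMulti_proj_ne_zero _))
  · intro h
    rw [h, one_smul]

theorem formMatrix_mulVec_castAdd {n d k : ℕ} (hd : d + k = n) (J : Fin d → Fin n)
    (ℓ : Fin k → Module.Dual K (Fin n → K)) (w : Fin n → K) (i : Fin d) :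
    (formMatrix hd J ℓ).mulVec w (Fin.cast hd (Fin.castAdd k i)) = w (J i) := by
  simp [formMatrix, Matrix.mulVec, dotProduct, Pi.single_apply]

theorem formMatrix_mulVec_natAdd {n d k : ℕ} (hd : d + k = n) (J : Fin d → Fin n)
    (ℓ : Fin k → Module.Dual K (Fin n → K)) (w : Fin n → K) (i : Fin k) :
    (formMatrix hd J ℓ).mulVec w (Fin.cast hd (Fin.natAdd d i)) = ℓ i w := by
  have hw : ℓ i w = ∑ t, ℓ i (Pi.single t 1) * w t := by
    conv_lhs => rw [← Finset.univ_sum_single w, map_sum]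
    refine Finset.sum_congr rfl fun t _ => ?_
    have : (Pi.single t (w t) : Fin n → K) = w t • Pi.single t 1 := by
      rw [← Pi.single_smul, smul_eq_mul, mul_one]
    rw [this, map_smul, smul_eq_mul, mul_comm]
  rw [hw]
  simp [formMatrix, Matrix.mulVec, dotProduct]

theorem det_formMatrix_ne_zero_iff {n d k : ℕ} (hd : d + k = n) (J : Fin d → Fin n)
    (ℓ : Fin k → Module.Dual K (Fin n → K)) :
    (formMatrix hd J ℓ).det ≠ 0 ↔ ∀ w : Fin n → K, (∀ i, w (J i) = 0) → (∀ i, ℓ i w = 0) → w = 0 := by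
  constructor
  · intro h w h1 h2
    refine Matrix.eq_zero_of_mulVec_eq_zero h ?_
    ext i
    obtain ⟨i, rfl⟩ := (finCongr hd).surjective i
    induction i using Fin.addCases with
    | left i => exact (formMatrix_mulVec_castAdd hd J ℓ w i).trans (h1 i)
    | right i => exact (formMatrix_mulVec_natAdd hd J ℓ w i).trans (h2 i)
  · intro h hdet
    obtain ⟨w, hw, hw0⟩ := Matrix.exists_mulVec_eq_zero_iff.2 hdet
    refine hw (h w (fun i => ?_) fun i => ?_)
    · rw [← formMatrix_mulVec_castAdd hd J ℓ w i, hw0]; rfl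
    · rw [← formMatrix_mulVec_natAdd hd J ℓ w i, hw0]; rfl

/-- Independent linear forms can be completed by coordinates to a coordinate system. -/
theorem exists_det_formMatrix_ne_zero {n d k : ℕ} (hd : d + k = n)
    (ℓ : Fin k → Module.Dual K (Fin n → K))
    (hℓ : Function.Surjective fun (w : Fin n → K) i => ℓ i w) :
    ∃ J : Fin d → Fin n, (formMatrix hd J ℓ).det ≠ 0 := by
  let L : (Fin n → K) →ₗ[K] (Fin k → K) := LinearMap.pi ℓ
  have hL : LinearMap.range L = ⊤ := LinearMap.range_eq_top.2 hℓ
  let E := LinearMap.ker L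
  have hE : Module.finrank K E = d := by
    have := LinearMap.finrank_range_add_finrank_ker L
    rw [hL] at this
    simp only [finrank_top, Module.finrank_fintype_fun_eq_card, Fintype.card_fin] at this
    change Module.finrank K (LinearMap.ker L) = d
    omega
  -- The coordinates restricted to the common kernel E of the ℓ_i separate its points; a maximal
  -- independent family among them has dim E = d members.
  let v : Fin n → Module.Dual K E := fun t => (LinearMap.proj t) ∘ₗ E.subtype
  obtain ⟨κ, a, ha, hspan, hind⟩ := exists_linearIndependent' K v
  have hann : ∀ w : E, (∀ i, v (a i) w = 0) → w = 0 := by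
    intro w hw
    have h1 : ∀ φ ∈ Submodule.span K (range (v ∘ a)), φ w = 0 := by
      intro φ hφ
      induction hφ using Submodule.span_induction with
      | mem x hx => obtain ⟨i, rfl⟩ := hx; exact hw i
      | zero => rfl
      | add x y _ _ hx hy => rw [LinearMap.add_apply, hx, hy, add_zero]
      | smul c x _ hx => rw [LinearMap.smul_apply, hx, smul_zero]
    rw [hspan] at h1
    ext t
    exact h1 (v t) (Submodule.subset_span ⟨t, rfl⟩)
  have : Finite κ := Finite.of_injective a ha
  have : Fintype κ := Fintype.ofFinite κ
  have hcard1 : Fintype.card κ ≤ d := by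
    have := hind.fintype_card_le_finrank
    rwa [Subspace.dual_finrank_eq, hE] at this
  have hcard2 : d ≤ Fintype.card κ := by
    have h2 : Function.Injective (LinearMap.pi fun i => v (a i) : E →ₗ[K] (κ → K)) := by
      rw [injective_iff_map_eq_zero]
      intro w hw
      exact hann w fun i => congrFun hw i
    have := LinearMap.finrank_le_finrank_of_injective h2
    simpa [hE] using this
  let ε : Fin d ≃ κ := Fintype.equivOfCardEq (by simp; omega)
  refine ⟨a ∘ ε, (det_formMatrix_ne_zero_iff hd _ ℓ).2 fun w h1 h2 => ?_⟩
  have hw : w ∈ E := LinearMap.mem_ker.2 (funext h2)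
  have h3 := hann ⟨w, hw⟩ fun i => by
    have := h1 (ε.symm i)
    simpa [v] using this
  exact congrArg Subtype.val h3

end WedgeProducts

/-! ### Submersions are affine up to an isometry. -/

section Straightening

variable {K : Type*} [NontriviallyNormedField K] [IsUltrametricDist K] [CompleteSpace K]

/-- A submersion is, on a small ball, an affine map up to an isometry of the source. -/
theorem exists_isometryEquiv_straighten {X Y : Type*} [NormedAddCommGroup X] [NormedSpace K X]
    [IsUltrametricDist X] [CompleteSpace X] [NormedAddCommGroup Y] [NormedSpace K Y]
    {h : X → Y} {H : X →L[K] Y} {B : Y →L[K] X} (hHB : ∀ y, H (B y) = y) {C ε r : ℝ} {z : X}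
    (hC : 0 ≤ C) (hB : ∀ y, ‖B y‖ ≤ C * ‖y‖) (hr : 0 ≤ r) (hCε : C * ε < 1)
    (hh : ∀ x ∈ Metric.closedBall z r, ∀ y ∈ Metric.closedBall z r,
      ‖h x - h y - H (x - y)‖ ≤ ε * ‖x - y‖) :
    ∃ Ψ : X ≃ᵢ X, (∀ x, Ψ x ∈ Metric.closedBall z r ↔ x ∈ Metric.closedBall z r) ∧
      (∀ x ∈ Metric.closedBall z r, h x = h z + H (Ψ x - z)) ∧
      ∀ x ∈ Metric.closedBall z r, Ψ x = x + B (h x - h z - H (x - z)) := by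
  -- As H B = 1, the map φ satisfies H (φ x - z) = h x - h z; it differs from the identity by a map
  -- with Lipschitz constant C ε < 1.
  obtain ⟨Ψ, h1, h2⟩ := exists_isometryEquiv_of_near_id
    (φ := fun x => x + B (h x - h z - H (x - z))) (z := z) (r := r) hCε (fun x hx y hy => by
      have e : x + B (h x - h z - H (x - z)) - (y + B (h y - h z - H (y - z))) - (x - y) =
          B (h x - h y - H (x - y)) := by
        simp only [map_sub]; abel
      rw [e]
      calc _ ≤ C * (ε * ‖x - y‖) := (hB _).trans (by gcongr; exact hh x hx y hy)
        _ = _ := by ring) (by simpa using hr)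
  refine ⟨Ψ, h2, fun x hx => ?_, h1⟩
  rw [h1 x hx]
  have e : x + B (h x - h z - H (x - z)) - z = (x - z) + B (h x - h z - H (x - z)) := by abel
  rw [e, map_add, hHB]
  abel

end Straightening

/-! ### Volumes of tubes around a zero set. -/

section Tubes

variable {K : Type*} [NontriviallyNormedField K] [IsUltrametricDist K] [ProperSpace K]
  [MeasurableSpace K] [BorelSpace K] {π : K}

instance : SecondCountableTopology K := secondCountable_of_proper

theorem addHaar_closedBall_pow (hπ : IsNormalizedUniformizer π) (vol : Measure K)
    [vol.IsAddHaarMeasure] (hvol : vol (Metric.closedBall (0 : K) 1) = 1) (N : ℕ) :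
    vol (Metric.closedBall (0 : K) (‖π‖ ^ N)) = ‖π‖ₑ ^ N := by
  have h0 : π ^ N ≠ 0 := pow_ne_zero _ hπ.ne_zero
  rw [← addHaar_preimage_mul_left hπ vol h0]
  have : (π ^ N * ·) ⁻¹' Metric.closedBall (0 : K) (‖π‖ ^ N) = Metric.closedBall (0 : K) 1 := by
    ext x
    simp only [mem_preimage, mem_closedBall_zero_iff, norm_mul, norm_pow]
    exact mul_le_iff_le_one_right (pow_pos hπ.norm_pos N)
  rw [this, hvol, mul_one, enorm_pow]

theorem pi_closedBall_pow (hπ : IsNormalizedUniformizer π) (vol : Measure K)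
    [vol.IsAddHaarMeasure] (hvol : vol (Metric.closedBall (0 : K) 1) = 1) (k N : ℕ) :
    Measure.pi (fun _ : Fin k => vol) (Metric.closedBall 0 (‖π‖ ^ N)) = (‖π‖ₑ ^ N) ^ k := by
  rw [closedBall_pi _ (pow_nonneg (norm_nonneg _) N), Measure.pi_pi]
  simp [addHaar_closedBall_pow hπ vol hvol]

/-- A compact open set contains all points within some fixed δ of it. For ‖π‖ ^ N < δ its
intersection with the tube is therefore exactly a product, so the formula is an equality and not
only a limit. -/
theorem eventually_prod_tube (hπ : IsNormalizedUniformizer π) (vol : Measure K)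
    [vol.IsAddHaarMeasure] (hvol : vol (Metric.closedBall (0 : K) 1) = 1) {d k : ℕ}
    {T : Set ((Fin d → K) × (Fin k → K))} (hT : IsCompact T) (hTo : IsOpen T) :
    ∀ᶠ N : ℕ in atTop, ((Measure.pi fun _ : Fin d => vol).prod (Measure.pi fun _ : Fin k => vol))
      (T ∩ {p | ‖p.2‖ ≤ ‖π‖ ^ N}) =
        Measure.pi (fun _ : Fin d => vol) {c | (c, 0) ∈ T} * (‖π‖ₑ ^ N) ^ k := by
  obtain ⟨δ, hδ, hδT⟩ := hT.exists_thickening_subset_open hTo subset_rfl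
  have h1 : ∀ᶠ N : ℕ in atTop, ‖π‖ ^ N < δ :=
    (tendsto_pow_atTop_nhds_zero_of_lt_one (norm_nonneg _) hπ.norm_lt_one).eventually_lt_const hδ
  filter_upwards [h1] with N hN
  have h2 : T ∩ {p | ‖p.2‖ ≤ ‖π‖ ^ N} = {c | (c, 0) ∈ T} ×ˢ Metric.closedBall 0 (‖π‖ ^ N) := by
    ext ⟨c, y⟩
    simp only [mem_inter_iff, mem_ofPred_eq, mem_prod, mem_closedBall_zero_iff]
    refine and_congr_left fun hy => ?_
    have hdist : dist (c, y) ((c, 0) : (Fin d → K) × (Fin k → K)) < δ := by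
      rw [Prod.dist_eq, dist_self, dist_zero_right]
      exact max_lt hδ (hy.trans_lt hN)
    constructor
    · intro h
      exact hδT (Metric.mem_thickening_iff.2 ⟨_, h, by rwa [dist_comm]⟩)
    · intro h
      exact hδT (Metric.mem_thickening_iff.2 ⟨_, h, hdist⟩)
  rw [h2, Measure.prod_prod, pi_closedBall_pow hπ vol hvol]

theorem measurePreserving_split (vol : Measure K) [vol.IsAddHaarMeasure] {n d k : ℕ}
    (hd : d + k = n) :
    MeasurePreserving (fun w : Fin n → K => ((fun i => w (Fin.cast hd (Fin.castAdd k i)),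
      fun i => w (Fin.cast hd (Fin.natAdd d i))) : (Fin d → K) × (Fin k → K)))
      (Measure.pi fun _ => vol)
      ((Measure.pi fun _ => vol).prod (Measure.pi fun _ => vol)) := by
  subst hd
  have h1 := (measurePreserving_piCongrLeft (fun _ : Fin (d + k) => vol) finSumFinEquiv).symm
  have h2 := measurePreserving_sumPiEquivProdPi (X := fun _ : Fin d ⊕ Fin k => K) (fun _ => vol)
  exact h2.comp h1

theorem pi_preimage_form (hπ : IsNormalizedUniformizer π) (vol : Measure K)
    [vol.IsAddHaarMeasure] {n d k : ℕ} (hd : d + k = n) (J : Fin d → Fin n)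
    (L : (Fin n → K) →L[K] (Fin k → K))
    (hdet : (formMatrix hd J fun i => LinearMap.proj i ∘ₗ L.toLinearMap).det ≠ 0)
    {T : Set ((Fin d → K) × (Fin k → K))} (hT : MeasurableSet T) :
    ‖(formMatrix hd J fun i => LinearMap.proj i ∘ₗ L.toLinearMap).det‖ₑ *
      Measure.pi (fun _ : Fin n => vol) ((fun w => (w ∘ J, L w)) ⁻¹' T) =
        ((Measure.pi fun _ => vol).prod (Measure.pi fun _ => vol)) T := by
  have h1 := measurePreserving_split vol hd
  rw [← h1.measure_preimage hT.nullMeasurableSet,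
    ← pi_image_mulVec hπ vol hdet (h1.measurable hT)]
  congr 2
  ext w
  simp only [mem_preimage, formMatrix_mulVec_castAdd, formMatrix_mulVec_natAdd]
  rfl

/-- Tubes around a linear subspace. -/
theorem eventually_linear_tube (hπ : IsNormalizedUniformizer π) (vol : Measure K)
    [vol.IsAddHaarMeasure] (hvol : vol (Metric.closedBall (0 : K) 1) = 1) {n d k : ℕ}
    (hd : d + k = n) (J : Fin d → Fin n) (L : (Fin n → K) →L[K] (Fin k → K))
    (hdet : (formMatrix hd J fun i => LinearMap.proj i ∘ₗ L.toLinearMap).det ≠ 0)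
    {S : Set (Fin n → K)} (hS : IsCompact S) (hSo : IsOpen S) :
    ∀ᶠ N : ℕ in atTop, Measure.pi (fun _ : Fin n => vol) (S ∩ {w | ‖L w‖ ≤ ‖π‖ ^ N}) =
      ‖(formMatrix hd J fun i => LinearMap.proj i ∘ₗ L.toLinearMap).det‖ₑ⁻¹ *
        Measure.pi (fun _ : Fin d => vol) ((fun w => w ∘ J) '' (S ∩ {w | L w = 0})) *
          (‖π‖ₑ ^ N) ^ k := by
  set D := (formMatrix hd J fun i => LinearMap.proj i ∘ₗ L.toLinearMap).det
  let Q : (Fin n → K) →L[K] (Fin d → K) × (Fin k → K) :=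
    (ContinuousLinearMap.pi fun i => ContinuousLinearMap.proj (J i)).prod L
  have hQ : ∀ w, Q w = (w ∘ J, L w) := fun w => rfl
  have hinj : Function.Injective Q := by
    rw [injective_iff_map_eq_zero]
    intro w hw
    rw [hQ, Prod.mk_eq_zero] at hw
    exact (det_formMatrix_ne_zero_iff hd J _).1 hdet w (fun i => congrFun hw.1 i)
      fun i => congrFun hw.2 i
  have hsurj : Function.Surjective Q := by
    have hfin : Module.finrank K (Fin n → K) = Module.finrank K ((Fin d → K) × (Fin k → K)) := by
      simp [hd]
    exact (LinearMap.injective_iff_surjective_of_finrank_eq_finrank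
      (f := (Q : (Fin n → K) →ₗ[K] (Fin d → K) × (Fin k → K))) hfin).1 hinj
  let Qe : (Fin n → K) ≃L[K] (Fin d → K) × (Fin k → K) :=
    (LinearEquiv.ofBijective (Q : (Fin n → K) →ₗ[K] (Fin d → K) × (Fin k → K))
      ⟨hinj, hsurj⟩).toContinuousLinearEquiv
  have hQe : ∀ w, Qe w = (w ∘ J, L w) := fun w => rfl
  have hT : IsCompact (Qe '' S) := hS.image Qe.continuous
  have hTo : IsOpen (Qe '' S) := Qe.toHomeomorph.isOpenMap S hSo
  filter_upwards [eventually_prod_tube hπ vol hvol hT hTo] with N hN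
  have hmeas : MeasurableSet (Qe '' S ∩ {p | ‖p.2‖ ≤ ‖π‖ ^ N}) :=
    hTo.measurableSet.inter (isClosed_le continuous_snd.norm continuous_const).measurableSet
  have h1 := pi_preimage_form hπ vol hd J L hdet hmeas
  have h2 : (fun w => (w ∘ J, L w)) ⁻¹' (Qe '' S ∩ {p | ‖p.2‖ ≤ ‖π‖ ^ N}) =
      S ∩ {w | ‖L w‖ ≤ ‖π‖ ^ N} := by
    ext w
    simp only [mem_preimage, mem_inter_iff, mem_ofPred_eq]
    rw [← hQe w, Qe.injective.mem_set_image]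
  have h3 : {c | (c, 0) ∈ Qe '' S} = (fun w => w ∘ J) '' (S ∩ {w | L w = 0}) := by
    ext c
    simp only [mem_ofPred_eq, mem_image, hQe, Prod.mk.injEq, mem_inter_iff, and_assoc]
    refine exists_congr fun w => and_congr_right fun _ => and_comm
  rw [h2, hN, h3] at h1
  have hD0 : ‖D‖ₑ ≠ 0 := by simpa using hdet
  have hDt : ‖D‖ₑ ≠ ⊤ := enorm_ne_top
  rw [mul_assoc, ← h1, ← mul_assoc, ENNReal.inv_mul_cancel hD0 hDt, one_mul]

/-- Tubes around a zero set near a point at which it is a submanifold. -/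
theorem eventually_local_tube (hπ : IsNormalizedUniformizer π) (vol : Measure K)
    [vol.IsAddHaarMeasure] (hvol : vol (Metric.closedBall (0 : K) 1) = 1) {n d k : ℕ}
    (hd : d + k = n) (J : Fin d → Fin n) {f : (Fin n → K) → (Fin k → K)}
    {L : (Fin n → K) →L[K] (Fin k → K)} {z : Fin n → K} (hz : f z = 0)
    (hf : ∀ ε > 0, ∃ r > 0, ∀ x ∈ Metric.closedBall z r, ∀ y ∈ Metric.closedBall z r,
      ‖f x - f y - L (x - y)‖ ≤ ε * ‖x - y‖)
    (hdet : (formMatrix hd J fun i => LinearMap.proj i ∘ₗ L.toLinearMap).det ≠ 0)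
    {O : Set (Fin n → K)} (hO : O ∈ 𝓝 z) :
    ∃ r > 0, Metric.closedBall z r ⊆ O ∧
      InjOn (fun w => w ∘ J) (Metric.closedBall z r ∩ {x | f x = 0}) ∧
      ∀ S ⊆ Metric.closedBall z r, IsCompact S → IsOpen S →
        ∀ᶠ N : ℕ in atTop, Measure.pi (fun _ : Fin n => vol) (S ∩ {w | ‖f w‖ ≤ ‖π‖ ^ N}) =
          ‖(formMatrix hd J fun i => LinearMap.proj i ∘ₗ L.toLinearMap).det‖ₑ⁻¹ *
            Measure.pi (fun _ : Fin d => vol) ((fun w => w ∘ J) '' (S ∩ {w | f w = 0})) *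
              (‖π‖ₑ ^ N) ^ k := by
  set Mx := formMatrix hd J fun i => LinearMap.proj i ∘ₗ L.toLinearMap
  -- a right inverse of `L` that does not change the coordinates `x_J`
  let e : (Fin k → K) →ₗ[K] (Fin n → K) := LinearMap.pi fun i =>
    Fin.addCases (motive := fun _ => (Fin k → K) →ₗ[K] K) (fun _ => 0) (fun s => LinearMap.proj s)
      (Fin.cast hd.symm i)
  have he1 : ∀ y (i : Fin d), e y (Fin.cast hd (Fin.castAdd k i)) = 0 := fun y i => by
    simp [e]
  have he2 : ∀ y (i : Fin k), e y (Fin.cast hd (Fin.natAdd d i)) = y i := fun y i => by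
    simp [e]
  let B : (Fin k → K) →L[K] (Fin n → K) :=
    LinearMap.toContinuousLinearMap (Matrix.toLin' Mx⁻¹ ∘ₗ e)
  have hMB : ∀ y, Mx.mulVec (B y) = e y := fun y => by
    change Mx.mulVec (Mx⁻¹.mulVec (e y)) = e y
    rw [Matrix.mulVec_mulVec, Matrix.mul_nonsing_inv _ (Ne.isUnit hdet), Matrix.one_mulVec]
  have hBJ : ∀ y, (B y) ∘ J = 0 := fun y => by
    ext i
    have := formMatrix_mulVec_castAdd hd J (fun i => LinearMap.proj i ∘ₗ L.toLinearMap) (B y) i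
    rw [Function.comp_apply, ← this, Pi.zero_apply, ← he1 y i]
    exact congrFun (hMB y) _
  have hLB : ∀ y, L (B y) = y := fun y => by
    ext i
    have := formMatrix_mulVec_natAdd hd J (fun i => LinearMap.proj i ∘ₗ L.toLinearMap) (B y) i
    calc L (B y) i = _ := this.symm
      _ = e y (Fin.cast hd (Fin.natAdd d i)) := congrFun (hMB y) _
      _ = y i := he2 y i
  obtain ⟨r₁, hr₁, hf₁⟩ := hf (1 / (2 * (‖B‖ + 1))) (by positivity)
  obtain ⟨r₂, hr₂, hO₂⟩ := Metric.nhds_basis_closedBall.mem_iff.1 hO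
  set r := min r₁ r₂
  have hr : 0 < r := lt_min hr₁ hr₂
  have hsub : Metric.closedBall z r ⊆ Metric.closedBall z r₁ :=
    Metric.closedBall_subset_closedBall (min_le_left _ _)
  obtain ⟨Ψ, hΨ1, hΨ2, hΨ3⟩ := exists_isometryEquiv_straighten (h := f) (H := L) (B := B) hLB
    (C := ‖B‖) (ε := 1 / (2 * (‖B‖ + 1))) (r := r) (z := z) (norm_nonneg _) B.le_opNorm hr.le
    (by
      rw [mul_one_div, div_lt_one (by positivity)]
      have := norm_nonneg B
      linarith)
    (fun x hx y hy => hf₁ x (hsub hx) y (hsub hy))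
  have hfΨ : ∀ x ∈ Metric.closedBall z r, f x = L (Ψ x - z) := fun x hx => by
    rw [hΨ2 x hx, hz, zero_add]
  -- The values of B have zero J-coordinates, so Ψ preserves the coordinates x_J. Hence projecting
  -- the zero set to them is the same as projecting its straightened image.
  have hJΨ : ∀ x ∈ Metric.closedBall z r, Ψ x ∘ J = x ∘ J := fun x hx => by
    have h := hBJ (f x - f z - L (x - z))
    rw [hΨ3 x hx]
    ext i
    have := congrFun h i
    simp only [Function.comp_apply, Pi.add_apply, Pi.zero_apply] at this ⊢
    rw [this, add_zero]
  refine ⟨r, hr, (Metric.closedBall_subset_closedBall (min_le_right _ _)).trans hO₂, ?_, ?_⟩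
  · rintro x ⟨hx, hfx⟩ y ⟨hy, hfy⟩ hxy
    have h1 : Ψ x - Ψ y = 0 := by
      refine (det_formMatrix_ne_zero_iff hd J _).1 hdet _ (fun i => ?_) (fun i => ?_)
      · have h2 := congrFun (hJΨ x hx) i
        have h3 := congrFun (hJΨ y hy) i
        have h4 := congrFun hxy i
        simp only [Function.comp_apply] at h2 h3 h4
        rw [Pi.sub_apply, h2, h3, h4, sub_self]
      · have h2 : L (Ψ x - Ψ y) = 0 := by
          have : Ψ x - Ψ y = (Ψ x - z) - (Ψ y - z) := by abel
          rw [this, map_sub, ← hfΨ x hx, ← hfΨ y hy, hfx, hfy, sub_zero]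
        exact congrFun h2 i
    exact Ψ.injective (sub_eq_zero.1 h1)
  · intro S hSB hS hSo
    -- τ preserves Haar measure and carries the tube around the zero set to the tube around the
    -- kernel of L.
    let τ : (Fin n → K) ≃ₜ (Fin n → K) := Ψ.toHomeomorph.trans (Homeomorph.addRight (-z))
    have hτ : ∀ x, τ x = Ψ x - z := fun x => (sub_eq_add_neg _ _).symm
    have hτm : MeasurePreserving τ (Measure.pi fun _ : Fin n => vol)
        (Measure.pi fun _ : Fin n => vol) :=
      (measurePreserving_add_right _ (-z)).comp (measurePreserving_isometryEquiv _ Ψ)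
    filter_upwards [eventually_linear_tube hπ vol hvol hd J L hdet (hS.image τ.continuous)
      (τ.isOpenMap S hSo)] with N hN
    have h1 : S ∩ {w | ‖f w‖ ≤ ‖π‖ ^ N} = τ ⁻¹' (τ '' S ∩ {w | ‖L w‖ ≤ ‖π‖ ^ N}) := by
      ext x
      simp only [mem_inter_iff, mem_preimage, mem_ofPred_eq, τ.injective.mem_set_image]
      refine and_congr_right fun hx => ?_
      rw [hτ, hfΨ x (hSB hx)]
    have hmeas : MeasurableSet (τ '' S ∩ {w | ‖L w‖ ≤ ‖π‖ ^ N}) :=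
      (τ.isOpenMap S hSo).measurableSet.inter
        (isClosed_le L.continuous.norm continuous_const).measurableSet
    rw [h1, hτm.measure_preimage hmeas.nullMeasurableSet, hN]
    congr 2
    have h2 : (fun w => w ∘ J) '' (τ '' S ∩ {w | L w = 0}) =
        (fun c => c + -(z ∘ J)) '' ((fun w => w ∘ J) '' (S ∩ {w | f w = 0})) := by
      ext c
      simp only [mem_image, mem_inter_iff, mem_ofPred_eq]
      constructor
      · rintro ⟨_, ⟨⟨x, hx, rfl⟩, h0⟩, rfl⟩
        rw [hτ, ← hfΨ x (hSB hx)] at h0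
        refine ⟨x ∘ J, ⟨x, ⟨hx, h0⟩, rfl⟩, ?_⟩
        rw [hτ, ← hJΨ x (hSB hx)]
        ext i
        simp [sub_eq_add_neg]
      · rintro ⟨_, ⟨x, ⟨hx, h0⟩, rfl⟩, rfl⟩
        refine ⟨τ x, ⟨⟨x, hx, rfl⟩, ?_⟩, ?_⟩
        · rw [hτ, ← hfΨ x (hSB hx), h0]
        · rw [hτ, ← hJΨ x (hSB hx)]
          ext i
          simp [sub_eq_add_neg]
    rw [h2, image_add_right, neg_neg]
    exact measure_preimage_add_right _ _ _

end Tubes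

/-! ### Chart measures as tube volumes. -/

section Charts

variable {K : Type*} [NontriviallyNormedField K] [IsUltrametricDist K] [ProperSpace K]
  [MeasurableSpace K] [BorelSpace K] {π : K} {n k : ℕ}

/-- The functions defined by the power series are continuously differentiable on `U`. -/
structure IsC1On {j : ℕ} (F : Fin j → MvPowerSeries (Fin n) K) (U : Set (Fin n → K)) : Prop where
  strict : ∀ i, ∀ z ∈ U, HasStrictFDerivAt (evalSeries (F i)) (fderiv K (evalSeries (F i)) z) z
  cont : ∀ i, ContinuousOn (fderiv K (evalSeries (F i))) U

/-- The mapping defined by a tuple of power series. -/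
def evalSeriesTuple {j : ℕ} (F : Fin j → MvPowerSeries (Fin n) K) (x : Fin n → K) : Fin j → K :=
  fun i => evalSeries (F i) x

/-- The differential of the mapping defined by a tuple of power series. -/
def fderivTuple {j : ℕ} (F : Fin j → MvPowerSeries (Fin n) K) (x : Fin n → K) :
    (Fin n → K) →L[K] (Fin j → K) :=
  ContinuousLinearMap.pi fun i => fderiv K (evalSeries (F i)) x

variable {F : Fin k → MvPowerSeries (Fin n) K} {U : Set (Fin n → K)}

theorem IsC1On.continuousOn (hF : IsC1On F U) : ContinuousOn (evalSeriesTuple F) U :=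
  continuousOn_pi.2 fun i z hz => (hF.strict i z hz).continuousAt.continuousWithinAt

theorem IsC1On.exists_ball (hF : IsC1On F U) {z : Fin n → K} (hz : z ∈ U) :
    ∀ ε > 0, ∃ r > 0, ∀ x ∈ Metric.closedBall z r, ∀ y ∈ Metric.closedBall z r,
      ‖evalSeriesTuple F x - evalSeriesTuple F y - fderivTuple F z (x - y)‖ ≤ ε * ‖x - y‖ := by
  intro ε hε
  have h1 : ∀ᶠ p : (Fin n → K) × (Fin n → K) in 𝓝 z ×ˢ 𝓝 z, ∀ i, ‖evalSeries (F i) p.1 -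
      evalSeries (F i) p.2 - fderiv K (evalSeries (F i)) z (p.1 - p.2)‖ ≤ ε * ‖p.1 - p.2‖ := by
    rw [← nhds_prod_eq, Filter.eventually_all]
    exact fun i => Asymptotics.isLittleO_iff.1 (hF.strict i z hz).isLittleO hε
  obtain ⟨r, hr, h2⟩ := (Metric.nhds_basis_closedBall.prod_self).eventually_iff.1 h1
  refine ⟨r, hr, fun x hx y hy => ?_⟩
  have h3 := h2 (x := (x, y)) ⟨hx, hy⟩
  exact (pi_norm_le_iff_of_nonneg (mul_nonneg hε.le (norm_nonneg _))).2 h3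

theorem IsC1On.continuousOn_det (hF : IsC1On F U) {d : ℕ} (hd : d + k = n) (J : Fin d → Fin n) :
    ContinuousOn (fun x => (formMatrix hd J fun i => differential (F i) x).det) U := by
  refine Continuous.comp_continuousOn (g := Matrix.det) (continuous_id.matrix_det) ?_
  refine continuousOn_pi.2 fun i => continuousOn_pi.2 fun t => ?_
  obtain ⟨i, rfl⟩ := (finCongr hd).surjective i
  induction i using Fin.addCases with
  | left i => simpa [formMatrix] using continuousOn_const
  | right i =>
    have : ContinuousOn (fun x => fderiv K (evalSeries (F i)) x (Pi.single t 1)) U :=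
      (hF.cont i).clm_apply continuousOn_const
    simpa [formMatrix, differential] using this

theorem IsC1On.measurableSet_zeroSet (hF : IsC1On F U) (hU : IsOpen U) :
    MeasurableSet (zeroSet F U) := by
  have h : zeroSet F U = U \ (U ∩ evalSeriesTuple F ⁻¹' {0}ᶜ) := by
    ext x
    simp only [zeroSet, mem_ofPred_eq, Set.mem_sdiff, mem_inter_iff, mem_preimage, mem_compl_iff,
      mem_singleton_iff]
    refine and_congr_right fun hx => ?_
    simp [hx, funext_iff, evalSeriesTuple]
  rw [h]
  exact hU.measurableSet.diff
    (hF.continuousOn.isOpen_inter_preimage hU isOpen_compl_singleton).measurableSet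

variable (vol : Measure K)

theorem chartMeasure_compl {d : ℕ} {V W : Set (Fin n → K)} (hVW : MeasurableSet (V ∩ W))
    (J : Fin d → Fin n) (g : (Fin n → K) → K) : chartMeasure vol V J W g (V ∩ W)ᶜ = 0 := by
  rw [chartMeasure, withDensity_apply _ hVW.compl]
  refine setLIntegral_measure_zero _ _ ?_
  rw [Measure.map_apply measurable_subtype_coe hVW.compl]
  have : (Subtype.val ⁻¹' (V ∩ W)ᶜ : Set ↥(V ∩ W)) = ∅ := by
    exact eq_empty_of_forall_notMem fun x hx => hx x.2
  rw [this, measure_empty]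

/-- An injective continuous map on a standard Borel space is a measurable embedding, so
`Measure.comap` has its intended meaning here and not its default value. -/
theorem chartMeasure_apply {d : ℕ} {V W : Set (Fin n → K)} (hVW : MeasurableSet (V ∩ W))
    {J : Fin d → Fin n} (hJ : InjOn (fun x => x ∘ J) (V ∩ W)) {g : (Fin n → K) → K}
    {S : Set (Fin n → K)} (hS : MeasurableSet S) {κ : ENNReal}
    (hg : ∀ x ∈ V ∩ W ∩ S, ‖g x‖ₑ = κ) :
    chartMeasure vol V J W g S =
      κ * Measure.pi (fun _ : Fin d => vol) ((fun x => x ∘ J) '' (V ∩ W ∩ S)) := by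
  have : StandardBorelSpace ↥(V ∩ W) := hVW.standardBorel
  have hcont : Continuous fun x : ↥(V ∩ W) => (x : Fin n → K) ∘ J :=
    continuous_pi fun i => (continuous_apply (J i)).comp continuous_subtype_val
  have hemb : MeasurableEmbedding fun x : ↥(V ∩ W) => (x : Fin n → K) ∘ J :=
    hcont.measurable.measurableEmbedding fun x y hxy => Subtype.ext (hJ x.2 y.2 hxy)
  rw [chartMeasure, withDensity_apply _ hS]
  set ν := ((Measure.comap (fun x : ↥(V ∩ W) => (x : Fin n → K) ∘ J)
    (Measure.pi fun _ : Fin d => vol)).map Subtype.val)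
  have h0 : ∀ᵐ x ∂ν, x ∈ V ∩ W := by
    rw [ae_iff]
    change ν (V ∩ W)ᶜ = 0
    rw [Measure.map_apply measurable_subtype_coe hVW.compl]
    have : (Subtype.val ⁻¹' (V ∩ W)ᶜ : Set ↥(V ∩ W)) = ∅ := by
      exact eq_empty_of_forall_notMem fun x hx => hx x.2
    rw [this, measure_empty]
  have h1 : ∫⁻ x in S, ‖g x‖ₑ ∂ν = ∫⁻ _ in S, κ ∂ν := by
    refine lintegral_congr_ae ?_
    rw [EventuallyEq, ae_restrict_iff' hS]
    filter_upwards [h0] with x hx hxS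
    exact hg x ⟨hx, hxS⟩
  rw [h1, setLIntegral_const, Measure.map_apply measurable_subtype_coe hS, hemb.comap_apply]
  congr 2
  ext c
  simp only [mem_image, mem_preimage, Subtype.exists, mem_inter_iff]
  constructor
  · rintro ⟨x, hx, hxS, rfl⟩; exact ⟨x, ⟨hx, hxS⟩, rfl⟩
  · rintro ⟨x, ⟨hx, hxS⟩, rfl⟩; exact ⟨x, hx, hxS, rfl⟩

/-- `c` is the limit of the normalized volumes of `S ∩ {‖f‖ ≤ ‖π‖ ^ N}`. -/
def IsTubeVolume (π : K) (f : (Fin n → K) → (Fin k → K)) (S : Set (Fin n → K)) (c : ENNReal) :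
    Prop :=
  ∀ᶠ N : ℕ in atTop, Measure.pi (fun _ : Fin n => vol) (S ∩ {x | ‖f x‖ ≤ ‖π‖ ^ N}) =
    c * (‖π‖ₑ ^ N) ^ k

variable {vol} {f : (Fin n → K) → (Fin k → K)} {S T : Set (Fin n → K)} {c c' : ENNReal}

theorem enorm_pow_pow_ne_zero (hπ : IsNormalizedUniformizer π) (k N : ℕ) : (‖π‖ₑ ^ N) ^ k ≠ 0 :=
  pow_ne_zero _ (pow_ne_zero _ (by simpa using hπ.ne_zero))

theorem enorm_pow_pow_ne_top (k N : ℕ) : (‖π‖ₑ ^ N) ^ k ≠ ⊤ :=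
  ENNReal.pow_ne_top (ENNReal.pow_ne_top enorm_ne_top)

theorem IsTubeVolume.unique (hπ : IsNormalizedUniformizer π) (h : IsTubeVolume vol π f S c)
    (h' : IsTubeVolume vol π f S c') : c = c' := by
  obtain ⟨N, h1, h2⟩ := (h.and h').exists
  exact (ENNReal.mul_left_inj (enorm_pow_pow_ne_zero hπ k N)
    (enorm_pow_pow_ne_top k N)).1 (h1.symm.trans h2)

theorem IsTubeVolume.ne_top [vol.IsAddHaarMeasure] (hπ : IsNormalizedUniformizer π)
    (h : IsTubeVolume vol π f S c) (hS : IsCompact S) : c ≠ ⊤ := by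
  obtain ⟨N, h1⟩ := h.exists
  rintro rfl
  rw [ENNReal.top_mul (enorm_pow_pow_ne_zero hπ k N)] at h1
  exact absurd h1 ((measure_mono inter_subset_left).trans_lt hS.measure_lt_top).ne

theorem IsTubeVolume.union (h : IsTubeVolume vol π f S c) (h' : IsTubeVolume vol π f T c')
    (hd : Disjoint S T) (hS : MeasurableSet S) : IsTubeVolume vol π f (S ∪ T) (c + c') := by
  filter_upwards [h, h'] with N h1 h2
  rw [add_mul, ← h1, ← h2, ← measure_inter_add_sdiff _ hS]
  congr 2
  · ext x; simp only [mem_inter_iff, mem_union]; tauto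
  · ext x
    have : x ∈ S → x ∉ T := fun h => Set.disjoint_left.1 hd h
    simp only [mem_inter_iff, mem_union, Set.mem_sdiff]; tauto

variable [vol.IsAddHaarMeasure]

/-- The norm of the determinant is locally constant where it is nonzero, so the density |g| is
constant near z and the local tube formula applies. Tube volumes involve neither J nor g, so
different charts must give the same measure. -/
theorem IsGelfandLerayChart.exists_isTubeVolume (hπ : IsNormalizedUniformizer π)
    (hvol : vol (Metric.closedBall (0 : K) 1) = 1) (hkn : k ≤ n) (hF : IsC1On F U) (hU : IsOpen U)
    {J : Fin (n - k) → Fin n} {W : Set (Fin n → K)} {g : (Fin n → K) → K}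
    (hc : IsGelfandLerayChart F U J W g) {z : Fin n → K} (hzV : z ∈ zeroSet F U) (hzW : z ∈ W)
    {O : Set (Fin n → K)} (hO : O ∈ 𝓝 z) :
    ∃ r > 0, Metric.closedBall z r ⊆ O ∧ ∀ S ⊆ Metric.closedBall z r, IsCompact S → IsOpen S →
      IsTubeVolume vol π (evalSeriesTuple F) S (chartMeasure vol (zeroSet F U) J W g S) := by
  have hd : n - k + k = n := Nat.sub_add_cancel hkn
  have hform : ∀ x ∈ zeroSet F U ∩ W,
      g x * (formMatrix hd J fun i => differential (F i) x).det = 1 := fun x hx =>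
    (smul_ιMulti_mul_eq_iff hd J _ _).1 (hc.form x hx)
  have hdet : (formMatrix hd J fun i => differential (F i) z).det ≠ 0 :=
    right_ne_zero_of_mul_eq_one (hform z ⟨hzV, hzW⟩)
  have hz0 : evalSeriesTuple F z = 0 := funext hzV.2
  have hnear : ∀ᶠ x in 𝓝 z, ‖(formMatrix hd J fun i => differential (F i) x).det‖ =
      ‖(formMatrix hd J fun i => differential (F i) z).det‖ := by
    have h1 : ContinuousAt (fun x => (formMatrix hd J fun i => differential (F i) x).det) z :=
      (hF.continuousOn_det hd J).continuousAt (hU.mem_nhds hzV.1)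
    filter_upwards [(Metric.tendsto_nhds.1 h1.tendsto) _ (norm_pos_iff.2 hdet)] with x hx
    rw [dist_eq_norm] at hx
    exact norm_eq_of_norm_sub_lt hx
  obtain ⟨r, hr, hrO, -, hS⟩ := eventually_local_tube hπ vol hvol hd J hz0 (hF.exists_ball hzV.1)
    hdet (inter_mem (inter_mem hO (inter_mem (hU.mem_nhds hzV.1) (hc.isOpen.mem_nhds hzW))) hnear)
  refine ⟨r, hr, fun x hx => (hrO hx).1.1, fun S hSr hSc hSo => ?_⟩
  have h2 := hS S hSr hSc hSo
  have h3 : S ∩ {w | evalSeriesTuple F w = 0} = zeroSet F U ∩ W ∩ S := by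
    ext x
    simp only [mem_inter_iff, zeroSet, mem_ofPred_eq]
    constructor
    · rintro ⟨hx, h0⟩
      have := (hrO (hSr hx)).1.2
      exact ⟨⟨⟨this.1, fun i => congrFun h0 i⟩, this.2⟩, hx⟩
    · rintro ⟨⟨⟨_, h0⟩, _⟩, hx⟩
      exact ⟨hx, funext h0⟩
  rw [h3] at h2
  rw [chartMeasure_apply vol ((hF.measurableSet_zeroSet hU).inter hc.isOpen.measurableSet) hc.injOn
    hSo.measurableSet (κ := ‖(formMatrix hd J fun i => differential (F i) z).det‖ₑ⁻¹)]
  · exact h2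
  · rintro x ⟨hx, hxS⟩
    have h4 := hform x hx
    have h5 := (hrO (hSr hxS)).2
    simp only [mem_ofPred_eq] at h5
    have h6 : g x = ((formMatrix hd J fun i => differential (F i) x).det)⁻¹ :=
      eq_inv_of_mul_eq_one_left h4
    have h7 : (formMatrix hd J fun i => differential (F i) x).det ≠ 0 :=
      right_ne_zero_of_mul_eq_one h4
    rw [h6, enorm_inv h7]
    congr 1
    rw [← ofReal_norm, ← ofReal_norm, h5]

theorem exists_gelfandLerayChart (hπ : IsNormalizedUniformizer π)
    (hvol : vol (Metric.closedBall (0 : K) 1) = 1) (hkn : k ≤ n) (hF : IsC1On F U) (hU : IsOpen U)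
    {z : Fin n → K} (hzV : z ∈ zeroSet F U) (hrank : (jacobian F z).rank = k) :
    ∃ (J : Fin (n - k) → Fin n) (W : Set (Fin n → K)) (g : (Fin n → K) → K),
      IsGelfandLerayChart F U J W g ∧ z ∈ W := by
  have hd : n - k + k = n := Nat.sub_add_cancel hkn
  have hsurj : Function.Surjective fun (w : Fin n → K) i => differential (F i) z w := by
    intro y
    obtain ⟨w, hw⟩ := (rank_eq_iff_mulVec_surjective _).1 hrank y
    refine ⟨w, funext fun i => ?_⟩
    rw [← congrFun hw i, jacobian_mulVec]
    rfl
  obtain ⟨J, hdet⟩ := exists_det_formMatrix_ne_zero hd (fun i => differential (F i) z) hsurj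
  have hz0 : evalSeriesTuple F z = 0 := funext hzV.2
  have hnear : ∀ᶠ x in 𝓝 z, (formMatrix hd J fun i => differential (F i) x).det ≠ 0 :=
    ((hF.continuousOn_det hd J).continuousAt (hU.mem_nhds hzV.1)).eventually_ne hdet
  obtain ⟨r, hr, hrO, hinj, -⟩ := eventually_local_tube hπ vol hvol hd J hz0
    (hF.exists_ball hzV.1) hdet (inter_mem (hU.mem_nhds hzV.1) hnear)
  refine ⟨J, Metric.closedBall z r, fun x => ((formMatrix hd J fun i => differential (F i) x).det)⁻¹,
    ⟨IsUltrametricDist.isOpen_closedBall z hr.ne', ?_, ?_⟩, Metric.mem_closedBall_self hr.le⟩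
  · refine hinj.mono ?_
    rintro x ⟨hx, hxr⟩
    exact ⟨hxr, funext hx.2⟩
  · rintro x ⟨hx, hxr⟩
    exact (smul_ιMulti_mul_eq_iff hd J _ _).2 (inv_mul_cancel₀ (hrO hxr).2)

end Charts

/-! ### The Gel'fand-Leray measure as a tube volume. -/

section GelfandLeray

variable {K : Type*} [NontriviallyNormedField K] [IsUltrametricDist K] [ProperSpace K]
  [MeasurableSpace K] [BorelSpace K] {π : K} {n k : ℕ} {F : Fin k → MvPowerSeries (Fin n) K}
  {U : Set (Fin n → K)} {vol : Measure K}

theorem chartMeasure_le_gelfandLerayMeasure {J : Fin (n - k) → Fin n} {W : Set (Fin n → K)}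
    {g : (Fin n → K) → K} (hc : IsGelfandLerayChart F U J W g) :
    chartMeasure vol (zeroSet F U) J W g ≤ gelfandLerayMeasure vol F U :=
  le_iSup_of_le J (le_iSup_of_le W (le_iSup_of_le g (le_iSup_of_le hc le_rfl)))

theorem gelfandLerayMeasure_le {μ : Measure (Fin n → K)}
    (h : ∀ J W g, IsGelfandLerayChart F U J W g → chartMeasure vol (zeroSet F U) J W g ≤ μ) :
    gelfandLerayMeasure vol F U ≤ μ :=
  iSup_le fun J => iSup_le fun W => iSup_le fun g => iSup_le fun hc => h J W g hc

/-- Allows a supremum of measures to be bounded locally: a bound valid on B only becomes a global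
one when the measure ⊤ is added off B. -/
theorem le_restrict_add_restrict_compl {α : Type*} [MeasurableSpace α] {μ ν : Measure α}
    {B : Set α} (hB : MeasurableSet B) (h : μ.restrict B ≤ ν.restrict B) :
    μ ≤ ν.restrict B + (⊤ : Measure α).restrict Bᶜ := by
  rw [← Measure.restrict_add_restrict_compl (μ := μ) hB]
  exact add_le_add h (Measure.restrict_mono subset_rfl le_top)

theorem gelfandLerayMeasure_compl (hF : IsC1On F U) (hU : IsOpen U) :
    gelfandLerayMeasure vol F U (zeroSet F U)ᶜ = 0 := by
  have hV := hF.measurableSet_zeroSet hU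
  have h : gelfandLerayMeasure vol F U ≤ (⊤ : Measure (Fin n → K)).restrict (zeroSet F U) := by
    refine gelfandLerayMeasure_le fun J W g hc => ?_
    have h1 : chartMeasure vol (zeroSet F U) J W g (zeroSet F U)ᶜ = 0 :=
      measure_mono_null (compl_subset_compl.2 inter_subset_left)
        (chartMeasure_compl vol (hV.inter hc.isOpen.measurableSet) J g)
    rw [← Measure.restrict_add_restrict_compl (μ := chartMeasure vol (zeroSet F U) J W g) hV,
      Measure.restrict_eq_zero.2 h1, add_zero]
    exact Measure.restrict_mono subset_rfl le_top
  refine le_antisymm ((h _).trans ?_) zero_le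
  rw [Measure.restrict_apply hV.compl, compl_inter_self, measure_empty]

variable [vol.IsAddHaarMeasure]

/-- Two charts define the same measure where both are defined. -/
theorem chartMeasure_restrict_le (hπ : IsNormalizedUniformizer π)
    (hvol : vol (Metric.closedBall (0 : K) 1) = 1) (hkn : k ≤ n) (hF : IsC1On F U) (hU : IsOpen U)
    {J : Fin (n - k) → Fin n} {W : Set (Fin n → K)} {g : (Fin n → K) → K}
    (hc : IsGelfandLerayChart F U J W g) {μ : Measure (Fin n → K)} {B : Set (Fin n → K)}
    (hB : IsOpen B)
    (hμ : ∀ S ⊆ B, IsCompact S → IsOpen S → IsTubeVolume vol π (evalSeriesTuple F) S (μ S)) :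
    (chartMeasure vol (zeroSet F U) J W g).restrict B ≤ μ.restrict B := by
  set ν := chartMeasure vol (zeroSet F U) J W g
  set A := zeroSet F U ∩ W ∩ B
  have h1 : ∀ z ∈ A, ∃ r > 0, Metric.closedBall z r ⊆ B ∧ ν.restrict (Metric.closedBall z r) =
      μ.restrict (Metric.closedBall z r) := by
    rintro z ⟨⟨hzV, hzW⟩, hzB⟩
    obtain ⟨r, hr, hrB, hS⟩ := hc.exists_isTubeVolume hπ hvol hkn hF hU hzV hzW (hB.mem_nhds hzB)
    have hcomp := isCompact_closedBall z r
    have hopen := IsUltrametricDist.isOpen_closedBall z hr.ne'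
    refine ⟨r, hr, hrB, restrict_eq_of_forall_isCompact_isOpen hcomp hopen
      ((hS _ subset_rfl hcomp hopen).ne_top hπ hcomp) fun S hSr hSc hSo => ?_⟩
    exact (hS S hSr hSc hSo).unique hπ (hμ S (hSr.trans hrB) hSc hSo)
  choose! r hr hrB hrest using h1
  -- By the Lindelöf property, countably many balls on which the two measures agree cover the part
  -- of B charged by ν.
  obtain ⟨t, htA, htc, htcov⟩ := TopologicalSpace.countable_cover_nhdsWithin
    (s := A) (f := fun z => Metric.closedBall z (r z))
    fun z hz => mem_nhdsWithin_of_mem_nhds (Metric.closedBall_mem_nhds z (hr z hz))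
  set O := ⋃ z ∈ t, Metric.closedBall z (r z)
  have hO : MeasurableSet O :=
    MeasurableSet.biUnion htc fun z _ => Metric.isClosed_closedBall.measurableSet
  have hOrest : ν.restrict O = μ.restrict O :=
    (Measure.restrict_biUnion_congr htc).2 fun z hz => hrest z (htA hz)
  have hnull : ν (B \ O) = 0 := by
    refine measure_mono_null ?_ (chartMeasure_compl vol
      ((hF.measurableSet_zeroSet hU).inter hc.isOpen.measurableSet) J g)
    rintro x ⟨hxB, hxO⟩ hx
    exact hxO (htcov ⟨hx, hxB⟩)
  refine Measure.le_iff.2 fun E hE => ?_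
  rw [Measure.restrict_apply hE, Measure.restrict_apply hE]
  calc ν (E ∩ B) ≤ ν (E ∩ B ∩ O) + ν (B \ O) :=
        (measure_mono fun x hx => by
          by_cases hxO : x ∈ O
          · exact Or.inl ⟨hx, hxO⟩
          · exact Or.inr ⟨hx.2, hxO⟩).trans (measure_union_le _ _)
    _ = ν.restrict O (E ∩ B) := by
        rw [hnull, add_zero, Measure.restrict_apply (hE.inter hB.measurableSet)]
    _ = μ.restrict O (E ∩ B) := by rw [hOrest]
    _ ≤ μ (E ∩ B) := Measure.restrict_apply_le _ _

/-- Near z one chart measure dominates all the others, so it coincides there with their supremum. -/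
theorem exists_ball_isTubeVolume_gelfandLeray (hπ : IsNormalizedUniformizer π)
    (hvol : vol (Metric.closedBall (0 : K) 1) = 1) (hkn : k ≤ n) (hF : IsC1On F U) (hU : IsOpen U)
    {z : Fin n → K} (hzV : z ∈ zeroSet F U) (hrank : (jacobian F z).rank = k) :
    ∃ r > 0, ∀ S ⊆ Metric.closedBall z r, IsCompact S → IsOpen S →
      IsTubeVolume vol π (evalSeriesTuple F) S (gelfandLerayMeasure vol F U S) := by
  obtain ⟨J, W, g, hc, hzW⟩ := exists_gelfandLerayChart hπ hvol hkn hF hU hzV hrank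
  obtain ⟨r, hr, -, hS⟩ := hc.exists_isTubeVolume hπ hvol hkn hF hU hzV hzW univ_mem
  set B := Metric.closedBall z r
  set μ := chartMeasure vol (zeroSet F U) J W g
  have hBo : IsOpen B := IsUltrametricDist.isOpen_closedBall z hr.ne'
  have hle : gelfandLerayMeasure vol F U ≤ μ.restrict B + (⊤ : Measure (Fin n → K)).restrict Bᶜ :=
    gelfandLerayMeasure_le fun J' W' g' hc' => le_restrict_add_restrict_compl hBo.measurableSet
      (chartMeasure_restrict_le hπ hvol hkn hF hU hc' hBo hS)
  refine ⟨r, hr, fun S hSB hSc hSo => ?_⟩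
  have h1 : gelfandLerayMeasure vol F U S = μ S := by
    refine le_antisymm ((hle S).trans ?_) (chartMeasure_le_gelfandLerayMeasure hc S)
    rw [Measure.add_apply, Measure.restrict_apply hSo.measurableSet,
      Measure.restrict_apply hSo.measurableSet, inter_eq_left.2 hSB]
    have : S ∩ Bᶜ = ∅ := by
      rw [← sdiff_eq, sdiff_eq_empty]; exact hSB
    rw [this, measure_empty, add_zero]
  rw [h1]
  exact hS S hSB hSc hSo

/-- The Gel'fand-Leray measure of a compact open set is the limit of the normalized volumes of
its intersections with tubes around the zero set. -/
theorem isTubeVolume_gelfandLeray (hπ : IsNormalizedUniformizer π)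
    (hvol : vol (Metric.closedBall (0 : K) 1) = 1) (hkn : k ≤ n) (hF : IsC1On F U) (hU : IsOpen U)
    (hrank : ∀ z ∈ zeroSet F U, (jacobian F z).rank = k) {S : Set (Fin n → K)} (hSU : S ⊆ U)
    (hS : IsCompact S) (hSo : IsOpen S) :
    IsTubeVolume vol π (evalSeriesTuple F) S (gelfandLerayMeasure vol F U S) := by
  set γ := gelfandLerayMeasure vol F U
  -- Asking for all compact open subsets of a clopen neighbourhood makes the property stable under
  -- finite unions, as induction on the compact set S requires.
  let P : Set (Fin n → K) → Prop := fun T => ∃ T', T ⊆ T' ∧ IsClopen T' ∧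
    ∀ S ⊆ T', IsCompact S → IsOpen S → IsTubeVolume vol π (evalSeriesTuple F) S (γ S)
  have hP : P S := by
    refine hS.induction_on (p := P) ?_ ?_ ?_ ?_
    · refine ⟨∅, subset_rfl, isClopen_empty, fun S hS _ _ => ?_⟩
      rw [subset_empty_iff.1 hS, measure_empty]
      exact Eventually.of_forall fun N => by simp
    · rintro s t hst ⟨T', h1, h2⟩
      exact ⟨T', hst.trans h1, h2⟩
    · rintro s t ⟨s', hs1, hs2, hs3⟩ ⟨t', ht1, ht2, ht3⟩
      refine ⟨s' ∪ t', union_subset_union hs1 ht1, hs2.union ht2, fun S hS hSc hSo => ?_⟩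
      have e : S = (S ∩ s') ∪ (S \ s') := (inter_union_sdiff S s').symm
      have hm := hSo.measurableSet.inter hs2.isOpen.measurableSet
      have h1 := hs3 (S ∩ s') inter_subset_right (hSc.inter_right hs2.isClosed)
        (hSo.inter hs2.isOpen)
      have h2 := ht3 (S \ s') (fun x hx => (hS hx.1).resolve_left hx.2) (hSc.diff hs2.isOpen)
        (hSo.sdiff hs2.isClosed)
      have hdis : Disjoint (S ∩ s') (S \ s') := disjoint_sdiff_right.mono_left inter_subset_right
      have h3 := h1.union h2 hdis hm
      rwa [← measure_union' hdis hm, ← e] at h3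
    · intro x hx
      have hxU := hSU hx
      by_cases hfx : evalSeriesTuple F x = 0
      · have hxV : x ∈ zeroSet F U := ⟨hxU, fun i => congrFun hfx i⟩
        obtain ⟨r, hr, h⟩ := exists_ball_isTubeVolume_gelfandLeray hπ hvol hkn hF hU hxV
          (hrank x hxV)
        exact ⟨_, mem_nhdsWithin_of_mem_nhds (Metric.closedBall_mem_nhds x hr), _, subset_rfl,
          IsUltrametricDist.isClopen_closedBall x hr.ne', h⟩
      · have hδ : 0 < ‖evalSeriesTuple F x‖ := norm_pos_iff.2 hfx
        have h1 : ∀ᶠ y in 𝓝 x, ‖evalSeriesTuple F x‖ / 2 < ‖evalSeriesTuple F y‖ :=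
          ((hF.continuousOn.continuousAt (hU.mem_nhds hxU)).norm.tendsto).eventually_const_lt
            (half_lt_self hδ)
        obtain ⟨r, hr, hr1⟩ := Metric.nhds_basis_closedBall.mem_iff.1 h1
        refine ⟨_, mem_nhdsWithin_of_mem_nhds (Metric.closedBall_mem_nhds x hr), _, subset_rfl,
          IsUltrametricDist.isClopen_closedBall x hr.ne', fun T hT hTc hTo => ?_⟩
        have h2 : γ T = 0 := by
          suffices hTV : T ⊆ (zeroSet F U)ᶜ from
            measure_mono_null hTV (gelfandLerayMeasure_compl hF hU)
          intro y hy hyV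
          have h3 : ‖evalSeriesTuple F x‖ / 2 < ‖evalSeriesTuple F y‖ := hr1 (hT hy)
          have h4 : evalSeriesTuple F y = 0 := funext hyV.2
          rw [h4, norm_zero] at h3
          linarith
        -- Away from the zero set the mapping is bounded below, so small tubes are empty, in
        -- accordance with the measure being zero there.
        have h5 : ∀ᶠ N : ℕ in atTop, ‖π‖ ^ N < ‖evalSeriesTuple F x‖ / 2 :=
          (tendsto_pow_atTop_nhds_zero_of_lt_one (norm_nonneg _)
            hπ.norm_lt_one).eventually_lt_const (by positivity)
        filter_upwards [h5] with N hN
        have h6 : T ∩ {y | ‖evalSeriesTuple F y‖ ≤ ‖π‖ ^ N} = ∅ := by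
          refine eq_empty_of_forall_notMem fun y hy => ?_
          have h3 : ‖evalSeriesTuple F x‖ / 2 < ‖evalSeriesTuple F y‖ := hr1 (hT hy.1)
          have h4 : ‖evalSeriesTuple F y‖ ≤ ‖π‖ ^ N := hy.2
          linarith
        rw [h6, h2, measure_empty, zero_mul]
  obtain ⟨T, hST, -, h⟩ := hP
  exact h S hST hS hSo

end GelfandLeray

/-! ### Strict differentiability of convergent power series. -/

section Differentiability

variable {K : Type*} [NontriviallyNormedField K] [IsUltrametricDist K] [CompleteSpace K] {n : ℕ}
  {π : K}

/-- Taylor's formula at y, together with the variation of the derivative from z to y. The constant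
depends only on the bound of the coefficients, hence is the same for all normalized series. -/
theorem norm_evalSeries_sub_totalDeriv_le {F : MvPowerSeries (Fin n) K} (hF : IsRestricted F)
    {C : ℝ} (hC : 0 ≤ C) (hFC : ∀ m, ‖MvPowerSeries.coeff m F‖ ≤ C) {z : Fin n → K}
    (hz : ‖z‖ ≤ 1) {r : ℝ} (hr : r ≤ 1) {x y : Fin n → K} (hx : x ∈ Metric.closedBall z r)
    (hy : y ∈ Metric.closedBall z r) :
    ‖evalSeries F x - evalSeries F y - totalDeriv F z (x - y)‖ ≤ C * r * ‖x - y‖ := by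
  rw [mem_closedBall_iff_norm] at hx hy
  have hball : ∀ {w : Fin n → K}, ‖w - z‖ ≤ r → ‖w‖ ≤ 1 := fun {w} hw => by
    calc ‖w‖ = ‖(w - z) + z‖ := by rw [sub_add_cancel]
      _ ≤ max _ _ := IsUltrametricDist.norm_add_le_max _ _
      _ ≤ 1 := max_le (hw.trans hr) hz
  have hxy : ‖x - y‖ ≤ r := by
    calc ‖x - y‖ = ‖(x - z) - (y - z)‖ := by congr 1; abel
      _ ≤ max _ _ := norm_sub_le_max _ _
      _ ≤ r := max_le hx hy
  calc ‖evalSeries F x - evalSeries F y - totalDeriv F z (x - y)‖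
      = ‖(evalSeries F x - evalSeries F y - totalDeriv F y (x - y)) +
          (totalDeriv F y (x - y) - totalDeriv F z (x - y))‖ := by congr 1; ring
    _ ≤ max _ _ := IsUltrametricDist.norm_add_le_max _ _
    _ ≤ C * r * ‖x - y‖ := max_le ?_ ?_
  · refine (evalSeries_taylor hF hC hFC (hball hx) (hball hy)).trans ?_
    rw [sq, ← mul_assoc]
    gcongr
  · refine (norm_totalDeriv_sub_apply_le hF hC hFC (hball hy) hz _).trans ?_
    gcongr

theorem IsRestricted.hasStrictFDerivAt {F : MvPowerSeries (Fin n) K} (hF : IsRestricted F)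
    {v : Fin n → K} (hv : ‖v‖ ≤ 1) : HasStrictFDerivAt (evalSeries F) (totalDeriv F v) v := by
  obtain ⟨C, hC, hFC⟩ := hF.exists_norm_coeff_le
  rw [hasStrictFDerivAt_iff_isLittleO, Asymptotics.isLittleO_iff]
  intro c hc
  have hr : 0 < min 1 (c / C) := lt_min one_pos (by positivity)
  have hball : Metric.closedBall v (min 1 (c / C)) ×ˢ Metric.closedBall v (min 1 (c / C)) ∈
      𝓝 (v, v) := prod_mem_nhds (Metric.closedBall_mem_nhds v hr) (Metric.closedBall_mem_nhds v hr)
  filter_upwards [hball] with p hp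
  refine (norm_evalSeries_sub_totalDeriv_le hF hC.le hFC hv (min_le_left _ _) hp.1 hp.2).trans ?_
  gcongr
  calc C * min 1 (c / C) ≤ C * (c / C) := by gcongr; exact min_le_right _ _
    _ = c := by field_simp

theorem IsRestricted.continuousOn_totalDeriv {F : MvPowerSeries (Fin n) K} (hF : IsRestricted F) :
    ContinuousOn (totalDeriv F) (Metric.closedBall 0 1) := by
  obtain ⟨C, hC, hFC⟩ := hF.exists_norm_coeff_le
  have h : ∀ t, ContinuousOn (partialDeriv F t) (Metric.closedBall 0 1) := by
    intro t
    refine (LipschitzOnWith.of_dist_le_mul (K := C.toNNReal) fun x hx y hy => ?_).continuousOn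
    rw [dist_eq_norm, dist_eq_norm, Real.coe_toNNReal _ hC.le]
    exact norm_partialDeriv_sub_le hF hC.le hFC (mem_closedBall_zero_iff.1 hx)
      (mem_closedBall_zero_iff.1 hy) t
  unfold totalDeriv
  exact continuousOn_finsetSum _ fun t _ => (h t).smul continuousOn_const

theorem isC1On_of_isRestricted {j : ℕ} (hπ0 : π ≠ 0) {N : ℕ} {F : Fin j → MvPowerSeries (Fin n) K}
    (hN : ∀ i, IsRestricted (MvPowerSeries.rescale (fun _ => π ^ N) (F i))) {U : Set (Fin n → K)}
    (hU : U ⊆ Metric.closedBall 0 (‖π‖ ^ N)) : IsC1On F U := by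
  have hb : π ^ N ≠ 0 := pow_ne_zero _ hπ0
  let L : (Fin n → K) →L[K] (Fin n → K) := (π ^ N)⁻¹ • ContinuousLinearMap.id K _
  have hL : ∀ x ∈ U, ‖L x‖ ≤ 1 := fun x hx => by
    have h := mem_closedBall_zero_iff.1 (hU hx)
    change ‖(π ^ N)⁻¹ • x‖ ≤ 1
    rw [norm_smul, norm_inv, norm_pow, inv_mul_le_iff₀ (pow_pos (norm_pos_iff.2 hπ0) N), mul_one]
    exact h
  have hFL : ∀ i, evalSeries (F i) =
      fun x => evalSeries (MvPowerSeries.rescale (fun _ => π ^ N) (F i)) (L x) := by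
    intro i
    ext x
    have h := evalSeries_smul_rescale 1 (fun _ => π ^ N) (F i) (L x)
    rw [one_smul, one_mul] at h
    rw [h]
    congr 1
    ext t
    simp [L, hb]
  have hs : ∀ i, ∀ z ∈ U, HasStrictFDerivAt (evalSeries (F i))
      (totalDeriv (MvPowerSeries.rescale (fun _ => π ^ N) (F i)) (L z) ∘L L) z := by
    intro i z hz
    rw [hFL]
    exact ((hN i).hasStrictFDerivAt (hL z hz)).comp z L.hasStrictFDerivAt
  refine ⟨fun i z hz => ?_, fun i => ?_⟩
  · rw [(hs i z hz).hasFDerivAt.fderiv]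
    exact hs i z hz
  · have h1 : ContinuousOn (fun z => totalDeriv (MvPowerSeries.rescale (fun _ => π ^ N) (F i))
        (L z) ∘L L) U :=
      ((hN i).continuousOn_totalDeriv.comp L.continuous.continuousOn
        fun x hx => mem_closedBall_zero_iff.2 (hL x hx)).clm_comp continuousOn_const
    exact h1.congr fun z hz => (hs i z hz).hasFDerivAt.fderiv

end Differentiability

/-! ### Multiplying the last component by a unit. -/

section BoxIsometries

variable {K : Type*} [NontriviallyNormedField K] [IsUltrametricDist K] [CompleteSpace K]

/-- Near a point at which a mapping is a submersion, there is an isometry which multiplies the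
last component by a given factor close to one, and preserves the others. -/
theorem exists_isometryEquiv_mul_last {X : Type*} [NormedAddCommGroup X] [NormedSpace K X]
    [IsUltrametricDist X] [CompleteSpace X] {k : ℕ} {h : X → (Fin (k + 1) → K)}
    {H : X →L[K] (Fin (k + 1) → K)} {B : (Fin (k + 1) → K) →L[K] X} (hHB : ∀ y, H (B y) = y)
    {C C' ε r : ℝ} {z : X} {ω : K}
    (hC : 0 ≤ C) (hC' : 0 ≤ C') (hB : ∀ y, ‖B y‖ ≤ C * ‖y‖) (hr : 0 ≤ r) (hCε : C * ε < 1)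
    (hh : ∀ x ∈ Metric.closedBall z r, ∀ y ∈ Metric.closedBall z r,
      ‖h x - h y - H (x - y)‖ ≤ ε * ‖x - y‖)
    (hH : ∀ w, ‖H w‖ ≤ C' * ‖w‖) (hz : ‖h z‖ ≤ C') (hω : ‖ω - 1‖ * (C' * C) < 1)
    (hω' : ‖ω - 1‖ * (C' * C) ≤ r) :
    ∃ Φ : X ≃ᵢ X, (∀ x, Φ x ∈ Metric.closedBall z r ↔ x ∈ Metric.closedBall z r) ∧
      ∀ x ∈ Metric.closedBall z r, (∀ i : Fin k, h (Φ x) i.castSucc = h x i.castSucc) ∧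
        h (Φ x) (Fin.last k) = ω * h x (Fin.last k) := by
  obtain ⟨Ψ, hΨ1, hΨ2, -⟩ := exists_isometryEquiv_straighten hHB hC hB hr hCε hh
  set e : Fin (k + 1) → K := Pi.single (Fin.last k) 1
  have he : ‖e‖ ≤ 1 := by
    refine (pi_norm_le_iff_of_nonneg zero_le_one).2 fun i => ?_
    simp only [e, Pi.single_apply]
    split_ifs <;> simp
  have hBe : ‖B e‖ ≤ C := (hB e).trans (mul_le_of_le_one_right hC he)
  -- In the straightened coordinates h is affine, and a shift along B e changes only its last
  -- component; the amount of the shift multiplies that component by ω.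
  let τ : X → X := fun y => y + ((ω - 1) * (h z (Fin.last k) + H (y - z) (Fin.last k))) • B e
  obtain ⟨T, hT1, hT2⟩ := exists_isometryEquiv_of_near_id (φ := τ) (z := z) (r := r) hω
    (fun x _ y _ => by
      have e1 : τ x - τ y - (x - y) = ((ω - 1) * H (x - y) (Fin.last k)) • B e := by
        have e2 : H (x - y) = H (x - z) - H (y - z) := by rw [← map_sub]; congr 1; abel
        rw [e2, Pi.sub_apply]
        simp only [τ]
        module
      rw [e1, norm_smul, norm_mul]
      calc ‖ω - 1‖ * ‖H (x - y) (Fin.last k)‖ * ‖B e‖ ≤ ‖ω - 1‖ * (C' * ‖x - y‖) * C := by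
            gcongr
            exact (norm_le_pi_norm _ _).trans (hH _)
        _ = ‖ω - 1‖ * (C' * C) * ‖x - y‖ := by ring)
    (by
      simp only [τ, sub_self, map_zero, Pi.zero_apply, add_zero, add_sub_cancel_left]
      rw [norm_smul, norm_mul]
      calc ‖ω - 1‖ * ‖h z (Fin.last k)‖ * ‖B e‖ ≤ ‖ω - 1‖ * C' * C := by
            gcongr
            exact (norm_le_pi_norm _ _).trans hz
        _ ≤ r := by rwa [mul_assoc])
  have hΦ : ∀ x, Ψ.symm (T (Ψ x)) ∈ Metric.closedBall z r ↔ x ∈ Metric.closedBall z r := by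
    intro x
    rw [← hΨ1, IsometryEquiv.apply_symm_apply, hT2, hΨ1]
  -- The near-identity map T, conjugated back by the straightening.
  refine ⟨(Ψ.trans T).trans Ψ.symm, hΦ, fun x hx => ?_⟩
  have key : h (Ψ.symm (T (Ψ x))) = h x + ((ω - 1) * h x (Fin.last k)) • e := by
    have hΨx := (hΨ1 x).2 hx
    rw [hΨ2 _ ((hΦ x).2 hx), IsometryEquiv.apply_symm_apply, hT1 _ hΨx]
    have e1 : τ (Ψ x) - z = (Ψ x - z) + ((ω - 1) * h x (Fin.last k)) • B e := by
      rw [hΨ2 x hx]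
      simp only [τ, Pi.add_apply]
      abel
    rw [e1, map_add, map_smul, hHB, ← add_assoc, ← hΨ2 x hx]
  constructor
  · intro i
    change h (Ψ.symm (T (Ψ x))) i.castSucc = _
    rw [key]
    simp [e, (Fin.castSucc_lt_last i).ne]
  · change h (Ψ.symm (T (Ψ x))) (Fin.last k) = _
    rw [key]
    simp only [e, Pi.add_apply, Pi.smul_apply, Pi.single_eq_same, smul_eq_mul]
    ring

end BoxIsometries

/-! ### Multiplicative boxes. -/

section Boxes

variable {K : Type*} [NontriviallyNormedField K] {n : ℕ}

/-- The size of the `t`-th coordinate relative to the truncation at `‖x‖ ^ (M + 1)`. -/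
def truncNorm (M : ℕ) (x : Fin n → K) (t : Fin n) : ℝ := max ‖x t‖ (‖x‖ ^ (M + 1))

/-- The multiplicative box around `x`. -/
def box (M : ℕ) (c : ℝ) (x : Fin n → K) : Set (Fin n → K) :=
  {y | ∀ t, ‖y t - x t‖ ≤ c * truncNorm M x t}

theorem exists_norm_apply_eq (hn : 0 < n) (x : Fin n → K) : ∃ t, ‖x t‖ = ‖x‖ := by
  have : Nonempty (Fin n) := ⟨⟨0, hn⟩⟩
  obtain ⟨t, ht⟩ := Finite.exists_max fun t => ‖x t‖
  exact ⟨t, le_antisymm (norm_le_pi_norm x t) ((pi_norm_le_iff_of_nonneg (norm_nonneg _)).2 ht)⟩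

theorem truncNorm_pos {M : ℕ} {x : Fin n → K} (hx : x ≠ 0) (t : Fin n) : 0 < truncNorm M x t :=
  lt_max_of_lt_right (pow_pos (norm_pos_iff.2 hx) _)

theorem truncNorm_le {M : ℕ} {x : Fin n → K} (hx : ‖x‖ ≤ 1) (t : Fin n) :
    truncNorm M x t ≤ ‖x‖ :=
  max_le (norm_le_pi_norm x t) (by
    rw [pow_succ]; exact mul_le_of_le_one_left (norm_nonneg _) (pow_le_one₀ (norm_nonneg _) hx))

theorem self_mem_box {M : ℕ} {c : ℝ} (hc : 0 ≤ c) (x : Fin n → K) : x ∈ box M c x := fun t => by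
  rw [sub_self, norm_zero]
  exact mul_nonneg hc (le_max_of_le_left (norm_nonneg _))

theorem box_eq_pi (M : ℕ) (c : ℝ) (x : Fin n → K) :
    box M c x = Set.univ.pi fun t => Metric.closedBall (x t) (c * truncNorm M x t) := by
  ext y
  simp [box, dist_eq_norm]

theorem isCompact_box [ProperSpace K] (M : ℕ) (c : ℝ) (x : Fin n → K) : IsCompact (box M c x) := by
  rw [box_eq_pi]
  exact isCompact_univ_pi fun t => isCompact_closedBall _ _

variable [IsUltrametricDist K]

theorem isOpen_box {M : ℕ} {c : ℝ} (hc : 0 < c) {x : Fin n → K} (hx : x ≠ 0) :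
    IsOpen (box M c x) := by
  rw [box_eq_pi]
  exact isOpen_set_pi finite_univ fun t _ =>
    IsUltrametricDist.isOpen_closedBall _ (mul_pos hc (truncNorm_pos hx t)).ne'

/-- For c < 1 the displacement in each coordinate is smaller than its truncated size, so
ultrametricity keeps both ‖x‖ and these sizes constant on the box. -/
theorem truncNorm_eq_of_mem_box {M : ℕ} (hn : 0 < n) {c : ℝ} (hc : c < 1) {x y : Fin n → K}
    (hx0 : x ≠ 0) (hx : ‖x‖ ≤ 1) (hy : y ∈ box M c x) :
    ‖y‖ = ‖x‖ ∧ ∀ t, truncNorm M y t = truncNorm M x t := by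
  have hlt : ∀ t, ‖y t - x t‖ < truncNorm M x t := fun t =>
    (hy t).trans_lt (mul_lt_of_lt_one_left (truncNorm_pos hx0 t) hc)
  have hnorm : ‖y‖ = ‖x‖ := by
    refine norm_eq_of_norm_sub_lt ?_
    obtain ⟨t, ht⟩ := exists_norm_apply_eq hn (y - x)
    rw [← ht]
    exact (hlt t).trans_le (truncNorm_le hx t)
  refine ⟨hnorm, fun t => ?_⟩
  rw [truncNorm, truncNorm, hnorm]
  by_cases h : ‖x‖ ^ (M + 1) ≤ ‖x t‖
  · have h1 := hlt t
    rw [truncNorm, max_eq_left h] at h1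
    rw [norm_eq_of_norm_sub_lt h1]
  · push Not at h
    have h1 := hlt t
    rw [truncNorm, max_eq_right h.le] at h1
    have h2 : ‖y t‖ ≤ ‖x‖ ^ (M + 1) := by
      calc ‖y t‖ = ‖(y t - x t) + x t‖ := by rw [sub_add_cancel]
        _ ≤ max _ _ := IsUltrametricDist.norm_add_le_max _ _
        _ ≤ _ := max_le h1.le h.le
    rw [max_eq_right h.le, max_eq_right h2]

/-- Like ultrametric balls, boxes have each of their points as a centre. Hence they partition the
space without the origin near 0, and can be recentred at a point of the zero set. -/
theorem box_eq_of_mem_box {M : ℕ} (hn : 0 < n) {c : ℝ} (hc : c < 1) {x y : Fin n → K}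
    (hx0 : x ≠ 0) (hx : ‖x‖ ≤ 1) (hy : y ∈ box M c x) : box M c y = box M c x := by
  have h := (truncNorm_eq_of_mem_box hn hc hx0 hx hy).2
  ext w
  simp only [box, mem_ofPred_eq, h]
  refine forall_congr' fun t => ?_
  have h1 := hy t
  constructor
  · intro h2
    calc ‖w t - x t‖ = ‖(w t - y t) + (y t - x t)‖ := by congr 1; ring
      _ ≤ max _ _ := IsUltrametricDist.norm_add_le_max _ _
      _ ≤ _ := max_le h2 h1
  · intro h2
    calc ‖w t - y t‖ = ‖(w t - x t) - (y t - x t)‖ := by congr 1; ring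
      _ ≤ max _ _ := norm_sub_le_max _ _
      _ ≤ _ := max_le h2 h1

end Boxes

/-! ### Measure preserving symmetries of the boxes. -/

section BoxSymmetry

variable {K : Type*} [NontriviallyNormedField K] [IsUltrametricDist K] [ProperSpace K] {n k : ℕ}
  {π : K}

/-- An isometry conjugated by a diagonal scaling preserves Haar measure. -/
theorem measurePreserving_scaled_isometryEquiv [MeasurableSpace K] [BorelSpace K]
    (hπ : IsNormalizedUniformizer π) (vol : Measure K) [vol.IsAddHaarMeasure] {b : Fin n → K}
    (hb : ∀ t, b t ≠ 0) (Φ : (Fin n → K) ≃ᵢ (Fin n → K)) :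
    MeasurePreserving (fun y => b * Φ (b⁻¹ * y)) (Measure.pi fun _ : Fin n => vol)
      (Measure.pi fun _ : Fin n => vol) := by
  have hm : ∀ c : Fin n → K, Measurable fun y : Fin n → K => c * y := fun c =>
    (continuous_const.mul continuous_id).measurable
  have hΦ := measurePreserving_isometryEquiv (Measure.pi fun _ : Fin n => vol) Φ
  have hcomp : Measurable fun y => b * Φ (b⁻¹ * y) :=
    (hm b).comp (Φ.continuous.measurable.comp (hm b⁻¹))
  refine ⟨hcomp, Measure.ext fun s hs => ?_⟩
  rw [Measure.map_apply hcomp hs]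
  have hdet : (Matrix.diagonal b).det ≠ 0 := by
    rw [Matrix.det_diagonal]
    exact Finset.prod_ne_zero_iff.2 fun t _ => hb t
  have hD : ∀ x : Fin n → K, (Matrix.diagonal b).mulVec x = b * x := fun x => by
    ext t
    simp [Matrix.mulVec_diagonal]
  have h1 := pi_image_mulVec hπ vol hdet hs
  have h2 := pi_image_mulVec hπ vol hdet (hcomp hs)
  rw [← h2, ← h1]
  congr 1
  simp only [hD]
  rw [← hΦ.measure_preimage (hm b hs).nullMeasurableSet]
  congr 1
  ext x
  have h3 : b⁻¹ * (b * x) = x := by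
    ext t
    simp [hb t]
  simp [h3]

/-- Scaling by b_t = π ^ a_t turns the box into a ball and the f_i into normalized series with
uniform bounds, to which `exists_isometryEquiv_mul_last` applies. Essential is that e' depends on e
but not on x. The first k functions must vanish at the centre, where the right inverse is taken. -/
theorem exists_box_symmetry [CharZero K] [MeasurableSpace K] [BorelSpace K]
    (hπ : IsNormalizedUniformizer π) (vol : Measure K)
    [vol.IsAddHaarMeasure] {M N : ℕ} (hkn : k + 1 ≤ n) {F : Fin (k + 1) → MvPowerSeries (Fin n) K}
    (hF0 : ∀ i, MvPowerSeries.constantCoeff (F i) = 0)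
    (hM : ∀ i t, ∃ e, e ≤ M ∧ MvPowerSeries.coeff (Finsupp.single t e) (F i) ≠ 0)
    (hN : ∀ i, IsRestricted (MvPowerSeries.rescale (fun _ => π ^ N) (F i)))
    {U : Set (Fin n → K)} (hU : U ∈ 𝓝 0) (hnd : IsNondegenerate F U)
    (hnd' : IsNondegenerate (fun i : Fin k => F i.castSucc) U) :
    ∃ A : ℕ, 2 * N ≤ A ∧ ∃ e₀ : ℕ, ∀ e ≥ e₀, ∃ e' : ℕ, 0 < e' ∧ ∀ x : Fin n → K, x ≠ 0 →
      ‖x‖ ≤ ‖π‖ ^ A → (∀ i : Fin k, evalSeries (F i.castSucc) x = 0) → ∀ ω : K,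
      ‖ω - 1‖ ≤ ‖π‖ ^ e' → ∃ ρ : (Fin n → K) → (Fin n → K),
        MeasurePreserving ρ (Measure.pi fun _ => vol) (Measure.pi fun _ => vol) ∧
        (∀ y, ρ y ∈ box M (‖π‖ ^ e) x ↔ y ∈ box M (‖π‖ ^ e) x) ∧
        ∀ y ∈ box M (‖π‖ ^ e) x,
          (∀ i : Fin k, evalSeries (F i.castSucc) (ρ y) = evalSeries (F i.castSucc) y) ∧
          evalSeries (F (Fin.last k)) (ρ y) = ω * evalSeries (F (Fin.last k)) y := by
  have hπ0 := hπ.ne_zero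
  have hπ1 := hπ.norm_lt_one
  have hπp := hπ.norm_pos
  obtain ⟨C, hC, A, hNA, hB⟩ := exists_bounded_rightInverse hπ hkn hF0 hM hN hU hnd hnd'
  choose c hc hcF using fun i => (hN i).exists_norm_coeff_le
  set C' : ℝ := ∑ i, (c i + ∑ m ∈ expBox n (2 * M), ‖MvPowerSeries.coeff m (F i)‖) with hC'def
  have hterm : ∀ i, 0 ≤ c i + ∑ m ∈ expBox n (2 * M), ‖MvPowerSeries.coeff m (F i)‖ := fun i =>
    add_nonneg (hc i).le (Finset.sum_nonneg fun _ _ => norm_nonneg _)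
  have hC' : 0 ≤ C' := Finset.sum_nonneg fun i _ => hterm i
  have hsmall : ∀ D : ℝ, 0 ≤ D → ∀ ε : ℝ, 0 < ε → ∃ e₀ : ℕ, ∀ e ≥ e₀, D * ‖π‖ ^ e < ε := by
    intro D hD ε hε
    have := ((tendsto_pow_atTop_nhds_zero_of_lt_one hπp.le hπ1).const_mul D)
    rw [mul_zero] at this
    exact eventually_atTop.1 (this.eventually (gt_mem_nhds hε))
  -- Small radius: the straightening map has to be within a factor less than 1 of the identity.
  obtain ⟨e₀, he₀⟩ := hsmall (C * C') (by positivity) 1 one_pos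
  refine ⟨A, hNA, e₀, fun e he => ?_⟩
  -- Closeness of ω to 1: the shift that multiplies the last component must be near the identity and
  -- stay within the ball.
  obtain ⟨e₁, he₁⟩ := hsmall (C' * C) (by positivity) (min 1 (‖π‖ ^ e))
    (lt_min one_pos (pow_pos hπp e))
  refine ⟨e₁ + 1, Nat.succ_pos _, fun x hx0 hxA hxV ω hω => ?_⟩
  have hx1 : ‖x‖ ≤ 1 := hxA.trans (pow_le_one₀ hπp.le hπ1.le)
  have hxp := norm_pos_iff.2 hx0
  obtain ⟨t₀, ht₀⟩ := exists_norm_apply_eq (by omega : 0 < n) x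
  have hanti : ∀ {i j : ℕ}, ‖π‖ ^ i ≤ ‖π‖ ^ j → j ≤ i := fun {i j} h =>
    (pow_le_pow_iff_right_of_lt_one₀ hπp hπ1).1 h
  have hexp : ∀ t, ∃ a : ℕ, truncNorm M x t = ‖π‖ ^ a := by
    intro t
    have hle := (truncNorm_le (M := M) hx1 t).trans hx1
    have hpos := truncNorm_pos (M := M) hx0 t
    rcases max_choice ‖x t‖ (‖x‖ ^ (M + 1)) with h | h
    · rw [truncNorm, h] at hle hpos ⊢
      exact hπ.exists_norm_eq_pow (norm_pos_iff.1 hpos) hle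
    · rw [truncNorm, h] at hle hpos ⊢
      rw [← ht₀, ← norm_pow] at hle hpos ⊢
      exact hπ.exists_norm_eq_pow (norm_pos_iff.1 hpos) hle
  choose a ha using hexp
  have haA : ∀ t, A ≤ a t := fun t => hanti (by
    rw [← ha]; exact (truncNorm_le hx1 t).trans hxA)
  have hat₀ : ‖x‖ = ‖π‖ ^ a t₀ := by
    rw [← ha]
    refine le_antisymm ?_ (truncNorm_le hx1 t₀)
    rw [← ht₀]
    exact le_max_left _ _
  set b : Fin n → K := fun t => π ^ a t with hbdef
  have hb : ∀ t, b t ≠ 0 := fun t => pow_ne_zero _ hπ0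
  have hbn : ∀ t, ‖b t‖ = truncNorm M x t := fun t => by rw [hbdef, norm_pow, ha]
  have hbb : ∀ y, b * (b⁻¹ * y) = y := fun y => by
    ext t
    simp [hb t]
  set u : Fin n → K := b⁻¹ * x with hudef
  have hbox : ∀ y, b⁻¹ * y ∈ Metric.closedBall u (‖π‖ ^ e) ↔ y ∈ box M (‖π‖ ^ e) x := by
    intro y
    rw [mem_closedBall_iff_norm, pi_norm_le_iff_of_nonneg (pow_nonneg hπp.le e)]
    refine forall_congr' fun t => ?_
    have h1 : (b⁻¹ * y - u) t = (b t)⁻¹ * (y t - x t) := by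
      simp only [hudef, Pi.sub_apply, Pi.mul_apply, Pi.inv_apply]
      ring
    rw [h1, norm_mul, norm_inv, hbn, inv_mul_le_iff₀ (truncNorm_pos hx0 t), mul_comm]
  have hut : ∀ t, ‖u t‖ = (truncNorm M x t)⁻¹ * ‖x t‖ := fun t => by
    rw [hudef, Pi.mul_apply, Pi.inv_apply, norm_mul, norm_inv, hbn]
  have hu1 : ‖u‖ ≤ 1 := by
    refine (pi_norm_le_iff_of_nonneg zero_le_one).2 fun t => ?_
    rw [hut, inv_mul_le_iff₀ (truncNorm_pos hx0 t), mul_one]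
    exact le_max_left _ _
  -- The truncation is what makes this dichotomy hold: a rescaled coordinate is a unit unless its
  -- weight was set to (M + 1) a t₀.
  have hu2 : ∀ t, ‖u t‖ = 1 ∨ (M + 1) * a t₀ ≤ a t := by
    intro t
    rcases max_choice ‖x t‖ (‖x‖ ^ (M + 1)) with h | h
    · left
      rw [hut]
      have h1 : truncNorm M x t = ‖x t‖ := h
      rw [← h1]
      exact inv_mul_cancel₀ (truncNorm_pos hx0 t).ne'
    · right
      have h1 : truncNorm M x t = ‖x‖ ^ (M + 1) := h
      rw [ha, hat₀, ← pow_mul] at h1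
      exact (mul_comm _ _).trans_le (hanti h1.le)
  set h : (Fin n → K) → (Fin (k + 1) → K) := fun v i => evalSeries (normalizedSeries π (F i) a) v
  have hhF : ∀ i v, h v i = (π ^ minWeight (F i) a)⁻¹ * evalSeries (F i) (b * v) := fun i v =>
    evalSeries_smul_rescale _ _ _ _
  have hFh : ∀ i y, evalSeries (F i) y = π ^ minWeight (F i) a * h (b⁻¹ * y) i := fun i y => by
    rw [hhF, hbb, mul_inv_cancel_left₀ (pow_ne_zero _ hπ0)]
  obtain ⟨B, hBC, hHB⟩ := hB a haA u t₀ hu1 hu2 fun i => by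
    have := hhF i.castSucc u
    rw [hudef, hbb, hxV i, mul_zero] at this
    exact this
  have hres : ∀ i, IsRestricted (normalizedSeries π (F i) a) := fun i =>
    isRestricted_rescale_pow hπ1.le (hN i) _ fun t => by have := haA t; omega
  have hcoeff : ∀ i m, ‖MvPowerSeries.coeff m (normalizedSeries π (F i) a)‖ ≤ C' := fun i m =>
    (norm_coeff_normalizedSeries_le hπ0 hπ1.le (hcF i) (hM i)
      (fun t => hNA.trans (haA t)) m).trans
      (Finset.single_le_sum (f := fun i => c i + ∑ m ∈ expBox n (2 * M),
        ‖MvPowerSeries.coeff m (F i)‖) (fun i _ => hterm i) (Finset.mem_univ i))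
  have hωC : ‖ω - 1‖ * (C' * C) < min 1 (‖π‖ ^ e) := by
    rw [mul_comm]
    refine lt_of_le_of_lt ?_ (he₁ (e₁ + 1) (Nat.le_succ _))
    gcongr
  obtain ⟨Φ, hΦ1, hΦ2⟩ := exists_isometryEquiv_mul_last (h := h) (z := u) (r := ‖π‖ ^ e)
    (C' := C') (ε := C' * ‖π‖ ^ e) (ω := ω) hHB hC.le hC' hBC (pow_nonneg hπp.le e)
    (by rw [← mul_assoc]; exact he₀ e he)
    (fun v hv w hw => (pi_norm_le_iff_of_nonneg (by positivity)).2 fun i =>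
      norm_evalSeries_sub_totalDeriv_le (hres i) hC' (hcoeff i) hu1
        (pow_le_one₀ hπp.le hπ1.le) hv hw)
    (fun w => (pi_norm_le_iff_of_nonneg (by positivity)).2 fun i =>
      norm_totalDeriv_apply_le hC' (hcoeff i) hu1 w)
    ((pi_norm_le_iff_of_nonneg hC').2 fun i => norm_evalSeries_le hC' (hcoeff i) hu1)
    (hωC.trans_le (min_le_left _ _)) (hωC.le.trans (min_le_right _ _))
  have hbb' : ∀ y, b⁻¹ * (b * y) = y := fun y => by
    ext t
    simp [hb t]
  refine ⟨fun y => b * Φ (b⁻¹ * y), measurePreserving_scaled_isometryEquiv hπ vol hb Φ,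
    fun y => ?_, fun y hy => ?_⟩
  · rw [← hbox, ← hbox, hbb', hΦ1]
  · obtain ⟨h1, h2⟩ := hΦ2 _ ((hbox y).2 hy)
    refine ⟨fun i => ?_, ?_⟩
    · rw [hFh, hFh, hbb', h1]
    · rw [hFh, hFh _ y, hbb', h2]
      ring

end BoxSymmetry

/-! ### Quasicharacters: equivariance, measurability, bounds. -/

section Quasicharacters

variable {K : Type*} [NontriviallyNormedField K] [IsUltrametricDist K] (π : K)
  (χ : UnitGroup K →ₜ* ℂˣ)

theorem extendChar_unit_mul (ω : UnitGroup K) (y : K) :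
    extendChar χ (ω * y) = χ ω * extendChar χ y := by
  have hω : ‖(ω : K)‖ = 1 := mem_sphere_zero_iff_norm.1 ω.2
  by_cases hy : y ∈ Metric.sphere (0 : K) 1
  · have h : (ω : K) * y ∈ Metric.sphere (0 : K) 1 := by
      rw [mem_sphere_zero_iff_norm] at hy ⊢
      rw [norm_mul, hω, hy, one_mul]
    rw [extendChar, extendChar, dif_pos h, dif_pos hy, ← Units.val_mul, ← map_mul]
    rfl
  · have h : (ω : K) * y ∉ Metric.sphere (0 : K) 1 := by
      rw [mem_sphere_zero_iff_norm] at hy ⊢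
      rwa [norm_mul, hω, one_mul]
    rw [extendChar, extendChar, dif_neg h, dif_neg hy, mul_zero]

theorem quasichar_unit_mul (s : ℂ) (ω : UnitGroup K) (z : K) :
    quasichar π χ s (ω * z) = χ ω * quasichar π χ s z := by
  have hω : ‖(ω : K)‖ = 1 := mem_sphere_zero_iff_norm.1 ω.2
  have hn : ‖(ω : K) * z‖ = ‖z‖ := by rw [norm_mul, hω, one_mul]
  rw [quasichar, quasichar, hn, ac, ac, ord, ord, hn, mul_assoc (ω : K), extendChar_unit_mul,
    mul_assoc]

theorem continuous_extendChar : Continuous (extendChar χ) := by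
  have hs : IsClopen (Metric.sphere (0 : K) 1) := IsUltrametricDist.isClopen_sphere 0 one_ne_zero
  have h1 : ContinuousOn (extendChar χ) (Metric.sphere (0 : K) 1) := by
    rw [continuousOn_iff_continuous_domRestrict]
    have h2 : (Metric.sphere (0 : K) 1).domRestrict (extendChar χ) = fun x => ((χ x : ℂˣ) : ℂ) := by
      ext x
      exact dif_pos x.2
    rw [h2]
    exact Units.continuous_val.comp (map_continuous χ)
  have h2 : ContinuousOn (extendChar χ) (Metric.sphere (0 : K) 1)ᶜ :=
    continuousOn_const.congr fun x hx => dif_neg hx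
  rw [← continuousOn_univ, ← union_compl_self (Metric.sphere (0 : K) 1)]
  exact h1.union_of_isOpen h2 hs.isOpen hs.compl.isOpen

theorem exists_norm_extendChar_le [ProperSpace K] : ∃ D : ℝ, ∀ x, ‖extendChar χ x‖ ≤ D := by
  obtain ⟨D, hD⟩ := (isCompact_sphere (0 : K) 1).exists_bound_of_continuousOn
    (continuous_extendChar χ).continuousOn
  refine ⟨max D 0, fun x => ?_⟩
  by_cases hx : x ∈ Metric.sphere (0 : K) 1
  · exact (hD x hx).trans (le_max_left _ _)
  · rw [extendChar, dif_neg hx, norm_zero]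
    exact le_max_right _ _

/-- Off 0 the norm, and with it the order, is locally constant, so the quasicharacter is continuous
there. -/
theorem measurable_quasichar [MeasurableSpace K] [BorelSpace K] (s : ℂ) :
    Measurable (quasichar π χ s) := by
  refine measurable_of_continuousOn_compl_singleton 0 fun z hz => ?_
  have hz0 : 0 < ‖z‖ := norm_pos_iff.2 hz
  have hev : ∀ᶠ w in 𝓝 z, extendChar χ (w * π ^ (-ord z)) * (‖z‖ : ℂ) ^ s = quasichar π χ s w := by
    filter_upwards [Metric.ball_mem_nhds z hz0] with w hw
    have h : ‖w‖ = ‖z‖ := norm_eq_of_norm_sub_lt (mem_ball_iff_norm.1 hw)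
    rw [quasichar, ac, ord, ord, h]
  refine ContinuousAt.continuousWithinAt (ContinuousAt.congr ?_ hev)
  exact (((continuous_extendChar χ).comp (continuous_id.mul continuous_const)).mul
    continuous_const).continuousAt

theorem norm_quasichar_le {D : ℝ} (hD : ∀ x, ‖extendChar χ x‖ ≤ D) {s : ℂ} (hs : 0 < s.re) {R : ℝ}
    {z : K} (hz : ‖z‖ ≤ R) : ‖quasichar π χ s z‖ ≤ D * R ^ s.re := by
  have hR : 0 ≤ R := (norm_nonneg z).trans hz
  rw [quasichar, norm_mul]
  refine mul_le_mul (hD _) ?_ (norm_nonneg _) ((norm_nonneg _).trans (hD 0))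
  rcases eq_or_ne z 0 with rfl | hz0
  · have : s ≠ 0 := fun h => by simp [h] at hs
    rw [norm_zero, Complex.ofReal_zero, Complex.zero_cpow this, norm_zero]
    exact Real.rpow_nonneg hR _
  · rw [Complex.norm_cpow_eq_rpow_re_of_pos (norm_pos_iff.2 hz0)]
    exact Real.rpow_le_rpow (norm_nonneg _) hz hs.le

theorem quasichar_zero {s : ℂ} (hs : 0 < s.re) : quasichar π χ s 0 = 0 := by
  have : s ≠ 0 := fun h => by simp [h] at hs
  rw [quasichar, norm_zero, Complex.ofReal_zero, Complex.zero_cpow this, mul_zero]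

end Quasicharacters

/-! ### Invariance of the Gel'fand-Leray integral. -/

section Invariance

variable {K : Type*} [NontriviallyNormedField K] [IsUltrametricDist K] [ProperSpace K]
  [MeasurableSpace K] [BorelSpace K] {n k : ℕ} {π : K} {vol : Measure K} [vol.IsAddHaarMeasure]
  {F : Fin k → MvPowerSeries (Fin n) K} {U : Set (Fin n → K)}

/-- The restriction of the Gel'fand-Leray measure to the level sets of `g` in `b` is invariant
under a measure preserving mapping which preserves the equations and multiplies `g` by `ω`. -/
theorem gelfandLerayMeasure_inter_preimage (hπ : IsNormalizedUniformizer π)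
    (hvol : vol (Metric.closedBall (0 : K) 1) = 1) (hkn : k ≤ n) (hF : IsC1On F U) (hU : IsOpen U)
    (hrank : ∀ z ∈ zeroSet F U, (jacobian F z).rank = k) {b : Set (Fin n → K)} (hbU : b ⊆ U)
    (hb : IsCompact b) (hbo : IsOpen b) {g : (Fin n → K) → K} (hg : Continuous g) {ω : K}
    {ρ : (Fin n → K) → (Fin n → K)}
    (hρ : MeasurePreserving ρ (Measure.pi fun _ => vol) (Measure.pi fun _ => vol))
    (hρb : ∀ y, ρ y ∈ b ↔ y ∈ b) (hρF : ∀ y ∈ b, evalSeriesTuple F (ρ y) = evalSeriesTuple F y)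
    (hρg : ∀ y ∈ b, g (ρ y) = ω * g y) {S : Set K} (hS : IsClopen S) :
    gelfandLerayMeasure vol F U (b ∩ g ⁻¹' ((ω * ·) ⁻¹' S)) =
      gelfandLerayMeasure vol F U (b ∩ g ⁻¹' S) := by
  have hS' : IsClopen (g ⁻¹' S) := hS.preimage hg
  have hS'' : IsClopen (g ⁻¹' ((ω * ·) ⁻¹' S)) :=
    hS.preimage (continuous_const.mul hg)
  have h1 := isTubeVolume_gelfandLeray hπ hvol hkn hF hU hrank (inter_subset_left.trans hbU)
    (hb.inter_right hS'.isClosed) (hbo.inter hS'.isOpen)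
  have h2 := isTubeVolume_gelfandLeray hπ hvol hkn hF hU hrank (inter_subset_left.trans hbU)
    (hb.inter_right hS''.isClosed) (hbo.inter hS''.isOpen)
  refine h2.unique hπ ?_
  unfold IsTubeVolume at h1 ⊢
  filter_upwards [h1] with N hN
  rw [← hN]
  have hcl : IsClopen b := ⟨hb.isClosed, hbo⟩
  have hmeas : MeasurableSet (b ∩ g ⁻¹' S ∩ {x | ‖evalSeriesTuple F x‖ ≤ ‖π‖ ^ N}) := by
    have hcont : ContinuousOn (fun x => ‖evalSeriesTuple F x‖) (b ∩ g ⁻¹' S) :=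
      (hF.continuousOn.mono (inter_subset_left.trans hbU)).norm
    exact (hcont.preimage_isClosed_of_isClosed (hcl.isClosed.inter hS'.isClosed)
      isClosed_Iic).measurableSet
  -- The tube in the first set is the preimage under ρ of the tube in the second one, so both have
  -- the same Haar volume for every large N.
  rw [← hρ.measure_preimage hmeas.nullMeasurableSet]
  congr 1
  ext y
  simp only [mem_inter_iff, mem_preimage, mem_ofPred_eq, hρb]
  constructor
  · rintro ⟨⟨h3, h4⟩, h5⟩
    exact ⟨⟨h3, by rwa [hρg y h3]⟩, by rwa [hρF y h3]⟩
  · rintro ⟨⟨h3, h4⟩, h5⟩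
    exact ⟨⟨h3, by rwa [hρg y h3] at h4⟩, by rwa [hρF y h3] at h5⟩

/-- The image under g of the measure on b is invariant under multiplication by ω. Closed balls are
clopen and form a generating π-system, so invariance on clopen sets is enough. -/
theorem setIntegral_quasichar_eq (hπ : IsNormalizedUniformizer π)
    (hvol : vol (Metric.closedBall (0 : K) 1) = 1) (hkn : k ≤ n) (hF : IsC1On F U) (hU : IsOpen U)
    (hrank : ∀ z ∈ zeroSet F U, (jacobian F z).rank = k) {b : Set (Fin n → K)} (hbU : b ⊆ U)
    (hb : IsCompact b) (hbo : IsOpen b) {g : (Fin n → K) → K} (hg : Continuous g)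
    {ω : UnitGroup K} {ρ : (Fin n → K) → (Fin n → K)}
    (hρ : MeasurePreserving ρ (Measure.pi fun _ => vol) (Measure.pi fun _ => vol))
    (hρb : ∀ y, ρ y ∈ b ↔ y ∈ b) (hρF : ∀ y ∈ b, evalSeriesTuple F (ρ y) = evalSeriesTuple F y)
    (hρg : ∀ y ∈ b, g (ρ y) = ω * g y) (χ : UnitGroup K →ₜ* ℂˣ) (s : ℂ) :
    ∫ x in b, quasichar π χ s (g x) ∂gelfandLerayMeasure vol F U =
      χ ω * ∫ x in b, quasichar π χ s (g x) ∂gelfandLerayMeasure vol F U := by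
  set γ := gelfandLerayMeasure vol F U with hγ
  have hfin : γ b ≠ ⊤ :=
    (isTubeVolume_gelfandLeray hπ hvol hkn hF hU hrank hbU hb hbo).ne_top hπ hb
  have : IsFiniteMeasure (γ.restrict b) := ⟨by
    rw [Measure.restrict_apply_univ]; exact hfin.lt_top⟩
  set ν := (γ.restrict b).map g with hν
  have hνS : ∀ S, MeasurableSet S → ν S = γ (b ∩ g ⁻¹' S) := fun S hS => by
    rw [hν, Measure.map_apply hg.measurable hS,
      Measure.restrict_apply (hg.measurable hS), inter_comm]
  have hmul : Measurable fun z : K => (ω : K) * z := (continuous_const.mul continuous_id).measurable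
  have hinv : ν.map (fun z => (ω : K) * z) = ν := by
    have : IsFiniteMeasure ν := by rw [hν]; infer_instance
    have hball : ∀ S, IsClopen S → ν.map (fun z => (ω : K) * z) S = ν S := by
      intro S hS
      have hSm := hS.isOpen.measurableSet
      rw [Measure.map_apply hmul hSm, hνS _ (hmul hSm), hνS _ hSm]
      exact gelfandLerayMeasure_inter_preimage hπ hvol hkn hF hU hrank hbU hb hbo hg hρ hρb hρF
        hρg hS
    refine ext_of_generate_finite _ borel_eq_generateFrom_closedBall isPiSystem_closedBall ?_
      (hball _ isClopen_univ)
    rintro S ⟨x, r, hr, rfl⟩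
    exact hball _ (IsUltrametricDist.isClopen_closedBall x hr.ne')
  have hq := measurable_quasichar π χ s
  have h1 : ∫ x in b, quasichar π χ s (g x) ∂γ = ∫ z, quasichar π χ s z ∂ν := by
    rw [hν, integral_map hg.measurable.aemeasurable hq.aestronglyMeasurable]
  rw [h1]
  conv_lhs => rw [← hinv]
  rw [integral_map hmul.aemeasurable hq.aestronglyMeasurable]
  simp only [quasichar_unit_mul]
  exact integral_const_mul _ _

end Invariance

theorem exists_forall_eq_of_dist_lt {X Y : Type*} [PseudoMetricSpace X] [Zero Y] {Φ : X → Y}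
    (hΦ : IsLocallyConstant Φ) (hc : HasCompactSupport Φ) :
    ∃ δ > 0, ∀ x y, dist y x < δ → Φ y = Φ x := by
  obtain ⟨δ, hδ, h⟩ := lebesgue_number_lemma_of_metric (c := fun c : Y => {x | Φ x = c}) hc
    (fun c => hΦ.isOpen_fiber c) fun x _ => mem_iUnion.2 ⟨Φ x, rfl⟩
  have key : ∀ x y, x ∈ tsupport Φ → dist y x < δ → Φ y = Φ x := by
    intro x y hx hxy
    obtain ⟨c, hcx⟩ := h x hx
    have h1 : Φ y = c := hcx hxy
    have h2 : Φ x = c := hcx (Metric.mem_ball_self hδ)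
    rw [h1, h2]
  refine ⟨δ, hδ, fun x y hxy => ?_⟩
  by_cases hx : x ∈ tsupport Φ
  · exact key x y hx hxy
  · by_cases hy : y ∈ tsupport Φ
    · exact (key y x hy (by rwa [dist_comm])).symm
    · rw [image_eq_zero_of_notMem_tsupport hx, image_eq_zero_of_notMem_tsupport hy]

/-- The identity theorem gives vanishing near every point outside the point itself; normal form
excludes an exceptional value there. -/
theorem eq_zero_of_meromorphicNFOn {Z : ℂ → ℂ} (hZ : MeromorphicNFOn Z univ)
    (h0 : ∀ s : ℂ, 0 < s.re → Z s = 0) (s : ℂ) : Z s = 0 := by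
  have hev : ∀ᶠ w in 𝓝 (1 : ℂ), Z w = 0 := by
    filter_upwards [(isOpen_lt continuous_const Complex.continuous_re).mem_nhds
      (show (0 : ℝ) < (1 : ℂ).re by simp)] with w hw using h0 w hw
  have h1 : meromorphicOrderAt Z 1 = ⊤ :=
    meromorphicOrderAt_eq_top_iff.2 (hev.filter_mono nhdsWithin_le_nhds)
  have h2 : meromorphicOrderAt Z s = ⊤ := by
    by_contra h
    exact hZ.meromorphicOn.meromorphicOrderAt_ne_top_of_isPreconnected isPreconnected_univ
      (mem_univ s) (mem_univ 1) h h1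
  have h3 := ((hZ (mem_univ s)).eventuallyEq_nhdsNE_iff_eventuallyEq_nhds
    (analyticAt_const (v := (0 : ℂ))).meromorphicNFAt).1 (meromorphicOrderAt_eq_top_iff.1 h2)
  exact h3.eq_of_nhds

/-! ### Vanishing of the integral for Re s > 0. -/

section Vanishing

variable {K : Type*} [NontriviallyNormedField K] [IsUltrametricDist K] [ProperSpace K]
  [MeasurableSpace K] [BorelSpace K] {n k : ℕ} {π : K} {vol : Measure K} [vol.IsAddHaarMeasure]
  {U : Set (Fin n → K)}

theorem integrable_mul_quasichar (hπ : IsNormalizedUniformizer π)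
    (hvol : vol (Metric.closedBall (0 : K) 1) = 1) (hkn : k ≤ n)
    {F : Fin k → MvPowerSeries (Fin n) K} (hF : IsC1On F U) (hU : IsOpen U)
    (hrank : ∀ z ∈ zeroSet F U, (jacobian F z).rank = k) {Φ : (Fin n → K) → ℂ}
    (hΦ : Continuous Φ) {S : Set (Fin n → K)} (hSU : S ⊆ U) (hS : IsCompact S) (hSo : IsOpen S)
    (hΦS : ∀ x ∉ S, Φ x = 0) {g : (Fin n → K) → K} (hg : Continuous g) (χ : UnitGroup K →ₜ* ℂˣ)
    {s : ℂ} (hs : 0 < s.re) :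
    Integrable (fun x => Φ x * quasichar π χ s (g x)) (gelfandLerayMeasure vol F U) := by
  obtain ⟨D, hD⟩ := exists_norm_extendChar_le χ
  obtain ⟨R, hR⟩ := hS.exists_bound_of_continuousOn hg.continuousOn
  obtain ⟨E, hE⟩ := hS.exists_bound_of_continuousOn hΦ.continuousOn
  have hfin := (isTubeVolume_gelfandLeray hπ hvol hkn hF hU hrank hSU hS hSo).ne_top hπ hS
  rw [← integrableOn_iff_integrable_of_support_subset (s := S)]
  · refine Measure.integrableOn_of_bounded (M := E * (D * R ^ s.re)) hfin
      (hΦ.measurable.mul ((measurable_quasichar π χ s).comp hg.measurable)).aestronglyMeasurable ?_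
    refine (ae_restrict_iff' hSo.measurableSet).2 (ae_of_all _ fun x hx => ?_)
    rw [norm_mul]
    exact mul_le_mul (hE x hx) (norm_quasichar_le π χ hD hs (hR x hx)) (norm_nonneg _)
      ((norm_nonneg _).trans (hE x hx))
  · intro x hx
    by_contra h
    exact hx (by simp only [hΦS x h, zero_mul])

/-- The integral is the sum over the boxes in the support of Φ. Boxes that miss the zero set are
null, and the others vanish by their symmetry. All these boxes use the same e', and this is the
bound for the conductor. -/
theorem exists_integral_eq_zero [CharZero K] (hπ : IsNormalizedUniformizer π)
    (hvol : vol (Metric.closedBall (0 : K) 1) = 1) {M N : ℕ} (hkn : k + 1 ≤ n)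
    {F : Fin (k + 1) → MvPowerSeries (Fin n) K}
    (hF0 : ∀ i, MvPowerSeries.constantCoeff (F i) = 0)
    (hM : ∀ i t, ∃ e, e ≤ M ∧ MvPowerSeries.coeff (Finsupp.single t e) (F i) ≠ 0)
    (hN : ∀ i, IsRestricted (MvPowerSeries.rescale (fun _ => π ^ N) (F i)))
    {U₁ : Set (Fin n → K)} (hU₁ : U₁ ∈ 𝓝 0) (hnd : IsNondegenerate F U₁)
    (hnd' : IsNondegenerate (fun i : Fin k => F i.castSucc) U₁) :
    ∃ U₀ ∈ 𝓝 (0 : Fin n → K), ∀ U ⊆ U₀, IsOpen U →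
      (∀ z ∈ zeroSet (fun i : Fin k => F i.castSucc) U,
        (jacobian (fun i : Fin k => F i.castSucc) z).rank = k) →
      ∀ Φ : (Fin n → K) → ℂ, IsLocallyConstant Φ → HasCompactSupport Φ → tsupport Φ ⊆ U →
        ∃ e : ℕ, 0 < e ∧ ∀ χ : UnitGroup K →ₜ* ℂˣ, ¬ conductor χ ≤ e → ∀ s : ℂ, 0 < s.re →
          Integrable (fun x => Φ x * quasichar π χ s (evalSeries (F (Fin.last k)) x))
            (gelfandLerayMeasure vol (fun i : Fin k => F i.castSucc) U) ∧
          ∫ x, Φ x * quasichar π χ s (evalSeries (F (Fin.last k)) x)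
            ∂gelfandLerayMeasure vol (fun i : Fin k => F i.castSucc) U = 0 := by
  have hπp := hπ.norm_pos
  have hπ1 := hπ.norm_lt_one
  have hn : 0 < n := by omega
  obtain ⟨A, hNA, e₀, hsym⟩ := exists_box_symmetry hπ vol hkn hF0 hM hN hU₁ hnd hnd'
  refine ⟨Metric.closedBall 0 (‖π‖ ^ A), Metric.closedBall_mem_nhds _ (pow_pos hπp A),
    fun U hUA hU hrank Φ hΦ hΦc hΦU => ?_⟩
  set G : Fin k → MvPowerSeries (Fin n) K := fun i => F i.castSucc with hG
  have hUN : U ⊆ Metric.closedBall 0 (‖π‖ ^ N) := hUA.trans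
    (Metric.closedBall_subset_closedBall (pow_le_pow_of_le_one hπp.le hπ1.le (by omega)))
  have hF1 : IsC1On F U := isC1On_of_isRestricted hπ.ne_zero hN hUN
  have hG1 : IsC1On G U := isC1On_of_isRestricted hπ.ne_zero (fun i => hN i.castSucc) hUN
  have hU1 : ∀ x ∈ U, ‖x‖ ≤ 1 := fun x hx =>
    (mem_closedBall_zero_iff.1 (hUA hx)).trans (pow_le_one₀ hπp.le hπ1.le)
  set γ := gelfandLerayMeasure vol G U with hγ
  set S : Set (Fin n → K) := Function.support Φ with hSdef
  have hScl : IsClopen S := (hΦ.isClopen_fiber 0).compl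
  have hSU : S ⊆ U := (subset_tsupport Φ).trans hΦU
  have hSc : IsCompact S := hΦc.of_isClosed_subset hScl.isClosed (subset_tsupport Φ)
  have hΦS : ∀ x ∉ S, Φ x = 0 := fun x hx => Function.notMem_support.1 hx
  -- Cut off to the clopen support of Φ, the function f_l becomes continuous on the whole space.
  set g : (Fin n → K) → K := S.indicator (evalSeries (F (Fin.last k))) with hgdef
  have hg : Continuous g := by
    refine continuous_indicator (fun a ha => ?_) ?_
    · rw [hScl.frontier_eq] at ha
      exact absurd ha (notMem_empty a)
    · rw [hScl.isClosed.closure_eq]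
      exact (continuousOn_pi.1 hF1.continuousOn (Fin.last k)).mono hSU
  have hgS : ∀ x ∈ S, g x = evalSeries (F (Fin.last k)) x := fun x hx => indicator_of_mem hx _
  have hfg : ∀ (χ : UnitGroup K →ₜ* ℂˣ) (s : ℂ),
      (fun x => Φ x * quasichar π χ s (evalSeries (F (Fin.last k)) x)) =
        fun x => Φ x * quasichar π χ s (g x) := by
    intro χ s
    ext x
    by_cases hx : x ∈ S
    · rw [hgS x hx]
    · rw [hΦS x hx, zero_mul, zero_mul]
  obtain ⟨δ, hδ, hΦδ⟩ := exists_forall_eq_of_dist_lt hΦ hΦc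
  -- Radius below δ makes Φ constant on the boxes, and below 1 makes the boxes a partition.
  obtain ⟨e₁, he₁⟩ := exists_pow_lt_of_lt_one (lt_min hδ one_pos) hπ1
  set e := max e₀ e₁
  have heδ : ‖π‖ ^ e < min δ 1 :=
    (pow_le_pow_of_le_one hπp.le hπ1.le (le_max_right _ _)).trans_lt he₁
  have hep : 0 < ‖π‖ ^ e := pow_pos hπp e
  have he1 : ‖π‖ ^ e < 1 := heδ.trans_le (min_le_right _ _)
  have hboxΦ : ∀ x ∈ S, ∀ y ∈ box M (‖π‖ ^ e) x, Φ y = Φ x := by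
    intro x hx y hy
    refine hΦδ x y (lt_of_le_of_lt ?_ (heδ.trans_le (min_le_left _ _)))
    rw [dist_eq_norm, pi_norm_le_iff_of_nonneg hep.le]
    exact fun t => (hy t).trans (mul_le_of_le_one_right hep.le
      ((truncNorm_le (hU1 x (hSU hx)) t).trans (hU1 x (hSU hx))))
  have hboxS : ∀ x ∈ S, box M (‖π‖ ^ e) x ⊆ S := fun x hx y hy => by
    rw [hSdef, Function.mem_support, hboxΦ x hx y hy]
    exact hx
  have hbox0 : ∀ x ∈ S, x ≠ 0 → ∀ y ∈ box M (‖π‖ ^ e) x, y ≠ 0 := fun x hx hx0 y hy => by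
    have := (truncNorm_eq_of_mem_box hn he1 hx0 (hU1 x (hSU hx)) hy).1
    rw [← norm_pos_iff, this]
    exact norm_pos_iff.2 hx0
  obtain ⟨e', he', hsym⟩ := hsym e (le_max_left _ _)
  refine ⟨e', he', fun χ hχ s hs => ?_⟩
  rw [hfg]
  have hint := integrable_mul_quasichar (vol := vol) hπ hvol (by omega : k ≤ n) hG1 hU hrank
    hΦ.continuous hSU hSc hScl.isOpen hΦS hg χ hs
  refine ⟨hint, ?_⟩
  -- If χ were trivial on 1 + P_K ^ e', the number e' ≥ 1 would belong to the set whose infimum is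
  -- the conductor.
  obtain ⟨ω, hω, hχω⟩ : ∃ ω : UnitGroup K, ‖(ω : K) - 1‖ ≤ ‖π‖ ^ e' ∧ χ ω ≠ 1 := by
    by_contra! h
    exact hχ (Nat.sInf_le ⟨he', fun u hu => h u (by rwa [hπ.norm_eq])⟩)
  have hboxint : ∀ x ∈ S, x ≠ 0 →
      ∫ y in box M (‖π‖ ^ e) x, Φ y * quasichar π χ s (g y) ∂γ = 0 := by
    intro x hx hx0
    by_cases hV : ∃ y ∈ box M (‖π‖ ^ e) x, y ∈ zeroSet G U
    · obtain ⟨y, hy, hyV⟩ := hV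
      have hyS := hboxS x hx hy
      have hy0 := hbox0 x hx hx0 y hy
      -- Recentre the box at a point of the zero set, as the symmetry requires.
      rw [← box_eq_of_mem_box hn he1 hx0 (hU1 x (hSU hx)) hy]
      obtain ⟨ρ, hρ, hρb, hρF⟩ := hsym y hy0 (mem_closedBall_zero_iff.1 (hUA hyV.1)) hyV.2 ω hω
      have hquasi := setIntegral_quasichar_eq hπ hvol (by omega : k ≤ n) hG1 hU hrank
        ((hboxS y hyS).trans hSU) (isCompact_box M (‖π‖ ^ e) y) (isOpen_box hep hy0) hg hρ hρb
        (fun w hw => funext (hρF w hw).1)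
        (fun w hw => by
          rw [hgS _ (hboxS y hyS hw), hgS _ (hboxS y hyS ((hρb w).2 hw))]
          exact (hρF w hw).2) χ s
      have hzero : ∫ w in box M (‖π‖ ^ e) y, quasichar π χ s (g w) ∂γ = 0 := by
        have h1 : (1 - (χ ω : ℂ)) * ∫ w in box M (‖π‖ ^ e) y, quasichar π χ s (g w) ∂γ = 0 := by
          rw [sub_mul, one_mul, sub_eq_zero]
          exact hquasi
        refine (mul_eq_zero.1 h1).resolve_left fun h2 => hχω ?_
        exact Units.ext (sub_eq_zero.1 h2).symm
      rw [setIntegral_congr_fun (isOpen_box hep hy0).measurableSet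
        (g := fun w => Φ y * quasichar π χ s (g w)) fun w hw => by
          simp only [hboxΦ y hyS w hw], integral_const_mul, hzero, mul_zero]
    · have h0 : γ (box M (‖π‖ ^ e) x) = 0 :=
        measure_mono_null (fun y hy hyV => hV ⟨y, hy, hyV⟩) (gelfandLerayMeasure_compl hG1 hU)
      exact setIntegral_measure_zero _ h0
  have hF00 : evalSeries (F (Fin.last k)) 0 = 0 := by
    rw [evalSeries, tsum_eq_single 0]
    · rw [MvPowerSeries.coeff_zero_eq_constantCoeff_apply, hF0, zero_mul]
    · intro m hm
      obtain ⟨t, ht⟩ := Finsupp.ne_iff.1 hm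
      rw [Finsupp.prod, Finset.prod_eq_zero (i := t) (Finsupp.mem_support_iff.2 ht), mul_zero]
      exact zero_pow ht
  -- Boxes are indexed as sets, so that each occurs once. They are disjoint, open and nonempty,
  -- hence countably many.
  let ι := {b : Set (Fin n → K) // ∃ x ∈ S, x ≠ 0 ∧ box M (‖π‖ ^ e) x = b}
  have hopen : ∀ b : ι, IsOpen b.1 := by
    rintro ⟨_, x, hx, hx0, rfl⟩
    exact isOpen_box hep hx0
  have hdisj : Pairwise (Function.onFun Disjoint fun b : ι => b.1) := by
    rintro ⟨_, x, hx, hx0, rfl⟩ ⟨_, y, hy, hy0, rfl⟩ hne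
    refine Set.disjoint_left.2 fun w hwx hwy => hne (Subtype.ext ?_)
    change box M (‖π‖ ^ e) x = box M (‖π‖ ^ e) y
    rw [← box_eq_of_mem_box hn he1 hx0 (hU1 x (hSU hx)) hwx,
      ← box_eq_of_mem_box hn he1 hy0 (hU1 y (hSU hy)) hwy]
  have : Countable ι := hdisj.countable_of_isOpen_disjoint hopen (by
    rintro ⟨_, x, hx, hx0, rfl⟩
    exact ⟨x, self_mem_box hep.le x⟩)
  rw [← setIntegral_eq_integral_of_forall_compl_eq_zero (s := ⋃ b : ι, b.1),
    integral_iUnion (fun b => (hopen b).measurableSet) hdisj hint.integrableOn]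
  · refine (tsum_congr ?_).trans tsum_zero
    rintro ⟨_, x, hx, hx0, rfl⟩
    exact hboxint x hx hx0
  · intro x hx
    by_cases hxS : x ∈ S
    -- The origin is the only point of the support in no box; the integrand is zero there since
    -- f_l(0) = 0 and Re s > 0.
    · have hx0 : x = 0 := by
        by_contra h
        exact hx (mem_iUnion.2 ⟨⟨_, x, hxS, h, rfl⟩, self_mem_box hep.le x⟩)
      rw [hgS x hxS, hx0, hF00, quasichar_zero π χ hs, mul_zero]
    · rw [hΦS x hxS, zero_mul]

end Vanishing

theorem isRestricted_rescale_of_summable {K : Type*} [NontriviallyNormedField K] {n : ℕ}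
    {F : MvPowerSeries (Fin n) K} {b : Fin n → K}
    (h : Summable fun m : Fin n →₀ ℕ => MvPowerSeries.coeff m F * m.prod fun j e => b j ^ e) :
    IsRestricted (MvPowerSeries.rescale b F) := by
  refine h.tendsto_cofinite_zero.congr fun m => ?_
  rw [MvPowerSeries.coeff_rescale, mul_comm]

end PadicZeta

end

/-- Here `l = k + 1`, and the analytic functions `f_1, …, f_l` are given by the power series
`F 0, …, F k`; the first `k = l - 1` of them define `V^{(l-1)}`. -/
theorem theorem2 {p : ℕ} [Fact p.Prime] {K : Type*} [NontriviallyNormedField K]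
    [IsUltrametricDist K] [Algebra ℚ_[p] K] [FiniteDimensional ℚ_[p] K] [ContinuousSMul ℚ_[p] K]
    [MeasurableSpace K] [BorelSpace K]
    (π : K) (hπ : PadicZeta.IsNormalizedUniformizer π)
    (vol : Measure K) [vol.IsAddHaarMeasure] (hvol : vol (Metric.closedBall (0 : K) 1) = 1)
    {n k : ℕ} (hl : 2 ≤ k + 1) (hln : k + 1 ≤ n)
    (F : Fin (k + 1) → MvPowerSeries (Fin n) K)
    (hF0 : ∀ i, MvPowerSeries.constantCoeff (F i) = 0)
    (hconv : PadicZeta.IsConvenient F) :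
    ∃ U₀ ∈ 𝓝 (0 : Fin n → K), ∀ U : Set (Fin n → K), U ⊆ U₀ → IsOpen U → 0 ∈ U →
      (∀ i, PadicZeta.ConvergesOn (F i) U) →
      PadicZeta.IsNondegenerate F U →
      PadicZeta.IsNondegenerate (fun i : Fin k => F i.castSucc) U →
      (∀ z ∈ PadicZeta.zeroSet (fun i : Fin k => F i.castSucc) U,
        (PadicZeta.jacobian (fun i : Fin k => F i.castSucc) z).rank = k) →
      (∀ c : K, c ≠ 0 → ∀ z ∈ PadicZeta.zeroSet (fun i : Fin k => F i.castSucc) U,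
        PadicZeta.evalSeries (F (Fin.last k)) z = c →
          ExteriorAlgebra.ιMulti K (k + 1) (fun i => PadicZeta.differential (F i) z) ≠ 0) →
      ∀ Φ : (Fin n → K) → ℂ, IsLocallyConstant Φ → HasCompactSupport Φ → tsupport Φ ⊆ U →
        ∃ e : ℕ, 0 < e ∧ ∀ χ : PadicZeta.UnitGroup K →ₜ* ℂˣ, ¬ PadicZeta.conductor χ ≤ e →
          (∃ Z : ℂ → ℂ, PadicZeta.IsLocalZeta vol π F U Φ χ Z) ∧
          ∀ Z : ℂ → ℂ, PadicZeta.IsLocalZeta vol π F U Φ χ Z → ∀ s : ℂ, Z s = 0 := by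
  have : LocallyCompactSpace K := LocallyCompactSpace.of_finiteDimensional_of_complete ℚ_[p] K
  have : ProperSpace K := ProperSpace.of_locallyCompactSpace K
  have : CharZero K := charZero_of_injective_algebraMap (algebraMap ℚ_[p] K).injective
  -- U₀ precedes U, but the bounds need non-degeneracy on some neighbourhood. If one such U₁ exists,
  -- it serves for every U inside U₀; if none exists, there is nothing to prove.
  by_cases hex : ∃ U₁ : Set (Fin n → K), IsOpen U₁ ∧ 0 ∈ U₁ ∧
      (∀ i, PadicZeta.ConvergesOn (F i) U₁) ∧ PadicZeta.IsNondegenerate F U₁ ∧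
      PadicZeta.IsNondegenerate (fun i : Fin k => F i.castSucc) U₁
  swap
  · exact ⟨univ, univ_mem, fun U _ hU h0 hc hnd hnd' => absurd ⟨U, hU, h0, hc, hnd, hnd'⟩ hex⟩
  obtain ⟨U₁, hU₁, h0, hc, hnd, hnd'⟩ := hex
  choose d _ hd using hconv
  have hM : ∀ i t, ∃ e, e ≤ ∑ i, ∑ t, d i t ∧
      MvPowerSeries.coeff (Finsupp.single t e) (F i) ≠ 0 := fun i t =>
    ⟨d i t, (Finset.single_le_sum (f := d i) (fun _ _ => Nat.zero_le _) (Finset.mem_univ t)).trans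
      (Finset.single_le_sum (f := fun i => ∑ t, d i t) (fun _ _ => Nat.zero_le _)
        (Finset.mem_univ i)), hd i t⟩
  -- Convergence at the single point (π ^ N, …, π ^ N) makes the coefficients rescaled by π ^ N tend
  -- to zero.
  obtain ⟨N, hN⟩ : ∃ N : ℕ, (fun _ => π ^ N : Fin n → K) ∈ U₁ := by
    have : Tendsto (fun N : ℕ => (fun _ => π ^ N : Fin n → K)) atTop (𝓝 0) :=
      tendsto_pi_nhds.2 fun _ => tendsto_pow_atTop_nhds_zero_of_norm_lt_one hπ.norm_lt_one
    exact (this.eventually (hU₁.mem_nhds h0)).exists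
  obtain ⟨U₀, hU₀, h⟩ := PadicZeta.exists_integral_eq_zero (vol := vol) hπ hvol hln hF0 hM
    (fun i => PadicZeta.isRestricted_rescale_of_summable (hc i _ hN)) (hU₁.mem_nhds h0) hnd hnd'
  refine ⟨U₀, hU₀, fun U hUU₀ hU _ _ _ _ hrank _ Φ hΦ hΦc hΦU => ?_⟩
  obtain ⟨e, he, hχ⟩ := h U hUU₀ hU hrank Φ hΦ hΦc hΦU
  -- The zero function is a meromorphic continuation, and any other one agrees with it on Re s > 0.
  refine ⟨e, he, fun χ hcond => ⟨⟨fun _ => 0, fun s hs => (hχ χ hcond s hs).1,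
    fun s hs => (hχ χ hcond s hs).2.symm, fun s _ => analyticAt_const.meromorphicNFAt⟩,
    fun Z hZ => ?_⟩⟩
  exact PadicZeta.eq_zero_of_meromorphicNFOn hZ.meromorphic fun s hs => by
    rw [hZ.eq_integral s hs, (hχ χ hcond s hs).2]
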